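/- Let $k$ be a field of characteristic $3$ and let $V$ be a two-dimensional vector space over $k$ with a nonzero alternating bilinear form $\langle\cdot|\cdot\rangle$. All signs $(-1)^{xy}$ refer to parities of homogeneous elements $x,y$ and equal $-1$ exactly when both are odd. *Hurwitz superalgebras.* Let $B(1,2)=k1\oplus V$ (even part $k1$, odd part $V$) with unit $1$, $uv=\langle u|v\rangle 1$ for $u,v\in V$, and even bilinear form $b$ given by $b(1,1)=2$, $b(u,v)=\langle u|v\rangle$. Let $B(4,2)=\operatorname{End}_k(V)\oplus V$ (even part $\operatorname{End}_k(V)$, odd part $V$), with composition as product on $\operatorname{End}_k(V)$, $v\cdot f=f(v)=\bar f\cdot v$ (where $\bar f=\operatorname{tr}(f)1-f$) and $u\cdot v=\big(w\mapsto\langle w|u\rangle v\big)$, and with the even bilinear form $b$ which is the polar form of $\det$ on $\operatorname{End}_k(V)$ and $b(u,v)=\langle u|v\rangle$ on $V$. Let $\mathrm{Mat}_2(k)$ have as $b$ the polar form of $\det$. For each such $C$ put $\bar x=b(x,1)1-x$, and let $\bar C$ be the space $C$ with the same form $b$ and the product $x\bullet y=\bar x\,\bar y$. Put $S_4=\overline{\mathrm{Mat}_2(k)}$,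 $S_{1,2}=\overline{B(1,2)}$, $S_{4,2}=\overline{B(4,2)}$. *The superalgebra $\mathfrak g(S,S')$.* For $S$ one of these, $\mathfrak{osp}(S)$ is spanned by the homogeneous $d\in\operatorname{End}_k(S)$ with $b(d(x),y)+(-1)^{dx}b(x,d(y))=0$, and $\mathfrak{tri}(S)=\mathfrak{tri}(S)_{\bar 0}\oplus\mathfrak{tri}(S)_{\bar 1}$, where $\mathfrak{tri}(S)_{\bar\imath}$ consists of the triples $(d_0,d_1,d_2)\in\mathfrak{osp}(S)_{\bar\imath}^3$ with $d_0(x\bullet y)=d_1(x)\bullet y+(-1)^{ix}x\bullet d_2(y)$. Put $\theta(d_0,d_1,d_2)=(d_2,d_0,d_1)$, $l_x(y)=x\bullet y$, $r_x(y)=(-1)^{xy}y\bullet x$, $\sigma_{x,y}(z)=(-1)^{yz}b(x,z)y-(-1)^{x(y+z)}b(y,z)x$ and $t_{x,y}=\big(\sigma_{x,y},\tfrac12b(x,y)1-r_xl_y,\tfrac12b(x,y)1-l_xr_y\big)$; write $b',\theta',t'$ for $S'$. Then $$\mathfrak g(S,S')=\mathfrak{tri}(S)\oplus\mathfrak{tri}(S')\oplus\bigoplus_{i=0}^{2}\iota_i(S\otimes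 S'),$$ where $\iota_i(S\otimes S')$ is a copy of $S\otimes S'$, with the superanticommutative bracket such that (indices modulo $3$, homogeneous elements): $\mathfrak{tri}(S)$ and $\mathfrak{tri}(S')$ have the componentwise supercommutator and commute with each other; $[(d_0,d_1,d_2),\iota_i(x\otimes x')]=\iota_i(d_i(x)\otimes x')$; $[(d'_0,d'_1,d'_2),\iota_i(x\otimes x')]=(-1)^{d'_ix}\iota_i(x\otimes d'_i(x'))$; $[\iota_i(x\otimes x'),\iota_{i+1}(y\otimes y')]=(-1)^{x'y}\iota_{i+2}((x\bullet y)\otimes(x'\bullet y'))$; and $[\iota_i(x\otimes x'),\iota_i(y\otimes y')]=(-1)^{xx'+xy'+yy'}b'(x',y')\theta^i(t_{x,y})+(-1)^{yx'}b(x,y)\theta'^i(t'_{x',y'})$. *The Tits–Kantor–Koecher superalgebra.* For $C=B(1,2)$ or $B(4,2)$ let $H_3(C)$ be the superalgebra of the $3\times3$ matrices $(a_{ij})$ over $C$ with $a_{ij}=\overline{a_{ji}}$, with product $x\circ y=\tfrac12(xy+(-1)^{xy}yx)$. For a Jordan superalgebra $J$, let $\operatorname{der}J$ be its Lie superalgebra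 of superderivations, $d_{x,y}=[L_x,L_y]$ the supercommutator of left multiplications, and $\mathcal{TKK}(J)=(\mathfrak{sl}_2(k)\otimes J)\oplus\operatorname{der}J$, with the supercommutator on $\operatorname{der}J$, $[d,a\otimes x]=a\otimes d(x)$ and $[a\otimes x,c\otimes y]=[a,c]\otimes(x\circ y)-2b(a,c)\,d_{x,y}$, where $b$ is the polar form of $\det$ on $\mathrm{Mat}_2(k)$, extended superanticommutatively. **Claim.** $\mathfrak g(S_4,S_{1,2})$, $\mathfrak g(S_4,S_{4,2})$, $\mathcal{TKK}(H_3(B(1,2)))$ and $\mathcal{TKK}(H_3(B(4,2)))$, with the brackets above, are Lie superalgebras, and there are isomorphisms of Lie superalgebras $$\mathfrak g(S_4,S_{1,2})\cong\mathcal{TKK}\big(H_3(B(1,2))\big),\qquad \mathfrak g(S_4,S_{4,2})\cong\mathcal{TKK}\big(H_3(B(4,2))\big).$$ -/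

import Mathlib

open scoped TensorProduct

namespace SuperSquare

/-- The sign `(-1)^{ij}`: it is `-1` if `i` and `j` are both odd, and `1` otherwise. -/
def ksign (k : Type*) [Field k] (i j : ZMod 2) : k := if i = 1 ∧ j = 1 then -1 else 1

theorem ksign_zero_left (k : Type*) [Field k] (i : ZMod 2) : ksign k 0 i = 1 := by simp [ksign]

theorem ksign_zero_right (k : Type*) [Field k] (i : ZMod 2) : ksign k i 0 = 1 := by simp [ksign]

theorem ksign_mul_self (k : Type*) [Field k] (i j : ZMod 2) : ksign k i j * ksign k i j = 1 := by
  unfold ksign; split_ifs <;> simp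

theorem ksign_comm (k : Type*) [Field k] (i j : ZMod 2) : ksign k i j = ksign k j i := by
  unfold ksign; simp [and_comm]

/-- A `ℤ/2`-grading of the vector space `A`, given by the two projections onto its homogeneous
components. -/
structure Grading (k A : Type*) [Field k] [AddCommGroup A] [Module k A] where
  pr : ZMod 2 → A →ₗ[k] A
  pr_pr : ∀ i j x, pr i (pr j x) = if i = j then pr j x else 0
  pr_add : ∀ x, pr 0 x + pr 1 x = x

section Gradings

variable {k A B C : Type*} [Field k] [AddCommGroup A] [Module k A] [AddCommGroup B] [Module k B]
  [AddCommGroup C] [Module k C]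

theorem sum_zmod_two {M : Type*} [AddCommMonoid M] (f : ZMod 2 → M) : ∑ i, f i = f 0 + f 1 :=
  Fin.sum_univ_two f

theorem zmod_two_cases (i : ZMod 2) : i = 0 ∨ i = 1 := by
  revert i; decide

theorem zmod_two_one_add_one : (1 : ZMod 2) + 1 = 0 := rfl

/-- The homogeneous component of degree `i`. -/
def Grading.part (P : Grading k A) (i : ZMod 2) : Submodule k A := LinearMap.range (P.pr i)

theorem Grading.mem_part {P : Grading k A} {i : ZMod 2} {x : A} :
    x ∈ P.part i ↔ P.pr i x = x := by
  constructor
  · rintro ⟨y, rfl⟩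
    simp [P.pr_pr]
  · intro h
    exact ⟨x, h⟩

theorem Grading.pr_mem (P : Grading k A) (i : ZMod 2) (x : A) : P.pr i x ∈ P.part i := ⟨x, rfl⟩

theorem Grading.pr_of_mem {P : Grading k A} {i : ZMod 2} {x : A} (h : x ∈ P.part i) (j : ZMod 2) :
    P.pr j x = if j = i then x else 0 := by
  rw [← Grading.mem_part.1 h, P.pr_pr]

/-- The grading of a space that is concentrated in degree `0`. -/
def Grading.trivial (k A : Type*) [Field k] [AddCommGroup A] [Module k A] : Grading k A where
  pr i := if i = 0 then LinearMap.id else 0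
  pr_pr i j x := by
    rcases zmod_two_cases i with rfl | rfl <;> rcases zmod_two_cases j with rfl | rfl <;> simp
  pr_add x := by simp

/-- The grading of `E × O` whose even part is `E` and whose odd part is `O`. -/
def Grading.evenOdd (k E O : Type*) [Field k] [AddCommGroup E] [Module k E] [AddCommGroup O]
    [Module k O] : Grading k (E × O) where
  pr i := if i = 0 then LinearMap.inl k E O ∘ₗ LinearMap.fst k E O
    else LinearMap.inr k E O ∘ₗ LinearMap.snd k E O
  pr_pr i j x := by
    rcases zmod_two_cases i with rfl | rfl <;> rcases zmod_two_cases j with rfl | rfl <;> simp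
  pr_add x := by simp

/-- The componentwise grading of a direct sum. -/
def Grading.prod (P : Grading k A) (Q : Grading k B) : Grading k (A × B) where
  pr i := (P.pr i).prodMap (Q.pr i)
  pr_pr i j x := by
    by_cases h : i = j <;> simp [P.pr_pr, Q.pr_pr, h]
  pr_add x := by simp [P.pr_add, Q.pr_add]

/-- The componentwise grading of a power. -/
def Grading.pi (ι : Type*) (P : Grading k A) : Grading k (ι → A) where
  pr i := LinearMap.pi fun m => P.pr i ∘ₗ LinearMap.proj m
  pr_pr i j x := by
    ext m
    by_cases h : i = j <;> simp [P.pr_pr, h]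
  pr_add x := by
    ext m
    simp [P.pr_add]

/-- The entrywise grading of the square matrices with entries in a graded space. -/
def Grading.matrix (ι : Type*) (P : Grading k A) : Grading k (Matrix ι ι A) where
  pr i := (P.pr i).mapMatrix
  pr_pr i j x := by
    ext m n
    by_cases h : i = j <;> simp [P.pr_pr, h]
  pr_add x := by
    ext m n
    simp [P.pr_add]

/-- The grading of `End A`: an endomorphism is of degree `i` if it maps `A_j` into `A_{i+j}`. -/
def Grading.hom (P : Grading k A) : Grading k (Module.End k A) where
  pr i := ∑ j, LinearMap.lcomp k A (P.pr j) ∘ₗ LinearMap.llcomp k A A A (P.pr (i + j))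
  pr_pr i j f := by
    ext x
    rcases zmod_two_cases i with rfl | rfl <;> rcases zmod_two_cases j with rfl | rfl <;>
      simp [sum_zmod_two, P.pr_pr, zmod_two_one_add_one]
  pr_add f := by
    ext x
    have h := P.pr_add
    simp only [sum_zmod_two, LinearMap.add_apply, LinearMap.comp_apply, LinearMap.lcomp_apply,
      LinearMap.llcomp_apply, add_zero, zero_add,
      zmod_two_one_add_one]
    calc _ = (P.pr 0 (f (P.pr 0 x)) + P.pr 1 (f (P.pr 0 x)))
          + (P.pr 0 (f (P.pr 1 x)) + P.pr 1 (f (P.pr 1 x))) := by abel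
      _ = f x := by rw [h, h, ← map_add, h]

/-- The grading of a tensor product: `A_i ⊗ B_j` has degree `i + j`. -/
def Grading.tensor (P : Grading k A) (Q : Grading k B) : Grading k (A ⊗[k] B) where
  pr i := ∑ j, TensorProduct.map (P.pr j) (Q.pr (i + j))
  pr_pr i j x := by
    induction x with
    | zero => simp
    | add x y hx hy => 
      rw [map_add, map_add, hx, hy]
      split_ifs <;> simp
    | tmul x y =>
      rcases zmod_two_cases i with rfl | rfl <;> rcases zmod_two_cases j with rfl | rfl <;>
        simp [sum_zmod_two, P.pr_pr, Q.pr_pr, zmod_two_one_add_one]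
  pr_add x := by
    induction x with
    | zero => simp
    | add x y hx hy =>
      rw [map_add, map_add, add_add_add_comm, hx, hy]
    | tmul x y =>
      simp only [sum_zmod_two, LinearMap.add_apply, TensorProduct.map_tmul, add_zero, zero_add,
      zmod_two_one_add_one]
      calc _ = P.pr 0 x ⊗ₜ[k] (Q.pr 0 y + Q.pr 1 y) + P.pr 1 x ⊗ₜ[k] (Q.pr 0 y + Q.pr 1 y) := by
            simp only [TensorProduct.tmul_add]; abel
        _ = x ⊗ₜ[k] y := by rw [Q.pr_add, ← TensorProduct.add_tmul, P.pr_add]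

/-- The bilinear map whose value on homogeneous `x ∈ A_i` and `y ∈ B_j` is `F i j x y`. -/
def homBilin (P : Grading k A) (Q : Grading k B) (F : ZMod 2 → ZMod 2 → A →ₗ[k] B →ₗ[k] C) :
    A →ₗ[k] B →ₗ[k] C :=
  ∑ i, ∑ j, (F i j).compl₁₂ (P.pr i) (Q.pr j)

theorem homBilin_apply (P : Grading k A) (Q : Grading k B)
    (F : ZMod 2 → ZMod 2 → A →ₗ[k] B →ₗ[k] C) {i j : ZMod 2} {x : A} {y : B}
    (hx : x ∈ P.part i) (hy : y ∈ Q.part j) : homBilin P Q F x y = F i j x y := by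
  simp [homBilin, Grading.pr_of_mem hx, Grading.pr_of_mem hy, apply_ite, ite_apply,
    LinearMap.sum_apply]

/-- The bilinear map `(y, x) ↦ (-1)^{xy} F(x, y)` (for homogeneous `x` and `y`). -/
def superFlip (P : Grading k A) (Q : Grading k B) (F : A →ₗ[k] B →ₗ[k] C) :
    B →ₗ[k] A →ₗ[k] C :=
  homBilin Q P fun j i => ksign k i j • F.flip

theorem superFlip_apply (P : Grading k A) (Q : Grading k B) (F : A →ₗ[k] B →ₗ[k] C)
    {i j : ZMod 2} {x : A} {y : B} (hx : x ∈ P.part i) (hy : y ∈ Q.part j) :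
    superFlip P Q F y x = ksign k i j • F x y := by
  rw [superFlip, homBilin_apply _ _ _ hy hx, ksign_comm]
  rfl

theorem bilin_ext (P : Grading k A) (Q : Grading k B) {F G : A →ₗ[k] B →ₗ[k] C}
    (h : ∀ i j x y, x ∈ P.part i → y ∈ Q.part j → F x y = G x y) : F = G := by
  ext x y
  rw [← P.pr_add x, ← Q.pr_add y]
  simp only [map_add, LinearMap.add_apply]
  rw [h 0 0 _ _ (P.pr_mem 0 x) (Q.pr_mem 0 y), h 0 1 _ _ (P.pr_mem 0 x) (Q.pr_mem 1 y),
    h 1 0 _ _ (P.pr_mem 1 x) (Q.pr_mem 0 y), h 1 1 _ _ (P.pr_mem 1 x) (Q.pr_mem 1 y)]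

/-- The supercommutator `[f, g] = f g - (-1)^{fg} g f` on `End A`. -/
def superComm (P : Grading k A) :
    Module.End k A →ₗ[k] Module.End k A →ₗ[k] Module.End k A :=
  LinearMap.mul k (Module.End k A) - superFlip P.hom P.hom (LinearMap.mul k (Module.End k A))

/-- The bilinear map on `A ⊗ B` which, for homogeneous `x, y ∈ A` and `x', y' ∈ B` of respective
degrees `a, c` and `b, d`, is given by
`(x ⊗ x', y ⊗ y') ↦ s a b c d • (F(x, y) ⊗ G(x', y'))`. -/
def tensorBilin {D E : Type*} [AddCommGroup D] [Module k D] [AddCommGroup E] [Module k E]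
    (P : Grading k A) (Q : Grading k B) (s : ZMod 2 → ZMod 2 → ZMod 2 → ZMod 2 → k)
    (F : A →ₗ[k] A →ₗ[k] D) (G : B →ₗ[k] B →ₗ[k] E) :
    A ⊗[k] B →ₗ[k] A ⊗[k] B →ₗ[k] D ⊗[k] E :=
  ∑ a, ∑ b, ∑ c, ∑ d, s a b c d •
    TensorProduct.map₂ (F.compl₁₂ (P.pr a) (P.pr c)) (G.compl₁₂ (Q.pr b) (Q.pr d))

theorem tensorBilin_apply {D E : Type*} [AddCommGroup D] [Module k D] [AddCommGroup E] [Module k E]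
    (P : Grading k A) (Q : Grading k B) (s : ZMod 2 → ZMod 2 → ZMod 2 → ZMod 2 → k)
    (F : A →ₗ[k] A →ₗ[k] D) (G : B →ₗ[k] B →ₗ[k] E) {a b c d : ZMod 2} {x y : A} {x' y' : B}
    (hx : x ∈ P.part a) (hx' : x' ∈ Q.part b) (hy : y ∈ P.part c) (hy' : y' ∈ Q.part d) :
    tensorBilin P Q s F G (x ⊗ₜ x') (y ⊗ₜ y') = s a b c d • (F x y ⊗ₜ[k] G x' y') := by
  have hp : ∀ i, P.pr i x = if i = a then x else 0 := Grading.pr_of_mem hx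
  have hp' : ∀ i, Q.pr i x' = if i = b then x' else 0 := Grading.pr_of_mem hx'
  have hq : ∀ i, P.pr i y = if i = c then y else 0 := Grading.pr_of_mem hy
  have hq' : ∀ i, Q.pr i y' = if i = d then y' else 0 := Grading.pr_of_mem hy'
  simp only [tensorBilin, LinearMap.sum_apply, LinearMap.smul_apply]
  rw [Finset.sum_eq_single a, Finset.sum_eq_single b, Finset.sum_eq_single c,
    Finset.sum_eq_single d]
  · simp [hp, hp', hq, hq']
  · intro e _ he
    simp [hq', he]
  · simp
  · intro e _ he
    simp [hq, he]
  · simp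
  · intro e _ he
    simp [hp', he]
  · simp
  · intro e _ he
    simp [hp, he]
  · simp

end Gradings

/-- A (not necessarily associative) superalgebra. -/
structure Superalgebra (k A : Type*) [Field k] [AddCommGroup A] [Module k A] where
  grading : Grading k A
  mul : A →ₗ[k] A →ₗ[k] A
  mul_mem : ∀ i j x y, x ∈ grading.part i → y ∈ grading.part j → mul x y ∈ grading.part (i + j)

/-- A superalgebra with an even bilinear form: the polar form `b` of a norm.  The characteristic
is not two in what follows, so that the norm on the even part is `q(x) = b(x, x) / 2`. -/
structure NormedSuperalgebra (k A : Type*) [Field k] [AddCommGroup A] [Module k A] extends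
    Superalgebra k A where
  polar : A →ₗ[k] A →ₗ[k] k
  polar_even : ∀ i j x y, x ∈ grading.part i → y ∈ grading.part j → i ≠ j → polar x y = 0

/-- A Hurwitz superalgebra, that is, a unital composition superalgebra, in characteristic
different from two. -/
structure HurwitzSuperalgebra (k A : Type*) [Field k] [AddCommGroup A] [Module k A] extends
    NormedSuperalgebra k A where
  one : A
  one_mem : one ∈ grading.part 0
  one_mul : ∀ x, mul one x = x
  mul_one : ∀ x, mul x one = x
  polar_symm : ∀ i j x y, x ∈ grading.part i → y ∈ grading.part j →
    polar x y = ksign k i j * polar y x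
  nondegenerate : ∀ x, (∀ y, polar x y = 0) → x = 0
  composition : ∀ a b c d x y z t, x ∈ grading.part a → y ∈ grading.part b →
    z ∈ grading.part c → t ∈ grading.part d →
    polar (mul x y) (mul z t) + ksign k a b * ksign k a c * ksign k b c *
      polar (mul z y) (mul x t) = ksign k b c * polar x z * polar y t

section Constructions

variable {k A B : Type*} [Field k] [AddCommGroup A] [Module k A] [AddCommGroup B] [Module k B]

/-- Inner derivations `d_{x,y} = [L_x, L_y]`, where `L_x` is the left multiplication by `x`. -/
def innerDer (J : Superalgebra k A) : A →ₗ[k] A →ₗ[k] Module.End k A :=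
  (superComm J.grading).compl₁₂ J.mul J.mul

/-- The superderivations of degree `i`. -/
def derPart (J : Superalgebra k A) (i : ZMod 2) : Submodule k (Module.End k A) where
  carrier := {d | d ∈ J.grading.hom.part i ∧ ∀ j x y, x ∈ J.grading.part j →
    d (J.mul x y) = J.mul (d x) y + ksign k i j • J.mul x (d y)}
  zero_mem' := ⟨zero_mem _, by simp⟩
  add_mem' := by
    rintro d e ⟨hd, hd'⟩ ⟨he, he'⟩
    refine ⟨add_mem hd he, fun j x y hx => ?_⟩
    simp only [LinearMap.add_apply, hd' j x y hx, he' j x y hx, map_add]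
    module
  smul_mem' := by
    rintro c d ⟨hd, hd'⟩
    refine ⟨Submodule.smul_mem _ c hd, fun j x y hx => ?_⟩
    simp only [LinearMap.smul_apply, hd' j x y hx, map_smul]
    module

/-- The space `der J` of superderivations. -/
def der (J : Superalgebra k A) : Submodule k (Module.End k A) := derPart J 0 ⊔ derPart J 1

/-- The homogeneous component of degree `i` of the orthosymplectic Lie superalgebra. -/
def ospPart (S : NormedSuperalgebra k A) (i : ZMod 2) : Submodule k (Module.End k A) where
  carrier := {d | d ∈ S.grading.hom.part i ∧ ∀ j x y, x ∈ S.grading.part j →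
    S.polar (d x) y + ksign k i j * S.polar x (d y) = 0}
  zero_mem' := ⟨zero_mem _, by simp⟩
  add_mem' := by
    rintro d e ⟨hd, hd'⟩ ⟨he, he'⟩
    refine ⟨add_mem hd he, fun j x y hx => ?_⟩
    simp only [LinearMap.add_apply, map_add]
    linear_combination hd' j x y hx + he' j x y hx
  smul_mem' := by
    rintro c d ⟨hd, hd'⟩
    refine ⟨Submodule.smul_mem _ c hd, fun j x y hx => ?_⟩
    simp only [LinearMap.smul_apply, map_smul, smul_eq_mul]
    linear_combination c * hd' j x y hx

/-- The homogeneous component of degree `i` of the triality Lie superalgebra. -/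
def triPart (S : NormedSuperalgebra k A) (i : ZMod 2) :
    Submodule k (Fin 3 → Module.End k A) where
  carrier := {d | (∀ m, d m ∈ ospPart S i) ∧ ∀ j x y, x ∈ S.grading.part j →
    d 0 (S.mul x y) = S.mul (d 1 x) y + ksign k i j • S.mul x (d 2 y)}
  zero_mem' := ⟨fun _ => zero_mem _, by simp⟩
  add_mem' := by
    rintro d e ⟨hd, hd'⟩ ⟨he, he'⟩
    refine ⟨fun m => add_mem (hd m) (he m), fun j x y hx => ?_⟩
    simp only [Pi.add_apply, LinearMap.add_apply, hd' j x y hx, he' j x y hx, map_add]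
    module
  smul_mem' := by
    rintro c d ⟨hd, hd'⟩
    refine ⟨fun m => Submodule.smul_mem _ c (hd m), fun j x y hx => ?_⟩
    simp only [Pi.smul_apply, LinearMap.smul_apply, hd' j x y hx, map_smul]
    module

/-- The triality Lie superalgebra `tri(S)`, as a subspace of `End(S)³`. -/
def tri (S : NormedSuperalgebra k A) : Submodule k (Fin 3 → Module.End k A) :=
  triPart S 0 ⊔ triPart S 1

/-- `σ_{x,y}(z) = (-1)^{yz} b(x,z) y - (-1)^{x(y+z)} b(y,z) x` for homogeneous `x, y, z`. -/
def sigma (S : NormedSuperalgebra k A) : A →ₗ[k] A →ₗ[k] Module.End k A :=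
  ∑ l, homBilin S.grading S.grading fun i j => LinearMap.mk₂ k
    (fun x y => (ksign k j l • (S.polar x).smulRight y -
      ksign k i (j + l) • (S.polar y).smulRight x) ∘ₗ S.grading.pr l)
    (fun x x' y => by ext; simp; module) (fun c x y => by ext; simp; module)
    (fun x y y' => by ext; simp; module) (fun c x y => by ext; simp; module)

/-- The triple `t_{x,y} = (σ_{x,y}, b(x,y)/2 - r_x l_y, b(x,y)/2 - l_x r_y)`, where `l_x(y) = xy`
and `r_x(y) = (-1)^{xy} yx`. -/
def tElem (S : NormedSuperalgebra k A) : A →ₗ[k] A →ₗ[k] (Fin 3 → Module.End k A) :=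
  LinearMap.mk₂ k
    (fun x y => ![sigma S x y,
      (2⁻¹ * S.polar x y) • LinearMap.id -
        superFlip S.grading S.grading S.mul x ∘ₗ S.mul y,
      (2⁻¹ * S.polar x y) • LinearMap.id -
        S.mul x ∘ₗ superFlip S.grading S.grading S.mul y])
    (fun x x' y => by ext m z; fin_cases m <;> simp <;> module)
    (fun c x y => by ext m z; fin_cases m <;> simp <;> module)
    (fun x y y' => by ext m z; fin_cases m <;> simp <;> module)
    (fun c x y => by ext m z; fin_cases m <;> simp <;> module)

/-- A bilinear bracket on a graded space, together with a subspace.  This is the way in which Lie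
superalgebras are presented here: as subspaces of a larger space on which the formula for the
bracket makes sense. -/
structure BracketSpace (k A : Type*) [Field k] [AddCommGroup A] [Module k A] where
  grading : Grading k A
  bracket : A →ₗ[k] A →ₗ[k] A
  carrier : Submodule k A

/-- The subspace is a graded subspace, closed under the bracket, and is a Lie superalgebra with
it.  The last condition follows from the others if the characteristic is neither two nor three. -/
structure BracketSpace.IsLieSuperalgebra (L : BracketSpace k A) : Prop where
  pr_mem : ∀ i, ∀ x ∈ L.carrier, L.grading.pr i x ∈ L.carrier
  bracket_mem : ∀ x ∈ L.carrier, ∀ y ∈ L.carrier, L.bracket x y ∈ L.carrier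
  bracket_degree : ∀ i j, ∀ x ∈ L.carrier, ∀ y ∈ L.carrier, x ∈ L.grading.part i →
    y ∈ L.grading.part j → L.bracket x y ∈ L.grading.part (i + j)
  skew : ∀ i j, ∀ x ∈ L.carrier, ∀ y ∈ L.carrier, x ∈ L.grading.part i →
    y ∈ L.grading.part j → L.bracket x y = -(ksign k i j • L.bracket y x)
  jacobi : ∀ i j, ∀ x ∈ L.carrier, ∀ y ∈ L.carrier, ∀ z ∈ L.carrier, x ∈ L.grading.part i →
    y ∈ L.grading.part j → L.bracket x (L.bracket y z) =
      L.bracket (L.bracket x y) z + ksign k i j • L.bracket y (L.bracket x z)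
  odd_cube : ∀ x ∈ L.carrier, x ∈ L.grading.part 1 → L.bracket x (L.bracket x x) = 0

/-- Isomorphism: an even linear bijection between the two subspaces that preserves brackets.  It
is used for Lie superalgebras only, so that the bracket of two elements of the subspace is in it. -/
def BracketSpace.Isomorphic (L : BracketSpace k A) (M : BracketSpace k B) : Prop :=
  ∃ Φ : L.carrier ≃ₗ[k] M.carrier,
    (∀ i (x : L.carrier), (x : A) ∈ L.grading.part i → (Φ x : B) ∈ M.grading.part i) ∧
    ∀ x y z : L.carrier, (z : A) = L.bracket x y → (Φ z : B) = M.bracket (Φ x) (Φ y)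

/-- The action `(d', x ⊗ x') ↦ (-1)^{d' x} x ⊗ d'(x')`. -/
def actRight (P : Grading k A) (Q : Grading k B) :
    Module.End k B →ₗ[k] A ⊗[k] B →ₗ[k] A ⊗[k] B :=
  ∑ i, ∑ j, ksign k i j •
    (LinearMap.lTensorHom A).compl₁₂ (Q.hom.pr i) (LinearMap.rTensor B (P.pr j))

/-- `[ι_i(x ⊗ x'), ι_{i+1}(y ⊗ y')] = (-1)^{x'y} ι_{i+2}(xy ⊗ x'y')`. -/
def brNext (S : NormedSuperalgebra k A) (S' : NormedSuperalgebra k B) :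
    A ⊗[k] B →ₗ[k] A ⊗[k] B →ₗ[k] A ⊗[k] B :=
  tensorBilin S.grading S'.grading (fun _ b c _ => ksign k b c) S.mul S'.mul

/-- `(x ⊗ x', y ⊗ y') ↦ (-1)^{xx' + xy' + yy'} b'(x', y') t_{x,y}`. -/
def brSameLeft (S : NormedSuperalgebra k A) (S' : NormedSuperalgebra k B) :
    A ⊗[k] B →ₗ[k] A ⊗[k] B →ₗ[k] (Fin 3 → Module.End k A) :=
  (tensorBilin S.grading S'.grading (fun a b c d => ksign k a b * ksign k a d * ksign k c d)
    (tElem S) S'.polar).compr₂ (TensorProduct.rid k _).toLinearMap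

/-- `(x ⊗ x', y ⊗ y') ↦ (-1)^{yx'} b(x, y) t'_{x',y'}`. -/
def brSameRight (S : NormedSuperalgebra k A) (S' : NormedSuperalgebra k B) :
    A ⊗[k] B →ₗ[k] A ⊗[k] B →ₗ[k] (Fin 3 → Module.End k B) :=
  (tensorBilin S.grading S'.grading (fun _ b c _ => ksign k c b)
    S.polar (tElem S')).compr₂ (TensorProduct.lid k _).toLinearMap

/-- The space `End(S)³ ⊕ End(S')³ ⊕ (S ⊗ S')³`, which contains `g(S, S')`.  An element is
`(d, d', z)`, where `z i` is the component in `ι_i(S ⊗ S')`. -/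
abbrev Amb (k A B : Type*) [Field k] [AddCommGroup A] [Module k A] [AddCommGroup B]
    [Module k B] : Type _ :=
  (Fin 3 → Module.End k A) × (Fin 3 → Module.End k B) × (Fin 3 → A ⊗[k] B)

/-- The grading of `End(S)³ ⊕ End(S')³ ⊕ (S ⊗ S')³`. -/
def ambGrading (S : NormedSuperalgebra k A) (S' : NormedSuperalgebra k B) :
    Grading k (Amb k A B) :=
  (S.grading.hom.pi (Fin 3)).prod
    ((S'.grading.hom.pi (Fin 3)).prod ((S.grading.tensor S'.grading).pi (Fin 3)))

/-- The bracket of `g(S, S')`.  The automorphism `θ (d₀, d₁, d₂) = (d₂, d₀, d₁)` gives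
`(θ^i d)_m = d_{m-i}`, indices modulo three.  The brackets that are listed only in one order of the
two arguments are extended by superanticommutativity. -/
def squareBracket (S : NormedSuperalgebra k A) (S' : NormedSuperalgebra k B) :
    Amb k A B →ₗ[k] Amb k A B →ₗ[k] Amb k A B :=
  let T := S.grading.tensor S'.grading
  LinearMap.mk₂ k
    (fun X Y =>
      (fun m => superComm S.grading (X.1 m) (Y.1 m)
          + ∑ i, brSameLeft S S' (X.2.2 i) (Y.2.2 i) (m - i),
       fun m => superComm S'.grading (X.2.1 m) (Y.2.1 m)
          + ∑ i, brSameRight S S' (X.2.2 i) (Y.2.2 i) (m - i),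
       fun m => LinearMap.rTensorHom B (X.1 m) (Y.2.2 m)
          - superFlip S.grading.hom T (LinearMap.rTensorHom B) (X.2.2 m) (Y.1 m)
          + actRight S.grading S'.grading (X.2.1 m) (Y.2.2 m)
          - superFlip S'.grading.hom T (actRight S.grading S'.grading) (X.2.2 m) (Y.2.1 m)
          + brNext S S' (X.2.2 (m + 1)) (Y.2.2 (m + 2))
          - superFlip T T (brNext S S') (X.2.2 (m + 2)) (Y.2.2 (m + 1))))
    (fun X X' Y => by
      refine Prod.ext (funext fun m => ?_) (Prod.ext (funext fun m => ?_) (funext fun m => ?_)) <;>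
      simp only [Prod.fst_add, Prod.snd_add, Pi.add_apply, map_add, LinearMap.add_apply,
        Finset.sum_add_distrib] <;> abel)
    (fun c X Y => by
      refine Prod.ext (funext fun m => ?_) (Prod.ext (funext fun m => ?_) (funext fun m => ?_)) <;>
      simp only [Prod.smul_fst, Prod.smul_snd, Pi.smul_apply, map_smul, LinearMap.smul_apply,
        ← Finset.smul_sum] <;> module)
    (fun X Y Y' => by
      refine Prod.ext (funext fun m => ?_) (Prod.ext (funext fun m => ?_) (funext fun m => ?_)) <;>
      simp only [Prod.fst_add, Prod.snd_add, Pi.add_apply, map_add,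
        Finset.sum_add_distrib] <;> abel)
    (fun c X Y => by
      refine Prod.ext (funext fun m => ?_) (Prod.ext (funext fun m => ?_) (funext fun m => ?_)) <;>
      simp only [Prod.smul_fst, Prod.smul_snd, Pi.smul_apply, map_smul,
        ← Finset.smul_sum] <;> module)

/-- `g(S, S') = (tri(S) ⊕ tri(S')) ⊕ (⊕_{i=0}^2 ι_i(S ⊗ S'))`. -/
def supermagic (S : NormedSuperalgebra k A) (S' : NormedSuperalgebra k B) :
    BracketSpace k (Amb k A B) where
  grading := ambGrading S S'
  bracket := squareBracket S S'
  carrier := (tri S).prod ((tri S').prod ⊤)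

end Constructions

section Hurwitz

variable {k A : Type*} [Field k] [AddCommGroup A] [Module k A] (C : HurwitzSuperalgebra k A)

/-- The standard involution `x ↦ b(x, 1) 1 - x`. -/
def HurwitzSuperalgebra.bar : A →ₗ[k] A :=
  (C.polar.flip C.one).smulRight C.one - LinearMap.id

theorem HurwitzSuperalgebra.bar_apply (x : A) : C.bar x = C.polar x C.one • C.one - x := rfl

theorem HurwitzSuperalgebra.bar_mem {i : ZMod 2} {x : A} (hx : x ∈ C.grading.part i) :
    C.bar x ∈ C.grading.part i := by
  rw [C.bar_apply]
  refine sub_mem ?_ hx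
  by_cases hi : i = 0
  · subst hi
    exact Submodule.smul_mem _ _ C.one_mem
  · rw [C.polar_even i 0 x C.one hx C.one_mem hi, zero_smul]
    exact zero_mem _

theorem HurwitzSuperalgebra.bar_pr (i : ZMod 2) (x : A) :
    C.bar (C.grading.pr i x) = C.grading.pr i (C.bar x) := by
  have h : ∀ j, C.grading.pr i (C.bar (C.grading.pr j x)) =
      if i = j then C.bar (C.grading.pr j x) else 0 := fun j =>
    Grading.pr_of_mem (C.bar_mem (C.grading.pr_mem j x)) i
  conv_rhs => rw [← C.grading.pr_add x, map_add, map_add, h, h]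
  rcases zmod_two_cases i with rfl | rfl <;> simp

/-- The standard involution is a superinvolution. -/
theorem HurwitzSuperalgebra.bar_mul {i j : ZMod 2} {x y : A} (hx : x ∈ C.grading.part i)
    (hy : y ∈ C.grading.part j) :
    C.bar (C.mul x y) = ksign k i j • C.mul (C.bar y) (C.bar x) := by
  rw [← sub_eq_zero]
  refine C.nondegenerate _ fun t => ?_
  have key : ∀ l t, t ∈ C.grading.part l → C.polar (C.bar (C.mul x y) -
      ksign k i j • C.mul (C.bar y) (C.bar x)) t = 0 := by
    intro l t ht
    have c1 := C.composition i j 0 l x y C.one t hx hy C.one_mem ht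
    have c2 := C.composition i 0 j l x C.one y t hx C.one_mem hy ht
    have c3 := C.composition i j 0 0 x y C.one C.one hx hy C.one_mem C.one_mem
    have c4 := C.composition 0 0 j l C.one C.one y t C.one_mem C.one_mem hy ht
    have c5 := C.composition j i 0 l y (C.bar x) C.one t hy (C.bar_mem hx) C.one_mem ht
    have hs := C.polar_symm j i y x hy hx
    have hs2 := C.polar_symm j 0 y C.one hy C.one_mem
    have hss := ksign_mul_self k i j
    have hco := ksign_comm k j i
    simp only [C.one_mul, C.mul_one, ksign_zero_left, ksign_zero_right,
      C.bar_apply, map_sub, map_smul, LinearMap.sub_apply, LinearMap.smul_apply, smul_eq_mul]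
      at c1 c2 c3 c4 c5 hs hs2 ⊢
    rw [hco] at c5 hs
    linear_combination C.polar C.one t * c3 - c1 - C.polar x C.one * c4 + c2 + ksign k i j * c5
      - (C.polar x C.one * C.polar C.one (C.mul y t) - C.polar x (C.mul y t)) * hss
      + C.polar x C.one * C.polar C.one t * hs2
      - C.polar C.one t * (ksign k i j * hs + C.polar x y * hss)
  rw [← C.grading.pr_add t, map_add, key 0 _ (C.grading.pr_mem 0 t),
    key 1 _ (C.grading.pr_mem 1 t), add_zero]

/-- The para-Hurwitz superalgebra: the same space and norm, with the product `x • y = x̄ ȳ`. -/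
def HurwitzSuperalgebra.para : NormedSuperalgebra k A where
  grading := C.grading
  mul := C.mul.compl₁₂ C.bar C.bar
  mul_mem i j _ _ hx hy := C.mul_mem i j _ _ (C.bar_mem hx) (C.bar_mem hy)
  polar := C.polar
  polar_even := C.polar_even

/-- The product of `3 × 3` matrices with entries in `C`. -/
def HurwitzSuperalgebra.matMul : Matrix (Fin 3) (Fin 3) A →ₗ[k] Matrix (Fin 3) (Fin 3) A →ₗ[k]
    Matrix (Fin 3) (Fin 3) A :=
  LinearMap.mk₂ k (fun X Y => Matrix.of fun i j => ∑ l, C.mul (X i l) (Y l j))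
    (fun X X' Y => by ext; simp [Finset.sum_add_distrib])
    (fun c X Y => by ext; simp [Finset.smul_sum])
    (fun X Y Y' => by ext; simp [Finset.sum_add_distrib])
    (fun c X Y => by ext; simp [Finset.smul_sum])

/-- The symmetrized product `X ∘ Y = (X Y + (-1)^{XY} Y X) / 2` of matrices. -/
def HurwitzSuperalgebra.jordanMul : Matrix (Fin 3) (Fin 3) A →ₗ[k] Matrix (Fin 3) (Fin 3) A →ₗ[k]
    Matrix (Fin 3) (Fin 3) A :=
  (2⁻¹ : k) • (C.matMul +
    superFlip (C.grading.matrix (Fin 3)) (C.grading.matrix (Fin 3)) C.matMul)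

/-- The superinvolution `(a_{ij})^* = (ā_{ji})` of the matrix superalgebra. -/
def HurwitzSuperalgebra.star : Matrix (Fin 3) (Fin 3) A →ₗ[k] Matrix (Fin 3) (Fin 3) A where
  toFun X := Matrix.of fun i j => C.bar (X j i)
  map_add' X Y := by ext; simp
  map_smul' c X := by ext; simp

/-- The hermitian matrices. -/
def HurwitzSuperalgebra.hermitian : Submodule k (Matrix (Fin 3) (Fin 3) A) :=
  LinearMap.eqLocus C.star LinearMap.id

theorem HurwitzSuperalgebra.pr_star (i : ZMod 2) (X : Matrix (Fin 3) (Fin 3) A) :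
    (C.grading.matrix (Fin 3)).pr i (C.star X) = C.star ((C.grading.matrix (Fin 3)).pr i X) := by
  ext a b
  exact (C.bar_pr i (X b a)).symm

theorem HurwitzSuperalgebra.mem_matrix_part {i : ZMod 2} {X : Matrix (Fin 3) (Fin 3) A} :
    X ∈ (C.grading.matrix (Fin 3)).part i ↔ ∀ a b, X a b ∈ C.grading.part i := by
  rw [Grading.mem_part, ← Matrix.ext_iff]
  exact forall₂_congr fun a b => Grading.mem_part.symm

theorem HurwitzSuperalgebra.star_mem {i : ZMod 2} {X : Matrix (Fin 3) (Fin 3) A}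
    (hX : X ∈ (C.grading.matrix (Fin 3)).part i) :
    C.star X ∈ (C.grading.matrix (Fin 3)).part i := by
  rw [C.mem_matrix_part] at hX ⊢
  exact fun a b => C.bar_mem (hX b a)

theorem HurwitzSuperalgebra.matMul_mem {i j : ZMod 2} {X Y : Matrix (Fin 3) (Fin 3) A}
    (hX : X ∈ (C.grading.matrix (Fin 3)).part i) (hY : Y ∈ (C.grading.matrix (Fin 3)).part j) :
    C.matMul X Y ∈ (C.grading.matrix (Fin 3)).part (i + j) := by
  rw [C.mem_matrix_part] at hX hY ⊢
  intro a b
  change ∑ l, C.mul (X a l) (Y l b) ∈ _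
  exact sum_mem fun l _ => C.mul_mem i j _ _ (hX a l) (hY l b)

theorem HurwitzSuperalgebra.star_matMul {i j : ZMod 2} {X Y : Matrix (Fin 3) (Fin 3) A}
    (hX : X ∈ (C.grading.matrix (Fin 3)).part i) (hY : Y ∈ (C.grading.matrix (Fin 3)).part j) :
    C.star (C.matMul X Y) = ksign k i j • C.matMul (C.star Y) (C.star X) := by
  rw [C.mem_matrix_part] at hX hY
  ext a b
  change C.bar (∑ l, C.mul (X b l) (Y l a)) =
    ksign k i j • ∑ l, C.mul (C.bar (Y l a)) (C.bar (X b l))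
  rw [map_sum, Finset.smul_sum]
  exact Finset.sum_congr rfl fun l _ => C.bar_mul (hX b l) (hY l a)

theorem HurwitzSuperalgebra.jordanMul_apply {i j : ZMod 2} {X Y : Matrix (Fin 3) (Fin 3) A}
    (hX : X ∈ (C.grading.matrix (Fin 3)).part i) (hY : Y ∈ (C.grading.matrix (Fin 3)).part j) :
    C.jordanMul X Y = (2⁻¹ : k) • (C.matMul X Y + ksign k i j • C.matMul Y X) := by
  rw [HurwitzSuperalgebra.jordanMul, LinearMap.smul_apply, LinearMap.smul_apply,
    LinearMap.add_apply, LinearMap.add_apply, superFlip_apply _ _ _ hY hX, ksign_comm]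

theorem HurwitzSuperalgebra.star_jordanMul (X Y : Matrix (Fin 3) (Fin 3) A) :
    C.star (C.jordanMul X Y) = C.jordanMul (C.star X) (C.star Y) := by
  have h : C.jordanMul.compr₂ C.star = C.jordanMul.compl₁₂ C.star C.star := by
    refine bilin_ext (C.grading.matrix (Fin 3)) (C.grading.matrix (Fin 3)) ?_
    intro i j X Y hX hY
    rw [LinearMap.compr₂_apply, LinearMap.compl₁₂_apply, C.jordanMul_apply hX hY,
      C.jordanMul_apply (C.star_mem hX) (C.star_mem hY), map_smul, map_add, map_smul,
      C.star_matMul hX hY, C.star_matMul hY hX, smul_smul, ksign_comm k j i, ksign_mul_self,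
      one_smul, add_comm]
  exact LinearMap.congr_fun₂ h X Y

theorem HurwitzSuperalgebra.mem_hermitian {X : Matrix (Fin 3) (Fin 3) A} :
    X ∈ C.hermitian ↔ C.star X = X := Iff.rfl

/-- The Jordan superalgebra `H₃(C)` of the hermitian `3 × 3` matrices over `C`, with the
symmetrized product. -/
def HurwitzSuperalgebra.H3 : Superalgebra k C.hermitian where
  grading :=
    { pr := fun i => ((C.grading.matrix (Fin 3)).pr i).restrict fun X hX => by
        rw [C.mem_hermitian] at hX ⊢
        rw [← C.pr_star, hX]
      pr_pr := fun i j X => Subtype.ext (by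
        have := (C.grading.matrix (Fin 3)).pr_pr i j X
        split_ifs with h
        · simpa [h] using this
        · simpa [h] using this)
      pr_add := fun X => Subtype.ext ((C.grading.matrix (Fin 3)).pr_add X) }
  mul := LinearMap.mk₂ k
    (fun X Y => ⟨C.jordanMul X Y, by
      have hX := X.2
      have hY := Y.2
      rw [C.mem_hermitian] at hX hY ⊢
      rw [C.star_jordanMul, hX, hY]⟩)
    (fun X X' Y => Subtype.ext (by simp))
    (fun c X Y => Subtype.ext (by simp))
    (fun X Y Y' => Subtype.ext (by simp))
    (fun c X Y => Subtype.ext (by simp))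
  mul_mem i j X Y hX hY := by
    rw [Grading.mem_part, Subtype.ext_iff] at hX hY ⊢
    have hX' : (X : Matrix (Fin 3) (Fin 3) A) ∈ (C.grading.matrix (Fin 3)).part i :=
      Grading.mem_part.2 hX
    have hY' : (Y : Matrix (Fin 3) (Fin 3) A) ∈ (C.grading.matrix (Fin 3)).part j :=
      Grading.mem_part.2 hY
    have key : C.jordanMul X Y ∈ (C.grading.matrix (Fin 3)).part (i + j) → _ :=
      Grading.mem_part.1
    refine key ?_
    rw [C.jordanMul_apply hX' hY']
    refine Submodule.smul_mem _ _ (add_mem (C.matMul_mem hX' hY') (Submodule.smul_mem _ _ ?_))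
    rw [add_comm i j]
    exact C.matMul_mem hY' hX'

end Hurwitz

section TitsKantorKoecher

variable {k A H : Type*} [Field k] [AddCommGroup A] [Module k A] [AddCommGroup H] [Module k H]

/-- The bracket of the Tits construction `T(Q, H) = (Q⁰ ⊗ H) ⊕ der H` for a quaternion algebra `Q`
(which has no odd part) and a superalgebra `H`, as a bilinear map on `(Q ⊗ H) ⊕ End H`:
`[a ⊗ x, b ⊗ y] = [a, b] ⊗ xy - 2 b(a, b) d_{x,y}`, `[d, a ⊗ x] = a ⊗ d(x)`, and `[d, e]` is the
supercommutator.  It is extended by superanticommutativity. -/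
def titsBracket (Q : HurwitzSuperalgebra k A) (J : Superalgebra k H) :
    ((A ⊗[k] H) × Module.End k H) →ₗ[k] ((A ⊗[k] H) × Module.End k H) →ₗ[k]
      ((A ⊗[k] H) × Module.End k H) :=
  LinearMap.mk₂ k
    (fun X Y =>
      (TensorProduct.map₂ (Q.mul - Q.mul.flip) J.mul X.1 Y.1
          + LinearMap.lTensorHom A X.2 Y.1
          - superFlip J.grading.hom (Q.grading.tensor J.grading) (LinearMap.lTensorHom A) X.1 Y.2,
       superComm J.grading X.2 Y.2
          - (2 : k) • TensorProduct.lid k _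
              (TensorProduct.map₂ Q.polar (innerDer J) X.1 Y.1)))
    (fun X X' Y => by
      refine Prod.ext ?_ ?_ <;>
      simp only [Prod.fst_add, Prod.snd_add, map_add, LinearMap.add_apply, smul_add] <;> abel)
    (fun c X Y => by
      refine Prod.ext ?_ ?_ <;>
      simp only [Prod.smul_fst, Prod.smul_snd, map_smul, LinearMap.smul_apply] <;> module)
    (fun X Y Y' => by
      refine Prod.ext ?_ ?_ <;>
      simp only [Prod.fst_add, Prod.snd_add, map_add, smul_add] <;> abel)
    (fun c X Y => by
      refine Prod.ext ?_ ?_ <;>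
      simp only [Prod.smul_fst, Prod.smul_snd, map_smul] <;> module)

/-- The space `Q⁰` of the elements of trace zero, that is, of the elements orthogonal to `1`. -/
def HurwitzSuperalgebra.traceZero (Q : HurwitzSuperalgebra k A) : Submodule k A :=
  LinearMap.ker (Q.polar.flip Q.one)

/-- The Tits construction `T(Q, H) = (Q⁰ ⊗ H) ⊕ der H` for a quaternion algebra `Q`, where
`Q⁰ ⊗ H` is regarded as a subspace of `Q ⊗ H`. -/
def tits (Q : HurwitzSuperalgebra k A) (J : Superalgebra k H) :
    BracketSpace k ((A ⊗[k] H) × Module.End k H) where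
  grading := (Q.grading.tensor J.grading).prod J.grading.hom
  bracket := titsBracket Q J
  carrier := (LinearMap.range (LinearMap.rTensor H Q.traceZero.subtype)).prod (der J)

end TitsKantorKoecher

section Examples

/-- The split quaternion algebra `Mat₂(k)`, with the determinant as its norm. -/
def mat2 (k : Type*) [Field k] : HurwitzSuperalgebra k (Matrix (Fin 2) (Fin 2) k) where
  grading := Grading.trivial k _
  mul := LinearMap.mul k _
  mul_mem i j x y hx hy := by
    rw [Grading.mem_part] at *
    rcases zmod_two_cases i with rfl | rfl <;> rcases zmod_two_cases j with rfl | rfl <;>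
      simp_all [Grading.trivial, eq_comm]
  polar := (LinearMap.mul k k).compl₁₂ (Matrix.traceLinearMap (Fin 2) k k)
      (Matrix.traceLinearMap (Fin 2) k k) -
    (LinearMap.mul k (Matrix (Fin 2) (Fin 2) k)).compr₂ (Matrix.traceLinearMap (Fin 2) k k)
  polar_even i j x y hx hy hij := by
    rw [Grading.mem_part] at *
    rcases zmod_two_cases i with rfl | rfl <;> rcases zmod_two_cases j with rfl | rfl <;>
      simp_all [Grading.trivial, eq_comm]
  one := 1
  one_mem := by simp [Grading.mem_part, Grading.trivial]
  one_mul x := by simp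
  mul_one x := by simp
  polar_symm i j x y hx hy := by
    rw [Grading.mem_part] at *
    rcases zmod_two_cases i with rfl | rfl <;> rcases zmod_two_cases j with rfl | rfl <;>
      simp_all [Grading.trivial, eq_comm, ksign]
    simp [Matrix.trace_mul_comm x y, mul_comm]
  nondegenerate x h := by
    have h00 := h !![1, 0; 0, 0]
    have h01 := h !![0, 1; 0, 0]
    have h10 := h !![0, 0; 1, 0]
    have h11 := h !![0, 0; 0, 1]
    simp [Matrix.trace, Matrix.mul_apply, Fin.sum_univ_two] at h00 h01 h10 h11
    ext i j
    fin_cases i <;> fin_cases j <;> simp [h00, h01, h10, h11]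
  composition a b c d x y z t hx hy hz ht := by
    rw [Grading.mem_part] at *
    rcases zmod_two_cases a with rfl | rfl <;> rcases zmod_two_cases b with rfl | rfl <;>
    rcases zmod_two_cases c with rfl | rfl <;> rcases zmod_two_cases d with rfl | rfl <;>
      simp_all [Grading.trivial, eq_comm, ksign]
    simp [Matrix.trace, Matrix.mul_apply, Fin.sum_univ_two]
    ring

/-- The bilinear form of `mat2 k` is the polar form of the determinant. -/
theorem mat2_polar (k : Type*) [Field k] (x y : Matrix (Fin 2) (Fin 2) k) :
    (mat2 k).polar x y = (x + y).det - x.det - y.det := by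
  simp [mat2, Matrix.trace, Matrix.mul_apply, Fin.sum_univ_two, Matrix.det_fin_two]
  ring

/-- The Tits-Kantor-Koecher Lie superalgebra of a Jordan superalgebra: the Tits construction for
the split quaternion algebra. -/
def TKK {k H : Type*} [Field k] [AddCommGroup H] [Module k H] (J : Superalgebra k H) :
    BracketSpace k ((Matrix (Fin 2) (Fin 2) k ⊗[k] H) × Module.End k H) :=
  tits (mat2 k) J

/-- A two-dimensional vector space `V` with a nonzero alternating bilinear form `⟨ | ⟩`. -/
structure SymplecticPlane (k V : Type*) [Field k] [AddCommGroup V] [Module k V] where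
  form : V →ₗ[k] V →ₗ[k] k
  alt : ∀ v, form v v = 0
  ne_zero : form ≠ 0
  finrank_eq : Module.finrank k V = 2

variable {k V : Type*} [Field k] [AddCommGroup V] [Module k V]

theorem SymplecticPlane.swap (P : SymplecticPlane k V) (u v : V) : P.form u v = -P.form v u := by
  have h := P.alt (u + v)
  simp only [map_add, LinearMap.add_apply, P.alt, zero_add, add_zero] at h
  linear_combination h

theorem SymplecticPlane.exists_basis (P : SymplecticPlane k V) :
    ∃ e : Module.Basis (Fin 2) k V, P.form (e 0) (e 1) = 1 := by
  obtain ⟨u, v, huv⟩ : ∃ u v, P.form u v ≠ 0 := by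
    by_contra! h
    exact P.ne_zero (LinearMap.ext₂ h)
  have hli : LinearIndependent k ![u, (P.form u v)⁻¹ • v] := by
    rw [LinearIndependent.pair_iff]
    intro s t hst
    have h1 := congrArg (P.form u) hst
    have h2 := congrArg (P.form v) hst
    simp [P.alt, huv, P.swap v u] at h1 h2
    exact ⟨h2, h1⟩
  refine ⟨basisOfLinearIndependentOfCardEqFinrank hli (by simp [P.finrank_eq]), ?_⟩
  simp [huv]

theorem SymplecticPlane.basis_expand (e : Module.Basis (Fin 2) k V) (v : V) :
    ∃ a b : k, v = a • e 0 + b • e 1 :=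
  ⟨e.repr v 0, e.repr v 1, by rw [← Fin.sum_univ_two fun i => e.repr v i • e i, e.sum_repr]⟩

theorem SymplecticPlane.trace_eq (e : Module.Basis (Fin 2) k V) (f : Module.End k V) :
    LinearMap.trace k V f = e.repr (f (e 0)) 0 + e.repr (f (e 1)) 1 := by
  rw [LinearMap.trace_eq_matrix_trace k e f, Matrix.trace_fin_two, LinearMap.toMatrix_apply,
    LinearMap.toMatrix_apply]

theorem SymplecticPlane.plucker (P : SymplecticPlane k V) (u v z t : V) :
    P.form u v * P.form z t - P.form u z * P.form v t + P.form u t * P.form v z = 0 := by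
  obtain ⟨e, he⟩ := P.exists_basis
  have he' : P.form (e 1) (e 0) = -1 := by rw [P.swap, he]
  obtain ⟨u1, u2, rfl⟩ := SymplecticPlane.basis_expand e u
  obtain ⟨v1, v2, rfl⟩ := SymplecticPlane.basis_expand e v
  obtain ⟨z1, z2, rfl⟩ := SymplecticPlane.basis_expand e z
  obtain ⟨t1, t2, rfl⟩ := SymplecticPlane.basis_expand e t
  simp only [map_add, map_smul, LinearMap.add_apply, LinearMap.smul_apply, smul_eq_mul, P.alt,
    he, he']
  ring

theorem SymplecticPlane.nondegenerate (P : SymplecticPlane k V) {u : V}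
    (h : ∀ v, P.form u v = 0) : u = 0 := by
  obtain ⟨e, he⟩ := P.exists_basis
  have he' : P.form (e 1) (e 0) = -1 := by rw [P.swap, he]
  obtain ⟨u1, u2, rfl⟩ := SymplecticPlane.basis_expand e u
  have h0 := h (e 0)
  have h1 := h (e 1)
  simp [P.alt, he, he'] at h0 h1
  simp [h0, h1]

theorem Grading.mem_evenOdd_zero {E O : Type*} [AddCommGroup E] [Module k E] [AddCommGroup O]
    [Module k O] {x : E × O} : x ∈ (Grading.evenOdd k E O).part 0 ↔ x.2 = 0 := by
  rw [Grading.mem_part, Prod.ext_iff]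
  simp [Grading.evenOdd, eq_comm]

theorem Grading.mem_evenOdd_one {E O : Type*} [AddCommGroup E] [Module k E] [AddCommGroup O]
    [Module k O] {x : E × O} : x ∈ (Grading.evenOdd k E O).part 1 ↔ x.1 = 0 := by
  rw [Grading.mem_part, Prod.ext_iff]
  simp [Grading.evenOdd, eq_comm]

/-- The product `(α, u)(β, v) = (αβ + ⟨u|v⟩, αv + βu)` of `B(1,2)`. -/
def B12Mul (P : SymplecticPlane k V) : k × V →ₗ[k] k × V →ₗ[k] k × V :=
  LinearMap.mk₂ k (fun x y => (x.1 * y.1 + P.form x.2 y.2, x.1 • y.2 + y.1 • x.2))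
    (fun x x' y => by ext <;> simp only [Prod.fst_add, Prod.snd_add, map_add,
      LinearMap.add_apply] <;> first | ring1 | module)
    (fun c x y => by ext <;> simp only [Prod.smul_fst, Prod.smul_snd, map_smul,
      LinearMap.smul_apply, smul_eq_mul] <;> first | ring1 | module)
    (fun x y y' => by ext <;> simp only [Prod.fst_add, Prod.snd_add, map_add] <;> first | ring1 | module)
    (fun c x y => by ext <;> simp only [Prod.smul_fst, Prod.smul_snd, map_smul,
      smul_eq_mul] <;> first | ring1 | module)

theorem B12Mul_apply (P : SymplecticPlane k V) (a b : k) (u v : V) :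
    B12Mul P (a, u) (b, v) = (a * b + P.form u v, a • v + b • u) := rfl

/-- The bilinear form of `B(1,2)`: `b(1, 1) = 2`, `b(1, v) = 0` and `b(u, v) = ⟨u|v⟩`. -/
def B12Polar (P : SymplecticPlane k V) : k × V →ₗ[k] k × V →ₗ[k] k :=
  LinearMap.mk₂ k (fun x y => 2 * x.1 * y.1 + P.form x.2 y.2)
    (fun x x' y => by simp; ring)
    (fun c x y => by simp; ring)
    (fun x y y' => by simp; ring)
    (fun c x y => by simp; ring)

theorem B12Polar_apply (P : SymplecticPlane k V) (a b : k) (u v : V) :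
    B12Polar P (a, u) (b, v) = 2 * a * b + P.form u v := rfl

/-- The Hurwitz superalgebra `B(1,2) = k1 ⊕ V`. -/
def B12 [CharP k 3] (P : SymplecticPlane k V) : HurwitzSuperalgebra k (k × V) where
  grading := Grading.evenOdd k k V
  mul := B12Mul P
  mul_mem i j x y hx hy := by
    rcases x with ⟨x, u⟩
    rcases y with ⟨y, v⟩
    rcases zmod_two_cases i with rfl | rfl <;> rcases zmod_two_cases j with rfl | rfl <;>
      simp only [zmod_two_one_add_one, add_zero, zero_add, Grading.mem_evenOdd_zero,
        Grading.mem_evenOdd_one] at hx hy ⊢ <;>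
      simp [B12Mul_apply, hx, hy]
  polar := B12Polar P
  polar_even i j x y hx hy hij := by
    rcases x with ⟨x, u⟩
    rcases y with ⟨y, v⟩
    rcases zmod_two_cases i with rfl | rfl <;> rcases zmod_two_cases j with rfl | rfl <;>
      simp only [Grading.mem_evenOdd_zero, Grading.mem_evenOdd_one] at hx hy <;>
      simp_all [B12Polar_apply]
  one := (1, 0)
  one_mem := by simp [Grading.mem_evenOdd_zero]
  one_mul x := by
    rcases x with ⟨x, u⟩
    simp [B12Mul_apply]
  mul_one x := by
    rcases x with ⟨x, u⟩
    simp [B12Mul_apply]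
  polar_symm i j x y hx hy := by
    rcases x with ⟨x, u⟩
    rcases y with ⟨y, v⟩
    have h := P.swap u v
    rcases zmod_two_cases i with rfl | rfl <;> rcases zmod_two_cases j with rfl | rfl <;>
      simp only [Grading.mem_evenOdd_zero, Grading.mem_evenOdd_one] at hx hy <;> subst hx hy <;>
      simp [B12Polar_apply, ksign, ← h]
    ring
  nondegenerate x h := by
    have h3 : (3 : k) = 0 := CharP.cast_eq_zero k 3
    rcases x with ⟨x, u⟩
    have hu : u = 0 := P.nondegenerate fun v => by simpa [B12Polar_apply] using h (0, v)
    have hx : 2 * x * 1 + P.form u 0 = 0 := h (1, 0)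
    rw [map_zero] at hx
    have hx' : x = 0 := by linear_combination x * h3 - hx
    rw [hx', hu, Prod.mk_zero_zero]
  composition a b c d x y z t hx hy hz ht := by
    have h3 : (3 : k) = 0 := CharP.cast_eq_zero k 3
    rcases x with ⟨x, u⟩
    rcases y with ⟨y, v⟩
    rcases z with ⟨z, u'⟩
    rcases t with ⟨t, v'⟩
    have h1 := P.plucker u v u' v'
    have h2 := P.swap v u
    have h4 := P.swap u' u
    have h5 := P.swap v' u
    have h6 := P.swap u' v
    have h7 := P.swap v' v
    have h8 := P.swap v' u'
    rcases zmod_two_cases a with rfl | rfl <;> rcases zmod_two_cases b with rfl | rfl <;>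
    rcases zmod_two_cases c with rfl | rfl <;> rcases zmod_two_cases d with rfl | rfl <;>
      simp only [Grading.mem_evenOdd_zero, Grading.mem_evenOdd_one] at hx hy hz ht <;>
      subst hx hy hz ht <;>
      simp [B12Polar_apply, B12Mul_apply, ksign] <;> grind

/-- The symplectic involution `f ↦ f̄ = tr(f) 1 - f` of `End V`. -/
noncomputable def SymplecticPlane.conj : Module.End k V →ₗ[k] Module.End k V :=
  (LinearMap.trace k V).smulRight 1 - LinearMap.id

theorem SymplecticPlane.conj_apply (f : Module.End k V) (v : V) :
    SymplecticPlane.conj f v = LinearMap.trace k V f • v - f v := rfl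

theorem SymplecticPlane.form_apply_left (P : SymplecticPlane k V) (f : Module.End k V) (u v : V) :
    P.form (f u) v = P.form u (SymplecticPlane.conj f v) := by
  obtain ⟨e, he⟩ := P.exists_basis
  have he' : P.form (e 1) (e 0) = -1 := by rw [P.swap, he]
  obtain ⟨u1, u2, rfl⟩ := SymplecticPlane.basis_expand e u
  obtain ⟨v1, v2, rfl⟩ := SymplecticPlane.basis_expand e v
  obtain ⟨a, c, h0⟩ := SymplecticPlane.basis_expand e (f (e 0))
  obtain ⟨b, d, h1⟩ := SymplecticPlane.basis_expand e (f (e 1))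
  simp [SymplecticPlane.conj, SymplecticPlane.trace_eq e, h0, h1, P.alt, he, he']
  ring

/-- The endomorphism `⟨ . | u⟩ v`, that is, `w ↦ ⟨w|u⟩ v`. -/
def SymplecticPlane.rankOne (P : SymplecticPlane k V) (u v : V) : Module.End k V :=
  (P.form.flip u).smulRight v

theorem SymplecticPlane.rankOne_apply (P : SymplecticPlane k V) (u v w : V) :
    P.rankOne u v w = P.form w u • v := rfl

/-- The bilinear form `tr(f) tr(g) - tr(fg)` on `End V`. -/
noncomputable def endPolar : Module.End k V →ₗ[k] Module.End k V →ₗ[k] k :=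
  (LinearMap.mul k k).compl₁₂ (LinearMap.trace k V) (LinearMap.trace k V) -
    (LinearMap.mul k (Module.End k V)).compr₂ (LinearMap.trace k V)

theorem endPolar_apply (f g : Module.End k V) : endPolar f g =
    LinearMap.trace k V f * LinearMap.trace k V g - LinearMap.trace k V (f * g) := rfl

/-- If `V` is a plane, then `endPolar` is the polar form of the determinant. -/
theorem SymplecticPlane.endPolar_eq (P : SymplecticPlane k V) (f g : Module.End k V) :
    endPolar f g = LinearMap.det (f + g) - LinearMap.det f - LinearMap.det g := by
  obtain ⟨e, -⟩ := P.exists_basis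
  rw [endPolar_apply, ← LinearMap.det_toMatrix e, ← LinearMap.det_toMatrix e,
    ← LinearMap.det_toMatrix e, LinearMap.trace_eq_matrix_trace k e,
    LinearMap.trace_eq_matrix_trace k e, LinearMap.trace_eq_matrix_trace k e,
    LinearMap.toMatrix_mul, map_add]
  simp only [Matrix.trace_fin_two, Matrix.det_fin_two, Matrix.mul_apply, Fin.sum_univ_two,
    Matrix.add_apply]
  ring

/-- The product of `B(4,2)`: the composition of endomorphisms, `v · f = f(v) = f̄ · v` and
`u · v = ⟨ . | u⟩ v`. -/
noncomputable def B42Mul (P : SymplecticPlane k V) :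
    Module.End k V × V →ₗ[k] Module.End k V × V →ₗ[k] Module.End k V × V :=
  LinearMap.mk₂ k
    (fun x y => (x.1 * y.1 + P.rankOne x.2 y.2, SymplecticPlane.conj x.1 y.2 + y.1 x.2))
    (fun x x' y => by
      ext <;> simp [SymplecticPlane.rankOne_apply, add_mul] <;> module)
    (fun c x y => by
      ext <;> simp [SymplecticPlane.rankOne_apply] <;> module)
    (fun x y y' => by
      ext <;> simp [SymplecticPlane.rankOne_apply, mul_add] <;> module)
    (fun c x y => by
      ext <;> simp [SymplecticPlane.rankOne_apply] <;> module)

theorem B42Mul_apply (P : SymplecticPlane k V) (f g : Module.End k V) (u v : V) :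
    B42Mul P (f, u) (g, v) = (f * g + P.rankOne u v, SymplecticPlane.conj f v + g u) := rfl

/-- The bilinear form of `B(4,2)`: the polar form of the determinant on the even part, and
`b(u, v) = ⟨u|v⟩` on the odd part. -/
noncomputable def B42Polar (P : SymplecticPlane k V) :
    Module.End k V × V →ₗ[k] Module.End k V × V →ₗ[k] k :=
  LinearMap.mk₂ k (fun x y => endPolar x.1 y.1 + P.form x.2 y.2)
    (fun x x' y => by simp; ring)
    (fun c x y => by simp; ring)
    (fun x y y' => by simp; ring)
    (fun c x y => by simp; ring)

theorem B42Polar_apply (P : SymplecticPlane k V) (f g : Module.End k V) (u v : V) :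
    B42Polar P (f, u) (g, v) = endPolar f g + P.form u v := rfl

theorem SymplecticPlane.endPolar_nondegenerate (P : SymplecticPlane k V) {f : Module.End k V}
    (h : ∀ g, endPolar f g = 0) : f = 0 := by
  obtain ⟨e, he⟩ := P.exists_basis
  have he' : P.form (e 1) (e 0) = -1 := by rw [P.swap, he]
  obtain ⟨a, c, h0⟩ := SymplecticPlane.basis_expand e (f (e 0))
  obtain ⟨b, d, h1⟩ := SymplecticPlane.basis_expand e (f (e 1))
  have g00 := h (P.rankOne (e 0) (e 0))
  have g01 := h (P.rankOne (e 0) (e 1))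
  have g10 := h (P.rankOne (e 1) (e 0))
  have g11 := h (P.rankOne (e 1) (e 1))
  simp [endPolar_apply, SymplecticPlane.trace_eq e, SymplecticPlane.rankOne_apply, P.alt, he, he',
    h0, h1] at g00 g01 g10 g11
  exact e.ext fun i => by fin_cases i <;> simp [h0, h1, g00, g01, g10, g11]

set_option maxHeartbeats 4000000 in
theorem B42_composition [CharP k 3] (P : SymplecticPlane k V) (a b c d : ZMod 2)
    (x y z t : Module.End k V × V)
    (hx : x ∈ (Grading.evenOdd k (Module.End k V) V).part a)
    (hy : y ∈ (Grading.evenOdd k (Module.End k V) V).part b)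
    (hz : z ∈ (Grading.evenOdd k (Module.End k V) V).part c)
    (ht : t ∈ (Grading.evenOdd k (Module.End k V) V).part d) :
    B42Polar P (B42Mul P x y) (B42Mul P z t) + ksign k a b * ksign k a c * ksign k b c *
      B42Polar P (B42Mul P z y) (B42Mul P x t) =
    ksign k b c * B42Polar P x z * B42Polar P y t := by
  have h3 : (3 : k) = 0 := CharP.cast_eq_zero k 3
  obtain ⟨e, he⟩ := P.exists_basis
  have he' : P.form (e 1) (e 0) = -1 := by rw [P.swap, he]
  rcases x with ⟨x, u⟩
  rcases y with ⟨y, v⟩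
  rcases z with ⟨z, u'⟩
  rcases t with ⟨t, v'⟩
  obtain ⟨u1, u2, hu⟩ := SymplecticPlane.basis_expand e u
  obtain ⟨v1, v2, hv⟩ := SymplecticPlane.basis_expand e v
  obtain ⟨w1, w2, hw⟩ := SymplecticPlane.basis_expand e u'
  obtain ⟨r1, r2, hr⟩ := SymplecticPlane.basis_expand e v'
  obtain ⟨x1, x3, hx0⟩ := SymplecticPlane.basis_expand e (x (e 0))
  obtain ⟨x2, x4, hx1⟩ := SymplecticPlane.basis_expand e (x (e 1))
  obtain ⟨y1, y3, hy0⟩ := SymplecticPlane.basis_expand e (y (e 0))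
  obtain ⟨y2, y4, hy1⟩ := SymplecticPlane.basis_expand e (y (e 1))
  obtain ⟨z1, z3, hz0⟩ := SymplecticPlane.basis_expand e (z (e 0))
  obtain ⟨z2, z4, hz1⟩ := SymplecticPlane.basis_expand e (z (e 1))
  obtain ⟨t1, t3, ht0⟩ := SymplecticPlane.basis_expand e (t (e 0))
  obtain ⟨t2, t4, ht1⟩ := SymplecticPlane.basis_expand e (t (e 1))
  have r0 : ∀ v, P.rankOne 0 v = 0 := fun v => by simp [SymplecticPlane.rankOne]
  have r1 : ∀ v, P.rankOne v 0 = 0 := fun v => by simp [SymplecticPlane.rankOne]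
  rcases zmod_two_cases a with rfl | rfl <;> rcases zmod_two_cases b with rfl | rfl <;>
  rcases zmod_two_cases c with rfl | rfl <;> rcases zmod_two_cases d with rfl | rfl <;>
    simp only [Grading.mem_evenOdd_zero, Grading.mem_evenOdd_one] at hx hy hz ht <;>
    simp only [hx, hy, hz, ht, B42Polar_apply, B42Mul_apply, map_zero, LinearMap.zero_apply,
      mul_zero, zero_mul, add_zero, zero_add, r0, r1] <;>
    simp only [endPolar_apply, SymplecticPlane.conj_apply, SymplecticPlane.trace_eq e,
      Module.End.mul_apply, SymplecticPlane.rankOne_apply, hu, hv, hw, hr, hx0, hx1, hy0, hy1,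
      hz0, hz1, ht0, ht1, map_add, map_sub, map_smul, LinearMap.add_apply, LinearMap.sub_apply,
      LinearMap.smul_apply, P.alt, he, he'] <;>
    clear hu hv hw hr hx0 hx1 hy0 hy1 hz0 hz1 ht0 ht1 hx hy hz ht r0 r1 <;>
    simp [ksign] <;> first | done | ring1 | grind

/-- The Hurwitz superalgebra `B(4,2) = End V ⊕ V`. -/
noncomputable def B42 [CharP k 3] (P : SymplecticPlane k V) :
    HurwitzSuperalgebra k (Module.End k V × V) where
  grading := Grading.evenOdd k (Module.End k V) V
  mul := B42Mul P
  mul_mem i j x y hx hy := by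
    rcases x with ⟨x, u⟩
    rcases y with ⟨y, v⟩
    rcases zmod_two_cases i with rfl | rfl <;> rcases zmod_two_cases j with rfl | rfl <;>
      simp only [zmod_two_one_add_one, add_zero, zero_add, Grading.mem_evenOdd_zero,
        Grading.mem_evenOdd_one] at hx hy ⊢ <;>
      simp [B42Mul_apply, SymplecticPlane.rankOne, hx, hy]
  polar := B42Polar P
  polar_even i j x y hx hy hij := by
    rcases x with ⟨x, u⟩
    rcases y with ⟨y, v⟩
    rcases zmod_two_cases i with rfl | rfl <;> rcases zmod_two_cases j with rfl | rfl <;>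
      simp only [Grading.mem_evenOdd_zero, Grading.mem_evenOdd_one] at hx hy <;>
      simp_all [B42Polar_apply]
  one := (1, 0)
  one_mem := by simp [Grading.mem_evenOdd_zero]
  one_mul x := by
    rcases x with ⟨f, u⟩
    have h2 : LinearMap.trace k V 1 = 2 := by
      have := Module.finite_of_finrank_eq_succ P.finrank_eq
      rw [LinearMap.trace_one, P.finrank_eq, Nat.cast_two]
    have h : (2 : k) • u - u = u := by module
    simp [B42Mul_apply, SymplecticPlane.rankOne, SymplecticPlane.conj, h2, h]
  mul_one x := by
    rcases x with ⟨f, u⟩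
    simp [B42Mul_apply, SymplecticPlane.rankOne]
  polar_symm i j x y hx hy := by
    rcases x with ⟨f, u⟩
    rcases y with ⟨g, v⟩
    have h := P.swap u v
    have h' : endPolar f g = endPolar g f := by
      rw [endPolar_apply, endPolar_apply, LinearMap.trace_mul_comm k f g, mul_comm]
    rcases zmod_two_cases i with rfl | rfl <;> rcases zmod_two_cases j with rfl | rfl <;>
      simp only [Grading.mem_evenOdd_zero, Grading.mem_evenOdd_one] at hx hy <;>
      simp [B42Polar_apply, ksign, hx, hy, ← h, h']
  nondegenerate x h := by
    rcases x with ⟨f, u⟩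
    have hu : u = 0 := P.nondegenerate fun v => by simpa [B42Polar_apply] using h (0, v)
    have hf : f = 0 := P.endPolar_nondegenerate fun g => by simpa [B42Polar_apply] using h (g, 0)
    rw [hu, hf, Prod.mk_zero_zero]
  composition := B42_composition P

end Examples

end SuperSquare

namespace SuperSquare

/-! Let C be B(1,2) or B(4,2), S its para-Hurwitz superalgebra with product x•y, and J = H₃(C). The
two Lie superalgebras split into the same pieces, and the isomorphism matches these pieces.

The para-Hurwitz product satisfies b(x•y, z) = b(x, y•z) and, up to signs, (x•y)•z + (z•y)•x =
b(x,z)y = x•(y•z) + z•(y•x) (`para_symmComposition`). Everything that follows about C uses these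
identities and b(1,1) = 2. They give the cyclic symmetry of tri(S) (`triPart_rotate`), t_{x,y} ∈
tri(S) (`tElem_mem`), and the relation t_{a•b,c} ± θ t_{b•c,a} ± θ² t_{c•a,b} = 0
(`tElem_cyclic_zero` is its component of index 0).

In characteristic 3, where 1/2 = -1, J has diagonal idempotents e_i and off-diagonal elements
ι_i(x), x ∈ S, with e_j∘ι_i(x) = -ι_i(x) for j ≠ i, e_i∘ι_i(x) = 0, ι_i(x)∘ι_i(y) = -b(x,y)(e_{i+1}
+ e_{i+2}) and ι_{i+1}(x)∘ι_{i+2}(y) = ι_i(x•y). A triple in tri(S) acts on the ι_i, and each v ∈ S³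
gives a further derivation sending e_{m+1} to ι_m(v_m) - ι_{m+2}(v_{m+2}). A Peirce argument shows
that these exhaust the derivations: der J = tri(S) ⊕ S³ (`der_eq`). The inner derivations [L_X, L_Y]
are computed in these coordinates (`innerDer_eq`), so they are derivations and satisfy the cyclic
identity d_{xy,z} ± d_{yz,x} ± d_{zx,y} = 0 (`innerDer_cyclic`). This, supercommutativity and the
vector-product identity of sl₂ give the Jacobi identity of TKK(J) (`TKK_isLieSuperalgebra`). The
Jordan identity itself is not needed.

On the TKK side, sl₂ ⊗ J = sl₂³ ⊕ (sl₂ ⊗ S)³ and der J = tri(S) ⊕ S³. On the side of the square,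
tri(S₄) ≅ sl₂³ through the operators z ↦ q_{m+2} z - z q_{m+1} (`exists_mat2Triple`,
`mat2Triple_injective`), and Mat₂ ⊗ S = (sl₂ ⊗ S) ⊕ (1 ⊗ S) because tr 1 = 2 ≠ 0. The map `toSquare`
identifies the pieces; it respects brackets on generators (`toSquare_bracket_gen`), hence on the
whole space.

The Lie superalgebra axioms are verified on the TKK side only and are carried to g(S₄, S) along the
bijection (`BracketSpace.Transport`). -/

theorem ksign_one_one (k : Type*) [Field k] : ksign k 1 1 = -1 := by simp [ksign]

theorem ksign_add_left (k : Type*) [Field k] (i j l : ZMod 2) :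
    ksign k (i + j) l = ksign k i l * ksign k j l := by
  rcases zmod_two_cases i with rfl | rfl <;> rcases zmod_two_cases j with rfl | rfl <;>
    rcases zmod_two_cases l with rfl | rfl <;> simp [ksign, zmod_two_one_add_one]

theorem ksign_add_right (k : Type*) [Field k] (i j l : ZMod 2) :
    ksign k i (j + l) = ksign k i j * ksign k i l := by
  rw [ksign_comm, ksign_add_left, ksign_comm k j, ksign_comm k l]

/-! ### Para-Hurwitz superalgebras as symmetric composition superalgebras -/

section

variable {k A : Type*} [Field k] [AddCommGroup A] [Module k A]

theorem Grading.induction (P : Grading k A) {p : A → Prop} (hadd : ∀ x y, p x → p y → p (x + y))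
    (hom : ∀ i x, x ∈ P.part i → p x) (x : A) : p x := by
  rw [← P.pr_add x]
  exact hadd _ _ (hom 0 _ (P.pr_mem 0 x)) (hom 1 _ (P.pr_mem 1 x))

/-- The identities of symmetric composition superalgebras. -/
structure SymmComposition (S : NormedSuperalgebra k A) : Prop where
  symm : ∀ i j x y, x ∈ S.grading.part i → y ∈ S.grading.part j →
    S.polar x y = ksign k i j * S.polar y x
  nondeg : ∀ x, (∀ y, S.polar x y = 0) → x = 0
  assoc : ∀ x y z, S.polar (S.mul x y) z = S.polar x (S.mul y z)
  left : ∀ i j l x y z, x ∈ S.grading.part i → y ∈ S.grading.part j → z ∈ S.grading.part l →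
    S.mul (S.mul x y) z + (ksign k i j * ksign k i l * ksign k j l) • S.mul (S.mul z y) x =
      (ksign k j l * S.polar x z) • y
  right : ∀ i j l x y z, x ∈ S.grading.part i → y ∈ S.grading.part j → z ∈ S.grading.part l →
    S.mul x (S.mul y z) + (ksign k i j * ksign k i l * ksign k j l) • S.mul z (S.mul y x) =
      (ksign k j l * S.polar x z) • y

namespace HurwitzSuperalgebra

variable (C : HurwitzSuperalgebra k A)

theorem polar_one_left (x : A) : C.polar C.one x = C.polar x C.one := by
  induction x using C.grading.induction with
  | hadd x y hx hy => rw [map_add, hx, hy, map_add, LinearMap.add_apply]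
  | hom i x hx => rw [C.polar_symm 0 i _ _ C.one_mem hx, ksign_zero_left, _root_.one_mul]

/-- The composition law with both left factors equal to 1. It replaces b(1,1) = 2, which could fail
only for the zero form. -/
theorem polar_one_one_mul (x y : A) : C.polar C.one C.one * C.polar x y = 2 * C.polar x y := by
  induction x using C.grading.induction with
  | hadd x x' hx hx' => simp only [map_add, LinearMap.add_apply, mul_add, hx, hx']
  | hom i x hx =>
    induction y using C.grading.induction with
    | hadd y y' hy hy' => simp only [map_add, mul_add, hy, hy']
    | hom j y hy =>
      have h := C.composition 0 i 0 j _ x _ y C.one_mem hx C.one_mem hy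
      simp only [ksign_zero_left, ksign_zero_right, _root_.one_mul, C.one_mul] at h
      linear_combination -h

theorem bar_bar (x : A) : C.bar (C.bar x) = x := by
  rw [← sub_eq_zero]
  refine C.nondegenerate _ fun t => ?_
  have h := C.polar_one_one_mul C.one t
  simp only [C.bar_apply, map_sub, map_smul, LinearMap.sub_apply, LinearMap.smul_apply,
    smul_eq_mul, sub_smul]
  linear_combination C.polar x C.one * h

theorem polar_bar (x y : A) : C.polar (C.bar x) y = C.polar x (C.bar y) := by
  simp only [C.bar_apply, map_sub, map_smul, LinearMap.sub_apply, LinearMap.smul_apply,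
    smul_eq_mul, C.polar_one_left y]
  ring

theorem polar_bar_bar (x y : A) : C.polar (C.bar x) (C.bar y) = C.polar x y := by
  rw [C.polar_bar, C.bar_bar]

theorem bar_one : C.bar C.one = C.one := by
  rw [← sub_eq_zero]
  refine C.nondegenerate _ fun t => ?_
  have h := C.polar_one_one_mul C.one t
  simp only [C.bar_apply, map_sub, map_smul, LinearMap.sub_apply, LinearMap.smul_apply,
    smul_eq_mul]
  linear_combination h

theorem para_mul (x y : A) : C.para.mul x y = C.mul (C.bar x) (C.bar y) := rfl

/-- The composition law with last argument 1: right multiplication by y has right multiplication by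
ȳ as its adjoint. -/
theorem polar_mul_right {i j l : ZMod 2} {x y z : A} (hx : x ∈ C.grading.part i)
    (hy : y ∈ C.grading.part j) (hz : z ∈ C.grading.part l) :
    C.polar (C.mul x y) z = ksign k j l * C.polar x (C.mul z (C.bar y)) := by
  have h := C.composition i j l 0 x y z C.one hx hy hz C.one_mem
  have h' := C.polar_symm _ _ _ _ (C.mul_mem _ _ _ _ hz hy) hx
  simp only [C.mul_one, ksign_add_left, C.bar_apply, map_sub, map_smul, smul_eq_mul] at h h' ⊢
  rw [h', ksign_comm k l i, ksign_comm k j i] at h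
  have e1 := ksign_mul_self k i j
  have e2 := ksign_mul_self k i l
  have e3 := ksign_mul_self k j l
  have e : ksign k i j * ksign k i l * ksign k j l * (ksign k i l * ksign k i j *
    C.polar x (C.mul z y)) = ksign k j l * C.polar x (C.mul z y) := by
    linear_combination ksign k j l * C.polar x (C.mul z y) * (e1 * ksign k i l * ksign k i l + e2)
  linear_combination h - e

/-- Up to signs, b(x̄ȳ, z) = b(x̄, zy) = b(x, ȳz̄), since the involution is self-adjoint and
reverses products. -/
theorem para_assoc (x y z : A) :
    C.para.polar (C.para.mul x y) z = C.para.polar x (C.para.mul y z) := by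
  change C.polar (C.para.mul x y) z = C.polar x (C.para.mul y z)
  induction x using C.grading.induction with
  | hadd x x' hx hx' => simp only [map_add, LinearMap.add_apply, hx, hx']
  | hom i x hx =>
  induction y using C.grading.induction with
  | hadd y y' hy hy' => simp only [map_add, LinearMap.add_apply, hy, hy']
  | hom j y hy =>
  induction z using C.grading.induction with
  | hadd z z' hz hz' => simp only [map_add, hz, hz']
  | hom l z hz =>
  rw [C.para_mul, C.para_mul, C.polar_mul_right (C.bar_mem hx) (C.bar_mem hy) hz, C.bar_bar,
    C.polar_bar, C.bar_mul hz hy, map_smul, smul_eq_mul, ← mul_assoc, ksign_comm k l j,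
    ksign_mul_self, _root_.one_mul]

/-- The involution is an isometry, so the composition law survives the substitution of conjugates.
-/
theorem para_composition (a b c d : ZMod 2) (x y z t : A) (hx : x ∈ C.grading.part a)
    (hy : y ∈ C.grading.part b) (hz : z ∈ C.grading.part c) (ht : t ∈ C.grading.part d) :
    C.polar (C.para.mul x y) (C.para.mul z t) + ksign k a b * ksign k a c * ksign k b c *
      C.polar (C.para.mul z y) (C.para.mul x t) = ksign k b c * C.polar x z * C.polar y t := by
  simpa only [polar_bar_bar, para_mul] using C.composition a b c d _ _ _ _ (C.bar_mem hx) (C.bar_mem hy)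
    (C.bar_mem hz) (C.bar_mem ht)

theorem eq_of_polar {x y : A} (h : ∀ i, ∀ t ∈ C.grading.part i, C.polar x t = C.polar y t) :
    x = y := by
  rw [← sub_eq_zero]
  refine C.nondegenerate _ fun t => ?_
  induction t using C.grading.induction with
  | hadd t t' ht ht' => rw [map_add, ht, ht', add_zero]
  | hom i t ht => rw [map_sub, LinearMap.sub_apply, h i t ht, sub_self]

/-- By nondegeneracy the left and right identities may be tested against t. Associativity of the
form turns b((x•y)•z, t) into b(x•y, z•t), and b(t, x•(y•z)) into b(t•x, y•z); what remains is the
linearised composition law. -/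
theorem para_symmComposition : SymmComposition C.para where
  symm := C.polar_symm
  nondeg := C.nondegenerate
  assoc := C.para_assoc
  left i j l x y z hx hy hz := by
    refine C.eq_of_polar fun m t ht => ?_
    have h := C.para_composition i j l m x y z t hx hy hz ht
    have h1 := C.para_assoc (C.para.mul x y) z t
    have h2 := C.para_assoc (C.para.mul z y) x t
    change C.polar _ _ = C.polar _ _ at h1 h2
    simp only [map_add, map_smul, LinearMap.add_apply, LinearMap.smul_apply, smul_eq_mul]
    rw [h1, h2, h]
    rfl
  right i j l x y z hx hy hz := by
    refine C.eq_of_polar fun m t ht => ?_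
    have h := C.para_composition m i j l t x y z ht hx hy hz
    have h1 := C.para_assoc t x (C.para.mul y z)
    have h2 := C.para_assoc t z (C.para.mul y x)
    change C.polar _ _ = C.polar _ _ at h1 h2
    have s1 := C.polar_symm _ _ _ _ (C.para.mul_mem _ _ _ _ hx (C.para.mul_mem _ _ _ _ hy hz)) ht
    have s2 := C.polar_symm _ _ _ _ (C.para.mul_mem _ _ _ _ hz (C.para.mul_mem _ _ _ _ hy hx)) ht
    have s3 := C.polar_symm _ _ _ _ hy ht
    have s4 := C.polar_symm _ _ _ _ (C.para.mul_mem _ _ _ _ hy hx) (C.para.mul_mem _ _ _ _ ht hz)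
    have h3 := C.para_assoc t z (C.para.mul y x)
    have s5 := C.polar_symm _ _ _ _ (C.para.mul_mem _ _ _ _ ht hz) (C.para.mul_mem _ _ _ _ hy hx)
    change C.polar _ _ = C.polar _ _ at h3
    have e1 := C.polar_even _ _ _ _ hx hz
    have e2 := C.polar_even _ _ _ _ hy ht
    simp only [map_add, map_smul, LinearMap.add_apply, LinearMap.smul_apply, smul_eq_mul]
    change _ = ksign k j l * C.polar x z * C.polar y t
    -- With the parities fixed every sign is ±1 and the claim is linear in the values of the form;
    -- those pairing opposite parities vanish by `e1` and `e2`.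
    rcases zmod_two_cases i with rfl | rfl <;> rcases zmod_two_cases j with rfl | rfl <;>
    rcases zmod_two_cases l with rfl | rfl <;> rcases zmod_two_cases m with rfl | rfl <;>
    simp [ksign, zmod_two_one_add_one] at * <;> grind

end HurwitzSuperalgebra

end

/-! ### The triality superalgebra and the elements t_{x,y} -/

section

variable {k A : Type*} [Field k] [AddCommGroup A] [Module k A]

theorem two_eq_neg_one (k : Type*) [Field k] [CharP k 3] : (2 : k) = -1 := by
  have h : (3 : k) = 0 := CharP.cast_eq_zero k 3
  linear_combination h

theorem inv_two_eq_neg_one (k : Type*) [Field k] [CharP k 3] : (2⁻¹ : k) = -1 := by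
  rw [two_eq_neg_one, inv_neg, inv_one]

theorem Grading.mem_hom_part {P : Grading k A} {i : ZMod 2} {f : Module.End k A} :
    f ∈ P.hom.part i ↔ ∀ j x, x ∈ P.part j → f x ∈ P.part (i + j) := by
  rw [Grading.mem_part]
  have key : ∀ j x, x ∈ P.part j → P.hom.pr i f x = P.pr (i + j) (f x) := by
    intro j x hx
    have h0 := Grading.pr_of_mem hx 0
    have h1 := Grading.pr_of_mem hx 1
    rcases zmod_two_cases j with rfl | rfl <;>
      simp [Grading.hom, sum_zmod_two] at h0 h1 ⊢ <;> simp [h0, h1]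
  constructor
  · intro h j x hx
    rw [← h, key j x hx]
    exact P.pr_mem _ _
  · intro h
    ext x
    induction x using P.induction with
    | hadd x y hx hy => rw [map_add, hx, hy, map_add]
    | hom j x hx => rw [key j x hx, Grading.mem_part.1 (h j x hx)]

theorem Grading.hom_mem {P : Grading k A} {i j : ZMod 2} {f : Module.End k A} {x : A}
    (hf : f ∈ P.hom.part i) (hx : x ∈ P.part j) : f x ∈ P.part (i + j) :=
  Grading.mem_hom_part.1 hf j x hx

theorem Grading.hom_ext (P : Grading k A) {f g : Module.End k A}
    (h : ∀ i, ∀ x ∈ P.part i, f x = g x) : f = g := by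
  ext x
  induction x using P.induction with
  | hadd x y hx hy => rw [map_add, hx, hy, map_add]
  | hom j x hx => exact h j x hx

theorem mem_triPart {S : NormedSuperalgebra k A} {i : ZMod 2} {d : Fin 3 → Module.End k A} :
    d ∈ triPart S i ↔ (∀ m, d m ∈ S.grading.hom.part i) ∧
      (∀ m j l x y, x ∈ S.grading.part j → y ∈ S.grading.part l →
        S.polar (d m x) y + ksign k i j * S.polar x (d m y) = 0) ∧
      ∀ j l x y, x ∈ S.grading.part j → y ∈ S.grading.part l →
        d 0 (S.mul x y) = S.mul (d 1 x) y + ksign k i j • S.mul x (d 2 y) := by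
  constructor
  · rintro ⟨h1, h2⟩
    exact ⟨fun m => (h1 m).1, fun m j l x y hx _ => (h1 m).2 j x y hx,
      fun j l x y hx _ => h2 j x y hx⟩
  · rintro ⟨h1, h2, h3⟩
    refine ⟨fun m => ⟨h1 m, fun j x y hx => ?_⟩, fun j x y hx => ?_⟩
    · induction y using S.grading.induction with
      | hadd y z hy hz =>
        simp only [map_add]
        linear_combination hy + hz
      | hom l y hy => exact h2 m j l x y hx hy
    · induction y using S.grading.induction with
      | hadd y z hy hz =>
        simp only [map_add, hy, hz]
        module
      | hom l y hy => exact h3 j l x y hx hy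

theorem SymmComposition.eq_of_polar {S : NormedSuperalgebra k A} (hS : SymmComposition S) {x y : A}
    (h : ∀ i, ∀ t ∈ S.grading.part i, S.polar x t = S.polar y t) : x = y := by
  rw [← sub_eq_zero]
  refine hS.nondeg _ fun t => ?_
  induction t using S.grading.induction with
  | hadd t t' ht ht' => rw [map_add, ht, ht', add_zero]
  | hom i t ht => rw [map_sub, LinearMap.sub_apply, h i t ht, sub_self]

/-- The triality relation says that the triple annihilates the trilinear form b(x•y, z), which is
cyclically invariant up to signs. Hence tri(S) is stable under cyclic shifts, and by nondegeneracy
the shifted relation can be recovered from the form. -/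
theorem triPart_rotate {S : NormedSuperalgebra k A} (hS : SymmComposition S) {p : ZMod 2}
    {d : Fin 3 → Module.End k A} (hd : d ∈ triPart S p) : (fun m => d (m + 1)) ∈ triPart S p := by
  rw [mem_triPart] at hd ⊢
  obtain ⟨h1, h2, h3⟩ := hd
  refine ⟨fun m => h1 _, fun m => h2 _, fun j l x y hx hy => ?_⟩
  change d 1 (S.mul x y) = S.mul (d 2 x) y + ksign k p j • S.mul x (d 0 y)
  refine hS.eq_of_polar fun m z hz => ?_
  have hd1 := fun m => Grading.hom_mem (h1 m) hx
  have hd2 := fun m => Grading.hom_mem (h1 m) hy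
  have hd3 := fun m => Grading.hom_mem (h1 m) hz
  have c1 := h2 1 _ _ _ _ (S.mul_mem _ _ _ _ hx hy) hz
  have c2 := hS.symm _ _ _ _ (S.mul_mem _ _ _ _ hx hy) (hd3 1)
  have c3 := hS.assoc (d 1 z) x y
  have c4 := congrArg (fun t => S.polar t y) (h3 _ _ _ _ hz hx)
  have c5 := h2 0 _ _ _ _ (S.mul_mem _ _ _ _ hz hx) hy
  have c6 := hS.assoc z x (d 0 y)
  have c7 := hS.assoc z (d 2 x) y
  have c8 := hS.symm _ _ _ _ hz (S.mul_mem _ _ _ _ hx (hd2 0))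
  have c9 := hS.symm _ _ _ _ hz (S.mul_mem _ _ _ _ (hd1 2) hy)
  simp only [map_add, map_smul, LinearMap.add_apply, LinearMap.smul_apply, smul_eq_mul] at c4 ⊢
  clear hd1 hd2 hd3 h1 h2 h3 hx hy hz
  rcases zmod_two_cases p with rfl | rfl <;> rcases zmod_two_cases j with rfl | rfl <;>
  rcases zmod_two_cases l with rfl | rfl <;> rcases zmod_two_cases m with rfl | rfl <;>
  simp [ksign, zmod_two_one_add_one] at * <;> grind

theorem triPart_mul {S : NormedSuperalgebra k A} (hS : SymmComposition S) {p : ZMod 2}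
    {d : Fin 3 → Module.End k A} (hd : d ∈ triPart S p) (m : Fin 3) {j : ZMod 2} {x : A} (y : A)
    (hx : x ∈ S.grading.part j) :
    d m (S.mul x y) = S.mul (d (m + 1) x) y + ksign k p j • S.mul x (d (m + 2) y) := by
  have h1 := triPart_rotate hS hd
  have h2 := triPart_rotate hS h1
  fin_cases m
  · exact hd.2 j x y hx
  · exact h1.2 j x y hx
  · exact h2.2 j x y hx

theorem triPart_of_rotate {S : NormedSuperalgebra k A} (hS : SymmComposition S) {p : ZMod 2}
    {d : Fin 3 → Module.End k A} (hd : (fun m => d (m + 1)) ∈ triPart S p) : d ∈ triPart S p := by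
  have h := triPart_rotate hS (triPart_rotate hS hd)
  have e : (fun m => d (m + 1 + 1 + 1)) = d := by
    funext m; fin_cases m <;> rfl
  rwa [e] at h

theorem superFlip_mul_apply (S : NormedSuperalgebra k A) {i j : ZMod 2} {x y : A}
    (hx : x ∈ S.grading.part i) (hy : y ∈ S.grading.part j) :
    superFlip S.grading S.grading S.mul y x = ksign k i j • S.mul x y :=
  superFlip_apply _ _ _ hx hy

theorem sigma_apply (S : NormedSuperalgebra k A) {i j l : ZMod 2} {x y z : A}
    (hx : x ∈ S.grading.part i) (hy : y ∈ S.grading.part j) (hz : z ∈ S.grading.part l) :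
    sigma S x y z = (ksign k j l * S.polar x z) • y -
      (ksign k i j * ksign k i l * S.polar y z) • x := by
  simp only [sigma, LinearMap.sum_apply]
  simp only [homBilin_apply _ _ _ hx hy, sum_zmod_two, LinearMap.mk₂_apply,
    LinearMap.comp_apply, Grading.pr_of_mem hz, LinearMap.sub_apply, LinearMap.smul_apply,
    LinearMap.smulRight_apply, ksign_add_right]
  rcases zmod_two_cases l with rfl | rfl <;> simp <;> module

theorem tElem_zero (S : NormedSuperalgebra k A) {i j l : ZMod 2} {x y z : A}
    (hx : x ∈ S.grading.part i) (hy : y ∈ S.grading.part j) (hz : z ∈ S.grading.part l) :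
    tElem S x y 0 z = (ksign k j l * S.polar x z) • y -
      (ksign k i j * ksign k i l * S.polar y z) • x :=
  sigma_apply S hx hy hz

variable [CharP k 3]

/-- The coefficient -1 of b(x,y) is 1/2 in characteristic 3; the same holds in `tElem_two`. -/
theorem tElem_one (S : NormedSuperalgebra k A) {i j l : ZMod 2} {x y z : A}
    (hx : x ∈ S.grading.part i) (hy : y ∈ S.grading.part j) (hz : z ∈ S.grading.part l) :
    tElem S x y 1 z = -(S.polar x y • z) -
      (ksign k i j * ksign k i l) • S.mul (S.mul y z) x := by
  have h : tElem S x y 1 z = (2⁻¹ * S.polar x y) • z -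
    superFlip S.grading S.grading S.mul x (S.mul y z) := rfl
  rw [h, superFlip_mul_apply S (S.mul_mem _ _ _ _ hy hz) hx, inv_two_eq_neg_one, ksign_comm,
    ksign_add_right]
  module

theorem tElem_two (S : NormedSuperalgebra k A) {i j l : ZMod 2} {x y z : A}
    (_hx : x ∈ S.grading.part i) (hy : y ∈ S.grading.part j) (hz : z ∈ S.grading.part l) :
    tElem S x y 2 z = -(S.polar x y • z) - ksign k j l • S.mul x (S.mul z y) := by
  have h : tElem S x y 2 z = (2⁻¹ * S.polar x y) • z -
    S.mul x (superFlip S.grading S.grading S.mul y z) := rfl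
  rw [h, superFlip_mul_apply S hz hy, inv_two_eq_neg_one, ksign_comm, map_smul]
  module

end

section

variable {k A : Type*} [Field k] [AddCommGroup A] [Module k A] [CharP k 3]

omit [CharP k 3] in
/-- The form vanishes unless the two arguments are of the same parity. -/
theorem NormedSuperalgebra.ksign_mul_polar (S : NormedSuperalgebra k A) {i j : ZMod 2} {x y : A}
    (hx : x ∈ S.grading.part i) (hy : y ∈ S.grading.part j) (l : ZMod 2) :
    ksign k i l * S.polar x y = ksign k j l * S.polar x y := by
  by_cases h : i = j
  · rw [h]
  · rw [S.polar_even _ _ _ _ hx hy h, mul_zero, mul_zero]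

theorem zmod_two_cancel (i j : ZMod 2) : i + j + i = j := by revert i j; decide

theorem zmod_two_cancel' (i j : ZMod 2) : i + j + j = i := by revert i j; decide

theorem zmod_two_cancel'' (i j : ZMod 2) : i + i + j = j := by revert i j; decide

theorem tElem_hom (S : NormedSuperalgebra k A) {i j : ZMod 2} {x y : A}
    (hx : x ∈ S.grading.part i) (hy : y ∈ S.grading.part j) (m : Fin 3) :
    tElem S x y m ∈ S.grading.hom.part (i + j) := by
  refine Grading.mem_hom_part.2 fun l z hz => ?_
  fin_cases m
  · change tElem S x y 0 z ∈ _
    rw [tElem_zero S hx hy hz]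
    refine sub_mem ?_ ?_
    · by_cases h : i = l
      · subst h
        refine Submodule.smul_mem _ _ ?_
        convert hy using 2
        exact zmod_two_cancel _ _
      · rw [S.polar_even _ _ _ _ hx hz h]; simp
    · by_cases h : j = l
      · subst h
        refine Submodule.smul_mem _ _ ?_
        convert hx using 2
        exact zmod_two_cancel' _ _
      · rw [S.polar_even _ _ _ _ hy hz h]; simp
  all_goals
    have h0 : S.polar x y • z ∈ S.grading.part (i + j + l) := by
      by_cases h : i = j
      · subst h
        refine Submodule.smul_mem _ _ ?_
        convert hz using 2
        exact zmod_two_cancel'' _ _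
      · rw [S.polar_even _ _ _ _ hx hy h]; simp
  · change tElem S x y 1 z ∈ _
    rw [tElem_one S hx hy hz]
    refine sub_mem (neg_mem h0) (Submodule.smul_mem _ _ ?_)
    convert S.mul_mem _ _ _ _ (S.mul_mem _ _ _ _ hy hz) hx using 2
    ring
  · change tElem S x y 2 z ∈ _
    rw [tElem_two S hx hy hz]
    refine sub_mem (neg_mem h0) (Submodule.smul_mem _ _ ?_)
    convert S.mul_mem _ _ _ _ hx (S.mul_mem _ _ _ _ hz hy) using 2
    ring

end

section

variable {k A : Type*} [Field k] [AddCommGroup A] [Module k A] [CharP k 3]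

/-- The relation for the shifted triple (t₂, t₀, t₁), in which the explicit operator σ stands on the
right-hand side. The right identity rewrites z•((y•w)•x) through x•((y•w)•z), and the left identity,
multiplied by x, rewrites that through x•((z•w)•y); the terms with b are those of σ. -/
theorem tElem_triality {S : NormedSuperalgebra k A} (hS : SymmComposition S) {i j l n : ZMod 2}
    {x y z w : A} (hx : x ∈ S.grading.part i) (hy : y ∈ S.grading.part j)
    (hz : z ∈ S.grading.part l) (hw : w ∈ S.grading.part n) :
    tElem S x y 2 (S.mul z w) = S.mul (tElem S x y 0 z) w +
      ksign k (i + j) l • S.mul z (tElem S x y 1 w) := by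
  rw [tElem_zero S hx hy hz, tElem_one S hx hy hw, tElem_two S hx hy (S.mul_mem _ _ _ _ hz hw)]
  have R := hS.right _ _ _ _ _ _ hz (S.mul_mem _ _ _ _ hy hw) hx
  have L := congrArg (S.mul x) (hS.left _ _ _ _ _ _ hy hw hz)
  have p := S.ksign_mul_polar hx hy l
  have p' := S.ksign_mul_polar hx hz
  have p'' := S.ksign_mul_polar hy hz i
  have s1 := ksign_mul_self k i j
  have s2 := ksign_mul_self k i l
  have s3 := ksign_mul_self k i n
  have s4 := ksign_mul_self k j l
  have s5 := ksign_mul_self k j n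
  have s6 := ksign_mul_self k l n
  simp only [ksign_add_left, ksign_add_right, ksign_comm k j i, ksign_comm k l i, ksign_comm k n i,
    ksign_comm k l j, ksign_comm k n l, map_add, map_sub, map_smul, map_neg,
    LinearMap.sub_apply, LinearMap.smul_apply, hS.symm _ _ _ _ hz hx] at L R p p' p'' ⊢
  clear hx hy hz hw
  -- After the identities are subtracted, the coefficients of the remaining monomials are compared;
  -- they agree because signs square to 1 and because b pairs only elements of equal parity.
  linear_combination (norm := skip) (ksign k i l * ksign k j l * ksign k i j * ksign k i n) • R -
    ksign k l n • L
  clear R L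
  match_scalars <;> grind

/-- The adjoint of r_x l_y is r_y l_x up to sign, by associativity of the form, and the left
identity says that the two add up to b(x,y). So r_x l_y minus half of b(x,y) is skew. -/
theorem tElem_one_osp {S : NormedSuperalgebra k A} (hS : SymmComposition S) {i j l n : ZMod 2}
    {x y z w : A} (hx : x ∈ S.grading.part i) (hy : y ∈ S.grading.part j)
    (hz : z ∈ S.grading.part l) (hw : w ∈ S.grading.part n) :
    S.polar (tElem S x y 1 z) w + ksign k (i + j) l * S.polar z (tElem S x y 1 w) = 0 := by
  rw [tElem_one S hx hy hz, tElem_one S hx hy hw]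
  have f1 := congrArg (fun t => S.polar t w) (hS.left _ _ _ _ _ _ hy hz hx)
  have f2 := hS.symm _ _ _ _ hz (S.mul_mem _ _ _ _ (S.mul_mem _ _ _ _ hy hw) hx)
  have f3 := hS.assoc (S.mul y w) x z
  have f4 := hS.symm _ _ _ _ (S.mul_mem _ _ _ _ hy hw) (S.mul_mem _ _ _ _ hx hz)
  have f5 := hS.assoc (S.mul x z) y w
  have e0 := hS.symm _ _ _ _ hy hx
  have p := S.ksign_mul_polar hx hy l
  have q := S.ksign_mul_polar hz hw
  have qi := q i
  have qj := q j
  have s1 := ksign_mul_self k i j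
  have s2 := ksign_mul_self k i l
  have s3 := ksign_mul_self k i n
  have s4 := ksign_mul_self k j l
  have s5 := ksign_mul_self k j n
  have s6 := ksign_mul_self k l n
  have h3 : (3 : k) = 0 := CharP.cast_eq_zero k 3
  simp only [ksign_add_left, ksign_add_right, ksign_comm k j i, ksign_comm k l i, ksign_comm k n i,
    ksign_comm k l j, ksign_comm k n j, ksign_comm k n l, map_add, map_sub, map_smul, map_neg,
    LinearMap.sub_apply, LinearMap.add_apply, LinearMap.neg_apply,
    LinearMap.smul_apply, e0, f2, f3, f4, f5, smul_eq_mul] at f1 p qi qj ⊢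
  clear hx hy hz hw f2 f3 f4 f5 e0 q
  grind

/-- As for the component of index 1: the adjoint of l_x r_y is l_y r_x up to sign, and the right
identity computes the sum. -/
theorem tElem_two_osp {S : NormedSuperalgebra k A} (hS : SymmComposition S) {i j l n : ZMod 2}
    {x y z w : A} (hx : x ∈ S.grading.part i) (hy : y ∈ S.grading.part j)
    (hz : z ∈ S.grading.part l) (hw : w ∈ S.grading.part n) :
    S.polar (tElem S x y 2 z) w + ksign k (i + j) l * S.polar z (tElem S x y 2 w) = 0 := by
  rw [tElem_two S hx hy hz, tElem_two S hx hy hw]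
  have g1 := congrArg (fun t => S.polar t w) (hS.right _ _ _ _ _ _ hx hz hy)
  have g2 := hS.symm _ _ _ _ (S.mul_mem _ _ _ _ hy (S.mul_mem _ _ _ _ hz hx)) hw
  have g3 := hS.assoc w y (S.mul z x)
  have g4 := hS.symm _ _ _ _ (S.mul_mem _ _ _ _ hw hy) (S.mul_mem _ _ _ _ hz hx)
  have g5 := hS.assoc z x (S.mul w y)
  have p := S.ksign_mul_polar hx hy l
  have q := S.ksign_mul_polar hz hw
  have qi := q i
  have qj := q j
  have s1 := ksign_mul_self k i j
  have s2 := ksign_mul_self k i l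
  have s3 := ksign_mul_self k i n
  have s4 := ksign_mul_self k j l
  have s5 := ksign_mul_self k j n
  have s6 := ksign_mul_self k l n
  simp only [ksign_add_left, ksign_add_right, ksign_comm k j i, ksign_comm k l i, ksign_comm k n i,
    ksign_comm k l j, ksign_comm k n j, ksign_comm k n l, map_add, map_sub, map_smul, map_neg,
    LinearMap.sub_apply, LinearMap.add_apply, LinearMap.neg_apply,
    LinearMap.smul_apply, g2, ← g3, g4, g5, smul_eq_mul] at g1 p qi qj ⊢
  clear hx hy hz hw g2 g3 g4 g5 q
  grind

omit [CharP k 3] in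
theorem tElem_zero_osp {S : NormedSuperalgebra k A} (hS : SymmComposition S) {i j l n : ZMod 2}
    {x y z w : A} (hx : x ∈ S.grading.part i) (hy : y ∈ S.grading.part j)
    (hz : z ∈ S.grading.part l) (hw : w ∈ S.grading.part n) :
    S.polar (tElem S x y 0 z) w + ksign k (i + j) l * S.polar z (tElem S x y 0 w) = 0 := by
  rw [tElem_zero S hx hy hz, tElem_zero S hx hy hw]
  have p1 := S.ksign_mul_polar hx hz
  have p2 := S.ksign_mul_polar hy hz
  have p1j := p1 j
  have p1l := p1 l
  have p2j := p2 i
  have p2l := p2 j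
  have s1 := ksign_mul_self k i j
  have s2 := ksign_mul_self k i l
  have s3 := ksign_mul_self k i n
  have s4 := ksign_mul_self k j l
  have s5 := ksign_mul_self k j n
  have s6 := ksign_mul_self k l n
  have r1 := S.ksign_mul_polar hx hw j
  have r2 := S.ksign_mul_polar hx hw l
  have r3 := S.ksign_mul_polar hy hw i
  have r4 := S.ksign_mul_polar hy hw l
  simp only [ksign_add_left, ksign_comm k j i, ksign_comm k l i, ksign_comm k n i,
    ksign_comm k l j, ksign_comm k n j, ksign_comm k n l, map_sub, map_smul,
    LinearMap.sub_apply, hS.symm _ _ _ _ hz hx, hS.symm _ _ _ _ hz hy,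
    LinearMap.smul_apply, smul_eq_mul] at p1j p1l p2j p2l r1 r2 r3 r4 ⊢
  clear hx hy hz hw p1 p2
  grind

theorem tElem_mem {S : NormedSuperalgebra k A} (hS : SymmComposition S) {i j : ZMod 2} {x y : A}
    (hx : x ∈ S.grading.part i) (hy : y ∈ S.grading.part j) :
    tElem S x y ∈ triPart S (i + j) := by
  -- Two shifts replace (t₀, t₁, t₂) by (t₂, t₀, t₁), the order in which the triality relation was
  -- checked.
  refine triPart_of_rotate hS (triPart_of_rotate hS ?_)
  refine mem_triPart.2 ⟨fun m => tElem_hom S hx hy _, fun m l n z w hz hw => ?_,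
    fun l n z w hz hw => tElem_triality hS hx hy hz hw⟩
  fin_cases m
  · exact tElem_two_osp hS hx hy hz hw
  · exact tElem_zero_osp hS hx hy hz hw
  · exact tElem_one_osp hS hx hy hz hw

/-- The component σ is skew by its formula; for the other two the left and the right identity give
r_x l_y ± r_y l_x and l_x r_y ± l_y r_x. -/
theorem tElem_skew {S : NormedSuperalgebra k A} (hS : SymmComposition S) {i j : ZMod 2} {x y : A}
    (hx : x ∈ S.grading.part i) (hy : y ∈ S.grading.part j) :
    tElem S x y = -(ksign k i j • tElem S y x) := by
  funext m
  refine S.grading.hom_ext fun l z hz => ?_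
  have e := hS.symm _ _ _ _ hy hx
  have s1 := ksign_mul_self k i j
  have s2 := ksign_mul_self k i l
  have s3 := ksign_mul_self k j l
  have p := S.ksign_mul_polar hx hy l
  have h3 : (3 : k) = 0 := CharP.cast_eq_zero k 3
  simp only [Pi.neg_apply, Pi.smul_apply, LinearMap.neg_apply, LinearMap.smul_apply]
  fin_cases m
  · change tElem S x y 0 z = -(_ • tElem S y x 0 z)
    rw [tElem_zero S hx hy hz, tElem_zero S hy hx hz, ksign_comm k j i]
    match_scalars <;> grind
  · change tElem S x y 1 z = -(_ • tElem S y x 1 z)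
    rw [tElem_one S hx hy hz, tElem_one S hy hx hz, e, ksign_comm k j i]
    have L := hS.left _ _ _ _ _ _ hx hz hy
    simp only [ksign_comm k l j] at L
    linear_combination (norm := skip) (-ksign k j l) • L
    clear L
    match_scalars <;> grind
  · change tElem S x y 2 z = -(_ • tElem S y x 2 z)
    rw [tElem_two S hx hy hz, tElem_two S hy hx hz, e, ksign_comm k j i]
    have L := hS.right _ _ _ _ _ _ hx hz hy
    simp only [ksign_comm k l j] at L
    linear_combination (norm := skip) (-ksign k j l) • L
    clear L
    match_scalars <;> grind

/-- The component of index 0 of t_{a•b,c} ± θ t_{b•c,a} ± θ² t_{c•a,b} = 0, since (θ^i d)₀ = d_{-i}.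
Three left identities reduce all the products to multiples of a, b, c and z, or to products that
cancel. This is the source of the cyclic identity for inner derivations. -/
theorem tElem_cyclic_zero {S : NormedSuperalgebra k A} (hS : SymmComposition S) {i j l : ZMod 2}
    {a b c : A} (ha : a ∈ S.grading.part i) (hb : b ∈ S.grading.part j)
    (hc : c ∈ S.grading.part l) :
    tElem S (S.mul a b) c 0 + ksign k i (j + l) • tElem S (S.mul b c) a 2 +
      ksign k l (i + j) • tElem S (S.mul c a) b 1 = 0 := by
  refine S.grading.hom_ext fun m z hz => ?_
  simp only [LinearMap.add_apply, LinearMap.smul_apply, LinearMap.zero_apply]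
  rw [tElem_zero S (S.mul_mem _ _ _ _ ha hb) hc hz, tElem_two S (S.mul_mem _ _ _ _ hb hc) ha hz,
    tElem_one S (S.mul_mem _ _ _ _ hc ha) hb hz]
  have R1 := hS.left _ _ _ _ _ _ hb hc (S.mul_mem _ _ _ _ hz ha)
  have R2 := congrArg (fun t => S.mul t b) (hS.left _ _ _ _ _ _ hz ha hc)
  have R3 := hS.left _ _ _ _ _ _ (S.mul_mem _ _ _ _ hc ha) hz hb
  have b1 := hS.assoc a b c
  have b2 := hS.symm _ _ _ _ (S.mul_mem _ _ _ _ hb hc) ha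
  have b3 := hS.assoc c a b
  have b4 := hS.symm _ _ _ _ hc (S.mul_mem _ _ _ _ ha hb)
  have b5 := hS.assoc b z a
  have b6 := hS.assoc a b z
  have b7 := hS.symm _ _ _ _ (S.mul_mem _ _ _ _ hb hz) ha
  have b8 := hS.symm _ _ _ _ hz hc
  have p1 := S.ksign_mul_polar (S.mul_mem _ _ _ _ ha hb) hc
  have p2 := S.ksign_mul_polar ha (S.mul_mem _ _ _ _ hb hz)
  have p3 := S.ksign_mul_polar hc hz
  have p1i := p1 i
  have p1j := p1 j
  have p1l := p1 l
  have p1m := p1 m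
  have p2i := p2 i
  have p2j := p2 j
  have p2l := p2 l
  have p2m := p2 m
  have p3i := p3 i
  have p3j := p3 j
  have p3l := p3 l
  have p3m := p3 m
  have s1 := ksign_mul_self k i j
  have s2 := ksign_mul_self k i l
  have s3 := ksign_mul_self k i m
  have s4 := ksign_mul_self k j l
  have s5 := ksign_mul_self k j m
  have s6 := ksign_mul_self k l m
  simp only [ksign_add_left, ksign_add_right, ksign_comm k j i, ksign_comm k l i, ksign_comm k m i,
    ksign_comm k l j, ksign_comm k m j, ksign_comm k m l, map_add, map_smul, LinearMap.add_apply,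
    LinearMap.smul_apply, b4, b2, b3, ← b5, b7, b8, b1, b6]
    at R1 R2 R3 p1i p1j p1l p1m p2i p2j p2l p2m p3i p3j p3l p3m ⊢
  clear ha hb hc hz b1 b2 b3 b4 b5 b6 b7 b8 p1 p2 p3
  linear_combination (norm := skip) (-(ksign k i j * ksign k i l * ksign k i m)) • R1 +
    (ksign k i m * ksign k j l * ksign k j m * ksign k l m) • R2 -
    (ksign k j l * ksign k j m * ksign k i l) • R3
  clear R1 R2 R3
  match_scalars <;> grind

end

/-! ### Coordinates on H₃(C) and its inner derivations -/

theorem fin_three_add (m : Fin 3) : m + 1 + 1 = m + 2 ∧ m + 1 + 2 = m ∧ m + 2 + 1 = m ∧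
    m + 2 + 2 = m + 1 := by
  revert m; decide

section

variable {k A H : Type*} [Field k] [AddCommGroup A] [Module k A] [AddCommGroup H] [Module k H]

/-- Coordinates on a superalgebra `J` that identify it with the superalgebra of the hermitian
`3 × 3` matrices over the Hurwitz superalgebra with para-Hurwitz superalgebra `S`, in
characteristic three. -/
structure HermitianCoordinates (S : NormedSuperalgebra k A) (J : Superalgebra k H) where
  coords : H ≃ₗ[k] (Fin 3 → k) × (Fin 3 → A)
  mem_part : ∀ i X, X ∈ J.grading.part i ↔
    (i = 1 → (coords X).1 = 0) ∧ ∀ m, (coords X).2 m ∈ S.grading.part i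
  diag_mul : ∀ X Y m, (coords (J.mul X Y)).1 m = (coords X).1 m * (coords Y).1 m -
    S.polar ((coords X).2 (m + 1)) ((coords Y).2 (m + 1)) -
    S.polar ((coords X).2 (m + 2)) ((coords Y).2 (m + 2))
  off_mul : ∀ i j X Y m, X ∈ J.grading.part i → Y ∈ J.grading.part j →
    (coords (J.mul X Y)).2 m =
      S.mul ((coords X).2 (m + 1)) ((coords Y).2 (m + 2)) +
      ksign k i j • S.mul ((coords Y).2 (m + 1)) ((coords X).2 (m + 2)) -
      ((coords X).1 (m + 1) + (coords X).1 (m + 2)) • (coords Y).2 m -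
      ((coords Y).1 (m + 1) + (coords Y).1 (m + 2)) • (coords X).2 m

namespace HermitianCoordinates

variable {S : NormedSuperalgebra k A} {J : Superalgebra k H} (K : HermitianCoordinates S J)

/-- The diagonal coordinates. -/
def diag (X : H) : Fin 3 → k := (K.coords X).1

/-- The off-diagonal coordinates. -/
def off (X : H) : Fin 3 → A := (K.coords X).2

theorem ext {X Y : H} (h1 : ∀ m, K.diag X m = K.diag Y m) (h2 : ∀ m, K.off X m = K.off Y m) :
    X = Y :=
  K.coords.injective (Prod.ext (funext h1) (funext h2))

theorem diag_add (X Y : H) (m : Fin 3) : K.diag (X + Y) m = K.diag X m + K.diag Y m := by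
  simp [diag]

theorem diag_sub (X Y : H) (m : Fin 3) : K.diag (X - Y) m = K.diag X m - K.diag Y m := by
  simp [diag]

theorem diag_smul (c : k) (X : H) (m : Fin 3) : K.diag (c • X) m = c * K.diag X m := by
  simp [diag]

theorem off_add (X Y : H) (m : Fin 3) : K.off (X + Y) m = K.off X m + K.off Y m := by
  simp [off]

theorem off_sub (X Y : H) (m : Fin 3) : K.off (X - Y) m = K.off X m - K.off Y m := by
  simp [off]

theorem off_smul (c : k) (X : H) (m : Fin 3) : K.off (c • X) m = c • K.off X m := by
  simp [off]

theorem diag_mul' (X Y : H) (m : Fin 3) : K.diag (J.mul X Y) m = K.diag X m * K.diag Y m -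
    S.polar (K.off X (m + 1)) (K.off Y (m + 1)) - S.polar (K.off X (m + 2)) (K.off Y (m + 2)) :=
  K.diag_mul X Y m

theorem off_mul' {i j : ZMod 2} {X Y : H} (hX : X ∈ J.grading.part i) (hY : Y ∈ J.grading.part j)
    (m : Fin 3) : K.off (J.mul X Y) m =
      S.mul (K.off X (m + 1)) (K.off Y (m + 2)) +
      ksign k i j • S.mul (K.off Y (m + 1)) (K.off X (m + 2)) -
      (K.diag X (m + 1) + K.diag X (m + 2)) • K.off Y m -
      (K.diag Y (m + 1) + K.diag Y (m + 2)) • K.off X m :=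
  K.off_mul i j X Y m hX hY

theorem off_mem {i : ZMod 2} {X : H} (hX : X ∈ J.grading.part i) (m : Fin 3) :
    K.off X m ∈ S.grading.part i :=
  ((K.mem_part i X).1 hX).2 m

/-- Diagonal coordinates vanish on odd elements, so a sign in front of them may be inserted or
dropped. -/
theorem ksign_mul_diag {i : ZMod 2} {X : H} (hX : X ∈ J.grading.part i) (j : ZMod 2) (m : Fin 3) :
    ksign k i j * K.diag X m = K.diag X m := by
  rcases zmod_two_cases i with rfl | rfl
  · rw [ksign_zero_left, one_mul]
  · have h : K.diag X = 0 := ((K.mem_part 1 X).1 hX).1 rfl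
    rw [h, Pi.zero_apply, mul_zero]

/-- The operator on `J` given by a triple of operators on `S` and a triple of elements of `S`. -/
def derOp : ((Fin 3 → Module.End k A) × (Fin 3 → A)) →ₗ[k] Module.End k H :=
  LinearMap.mk₂ k
    (fun D X => K.coords.symm
      (fun m => S.polar (D.2 (m + 1)) (K.off X (m + 1)) - S.polar (D.2 (m + 2)) (K.off X (m + 2)),
       fun m => D.1 m (K.off X m) + (K.diag X (m + 1) - K.diag X (m + 2)) • D.2 m +
        S.mul (D.2 (m + 1)) (K.off X (m + 2)) -
        superFlip S.grading S.grading S.mul (D.2 (m + 2)) (K.off X (m + 1))))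
    (fun D D' X => by
      rw [← map_add]
      congr 1
      refine Prod.ext (funext fun m => ?_) (funext fun m => ?_) <;> simp
      · ring
      · module)
    (fun c D X => by
      rw [← map_smul]
      congr 1
      refine Prod.ext (funext fun m => ?_) (funext fun m => ?_) <;> simp
      · ring
      · module)
    (fun D X Y => by
      rw [← map_add]
      congr 1
      refine Prod.ext (funext fun m => ?_) (funext fun m => ?_) <;>
        simp [diag_add, off_add]
      · ring
      · module)
    (fun c D X => by
      rw [← map_smul]
      congr 1
      refine Prod.ext (funext fun m => ?_) (funext fun m => ?_) <;>
        simp [diag_smul, off_smul]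
      · ring
      · module)

theorem diag_derOp (d : Fin 3 → Module.End k A) (v : Fin 3 → A) (X : H) (m : Fin 3) :
    K.diag (K.derOp (d, v) X) m =
      S.polar (v (m + 1)) (K.off X (m + 1)) - S.polar (v (m + 2)) (K.off X (m + 2)) := by
  simp [derOp, diag]

theorem off_derOp (d : Fin 3 → Module.End k A) (v : Fin 3 → A) (X : H) (m : Fin 3) :
    K.off (K.derOp (d, v) X) m = d m (K.off X m) + (K.diag X (m + 1) - K.diag X (m + 2)) • v m +
        S.mul (v (m + 1)) (K.off X (m + 2)) -
        superFlip S.grading S.grading S.mul (v (m + 2)) (K.off X (m + 1)) := by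
  simp [derOp, off, diag]

theorem off_derOp' {d : Fin 3 → Module.End k A} {v : Fin 3 → A} {p j : ZMod 2} {X : H}
    (hv : ∀ m, v m ∈ S.grading.part p) (hX : X ∈ J.grading.part j) (m : Fin 3) :
    K.off (K.derOp (d, v) X) m =
      d m (K.off X m) + (K.diag X (m + 1) - K.diag X (m + 2)) • v m +
        S.mul (v (m + 1)) (K.off X (m + 2)) -
        ksign k p j • S.mul (K.off X (m + 1)) (v (m + 2)) := by
  rw [off_derOp, superFlip_mul_apply S (K.off_mem hX _) (hv _), ksign_comm]

/-- The triple `∑ θ^i t_{x_i, y_i}`. -/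
def tSum (S : NormedSuperalgebra k A) (x y : Fin 3 → A) : Fin 3 → Module.End k A := fun m =>
  tElem S (x m) (y m) 0 + tElem S (x (m + 1)) (y (m + 1)) 2 + tElem S (x (m + 2)) (y (m + 2)) 1

/-- The vector part of the inner derivation given by two elements of `J`. -/
def innerVec (X Y : H) : Fin 3 → A := fun m =>
  (K.diag Y (m + 1) - K.diag Y (m + 2)) • K.off X m -
  (K.diag X (m + 1) - K.diag X (m + 2)) • K.off Y m -
  S.mul (K.off X (m + 1)) (K.off Y (m + 2)) +
  superFlip S.grading S.grading S.mul (K.off X (m + 2)) (K.off Y (m + 1))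

theorem innerVec_apply {i j : ZMod 2} {X Y : H} (hX : X ∈ J.grading.part i)
    (hY : Y ∈ J.grading.part j) (m : Fin 3) : K.innerVec X Y m =
  (K.diag Y (m + 1) - K.diag Y (m + 2)) • K.off X m -
  (K.diag X (m + 1) - K.diag X (m + 2)) • K.off Y m -
  S.mul (K.off X (m + 1)) (K.off Y (m + 2)) +
  ksign k i j • S.mul (K.off Y (m + 1)) (K.off X (m + 2)) := by
  rw [innerVec, superFlip_mul_apply S (K.off_mem hY _) (K.off_mem hX _), ksign_comm]

theorem innerVec_mem {i j : ZMod 2} {X Y : H} (hX : X ∈ J.grading.part i)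
    (hY : Y ∈ J.grading.part j) (m : Fin 3) : K.innerVec X Y m ∈ S.grading.part (i + j) := by
  have key : ∀ i j X Y, X ∈ J.grading.part i → Y ∈ J.grading.part j → ∀ m m',
      K.diag X m • K.off Y m' ∈ S.grading.part (i + j) := by
    intro i j X Y hX hY m m'
    rcases zmod_two_cases i with rfl | rfl
    · rw [zero_add]
      exact Submodule.smul_mem _ _ (K.off_mem hY _)
    · have h : K.diag X = 0 := ((K.mem_part 1 X).1 hX).1 rfl
      rw [h, Pi.zero_apply, zero_smul]
      exact zero_mem _
  rw [K.innerVec_apply hX hY, sub_smul, sub_smul]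
  refine add_mem (sub_mem (sub_mem (sub_mem ?_ ?_) (sub_mem ?_ ?_)) ?_) (Submodule.smul_mem _ _ ?_)
  · rw [add_comm]; exact key _ _ _ _ hY hX _ _
  · rw [add_comm]; exact key _ _ _ _ hY hX _ _
  · exact key _ _ _ _ hX hY _ _
  · exact key _ _ _ _ hX hY _ _
  · exact S.mul_mem _ _ _ _ (K.off_mem hX _) (K.off_mem hY _)
  · rw [add_comm]; exact S.mul_mem _ _ _ _ (K.off_mem hY _) (K.off_mem hX _)

end HermitianCoordinates

theorem superComm_apply (P : Grading k H) {i j : ZMod 2} {f g : Module.End k H}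
    (hf : f ∈ P.hom.part i) (hg : g ∈ P.hom.part j) :
    superComm P f g = f * g - ksign k i j • (g * f) := by
  rw [superComm, LinearMap.sub_apply, LinearMap.sub_apply, superFlip_apply _ _ _ hg hf, ksign_comm]
  rfl

theorem mul_mem_hom (J : Superalgebra k H) {i : ZMod 2} {X : H} (hX : X ∈ J.grading.part i) :
    J.mul X ∈ J.grading.hom.part i :=
  Grading.mem_hom_part.2 fun j Y hY => J.mul_mem i j X Y hX hY

theorem innerDer_apply (J : Superalgebra k H) {i j : ZMod 2} {X Y : H}
    (hX : X ∈ J.grading.part i) (hY : Y ∈ J.grading.part j) (Z : H) :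
    innerDer J X Y Z = J.mul X (J.mul Y Z) - ksign k i j • J.mul Y (J.mul X Z) := by
  have h : innerDer J X Y = superComm J.grading (J.mul X) (J.mul Y) := rfl
  rw [h, superComm_apply _ (mul_mem_hom J hX) (mul_mem_hom J hY)]
  rfl

end

namespace HermitianCoordinates

variable {k A H : Type*} [Field k] [AddCommGroup A] [Module k A] [AddCommGroup H] [Module k H]
  {S : NormedSuperalgebra k A} {J : Superalgebra k H} (K : HermitianCoordinates S J)

/-- Cyclic invariance of the trilinear form b(x, y•z), from symmetry and associativity of the form.
-/
theorem polar_mul_cyclic (hS : SymmComposition S) {i j l : ZMod 2} {x y z : A}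
    (hx : x ∈ S.grading.part i) (hy : y ∈ S.grading.part j) (hz : z ∈ S.grading.part l) :
    S.polar x (S.mul y z) = ksign k i j * ksign k i l * S.polar y (S.mul z x) := by
  rw [hS.symm _ _ _ _ hx (S.mul_mem _ _ _ _ hy hz), hS.assoc, ksign_add_right]

variable [CharP k 3]

/-- The triple acts on off-diagonal coordinates only, so here d is arbitrary. Both sides are
combinations of the forms b(x, y•z), which cyclic invariance brings to a common shape. -/
theorem innerDer_diag (hS : SymmComposition S) {i j l : ZMod 2} {X Y Z : H}
    (hX : X ∈ J.grading.part i) (hY : Y ∈ J.grading.part j) (hZ : Z ∈ J.grading.part l)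
    (d : Fin 3 → Module.End k A) (m : Fin 3) :
    K.diag (innerDer J X Y Z) m = K.diag (K.derOp (d, K.innerVec X Y) Z) m := by
  obtain ⟨f1, f2, f3, f4⟩ := fin_three_add m
  have x0 := K.off_mem hX m
  have x1 := K.off_mem hX (m + 1)
  have x2 := K.off_mem hX (m + 2)
  have y0 := K.off_mem hY m
  have y1 := K.off_mem hY (m + 1)
  have y2 := K.off_mem hY (m + 2)
  have z0 := K.off_mem hZ m
  have z1 := K.off_mem hZ (m + 1)
  have z2 := K.off_mem hZ (m + 2)
  have F1 := polar_mul_cyclic hS x1 y2 z0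
  have F2 := polar_mul_cyclic hS y1 x2 z0
  have F3 := polar_mul_cyclic hS x1 z2 y0
  have F4 := polar_mul_cyclic hS y1 z2 x0
  have F5 := polar_mul_cyclic hS z2 y0 x1
  have F6 := polar_mul_cyclic hS z2 x0 y1
  have s1 := ksign_mul_self k i j
  have s2 := ksign_mul_self k i l
  have s3 := ksign_mul_self k j l
  rw [innerDer_apply J hX hY, diag_sub, diag_smul, diag_mul', diag_mul', diag_mul', diag_mul',
    diag_derOp, K.off_mul' hY hZ, K.off_mul' hY hZ, K.off_mul' hX hZ, K.off_mul' hX hZ,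
    K.innerVec_apply hX hY, K.innerVec_apply hX hY]
  simp only [f1, f2, f3, f4]
  have a0 := K.ksign_mul_diag hX j m
  have a1 := K.ksign_mul_diag hX j (m + 1)
  have a2 := K.ksign_mul_diag hX j (m + 2)
  have b0 := K.ksign_mul_diag hY i m
  have b1 := K.ksign_mul_diag hY i (m + 1)
  have b2 := K.ksign_mul_diag hY i (m + 2)
  have c0 := K.ksign_mul_diag hZ i m
  have c1 := K.ksign_mul_diag hZ i (m + 1)
  have c2 := K.ksign_mul_diag hZ i (m + 2)
  have d0 := K.ksign_mul_diag hZ j m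
  have d1 := K.ksign_mul_diag hZ j (m + 1)
  have d2 := K.ksign_mul_diag hZ j (m + 2)
  have e1 := hS.symm _ _ _ _ x1 y1
  have e2 := hS.symm _ _ _ _ x2 y2
  simp only [map_add, map_sub, map_smul, LinearMap.add_apply, LinearMap.sub_apply,
    LinearMap.smul_apply, smul_eq_mul, hS.assoc, ksign_comm k j i, ksign_comm k l i,
    ksign_comm k l j] at *
  generalize K.diag X m = α0 at *
  generalize K.diag X (m + 1) = α1 at *
  generalize K.diag X (m + 2) = α2 at *
  generalize K.diag Y m = β0 at *
  generalize K.diag Y (m + 1) = β1 at *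
  generalize K.diag Y (m + 2) = β2 at *
  generalize K.diag Z m = γ0 at *
  generalize K.diag Z (m + 1) = γ1 at *
  generalize K.diag Z (m + 2) = γ2 at *
  clear x0 x1 x2 y0 y1 y2 z0 z1 z2 hX hY hZ f1 f2 f3 f4
  -- From here the three indices are independent names: the cyclic relations among them have already
  -- been used.
  generalize m + 1 = m1 at *
  generalize m + 2 = m2 at *
  grind

/-- Cubic terms in the off-diagonal coordinates come from x•(y•z) and (x•y)•z in various orders;
three right and three left identities bring them to the order in which they occur in σ, r_x l_y and
l_x r_y. Terms containing a diagonal coordinate form the contribution of `innerVec`. -/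
theorem innerDer_off (hS : SymmComposition S) {i j l : ZMod 2} {X Y Z : H}
    (hX : X ∈ J.grading.part i) (hY : Y ∈ J.grading.part j) (hZ : Z ∈ J.grading.part l)
    (m : Fin 3) :
    K.off (innerDer J X Y Z) m =
      K.off (K.derOp (tSum S (K.off X) (K.off Y), K.innerVec X Y) Z) m := by
  obtain ⟨f1, f2, f3, f4⟩ := fin_three_add m
  have x0 := K.off_mem hX m
  have x1 := K.off_mem hX (m + 1)
  have x2 := K.off_mem hX (m + 2)
  have y0 := K.off_mem hY m
  have y1 := K.off_mem hY (m + 1)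
  have y2 := K.off_mem hY (m + 2)
  have z0 := K.off_mem hZ m
  have z1 := K.off_mem hZ (m + 1)
  have z2 := K.off_mem hZ (m + 2)
  have Ra := hS.right _ _ _ _ _ _ x1 y0 z1
  have Rb := hS.right _ _ _ _ _ _ y1 x0 z1
  have Rc := hS.right _ _ _ _ _ _ x1 z0 y1
  have La := hS.left _ _ _ _ _ _ z2 y0 x2
  have Lb := hS.left _ _ _ _ _ _ z2 x0 y2
  have Lc := hS.left _ _ _ _ _ _ y2 z0 x2
  have s1 := ksign_mul_self k i j
  have s2 := ksign_mul_self k i l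
  have s3 := ksign_mul_self k j l
  rw [innerDer_apply J hX hY, off_sub, off_smul, K.off_mul' hX (J.mul_mem _ _ _ _ hY hZ),
    K.off_mul' hY (J.mul_mem _ _ _ _ hX hZ), diag_mul', diag_mul', diag_mul', diag_mul',
    K.off_derOp' (fun m => K.innerVec_mem hX hY m) hZ, K.off_mul' hY hZ, K.off_mul' hY hZ,
    K.off_mul' hY hZ, K.off_mul' hX hZ, K.off_mul' hX hZ, K.off_mul' hX hZ,
    K.innerVec_apply hX hY, K.innerVec_apply hX hY, K.innerVec_apply hX hY, tSum,
    LinearMap.add_apply, LinearMap.add_apply, tElem_zero S x0 y0 z0, tElem_two S x1 y1 z0,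
    tElem_one S x2 y2 z0]
  simp only [f1, f2, f3, f4]
  have a0 := K.ksign_mul_diag hX j m
  have a1 := K.ksign_mul_diag hX j (m + 1)
  have a2 := K.ksign_mul_diag hX j (m + 2)
  have a0' := K.ksign_mul_diag hX l m
  have a1' := K.ksign_mul_diag hX l (m + 1)
  have a2' := K.ksign_mul_diag hX l (m + 2)
  have b0 := K.ksign_mul_diag hY i m
  have b1 := K.ksign_mul_diag hY i (m + 1)
  have b2 := K.ksign_mul_diag hY i (m + 2)
  have b0' := K.ksign_mul_diag hY l m
  have b1' := K.ksign_mul_diag hY l (m + 1)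
  have b2' := K.ksign_mul_diag hY l (m + 2)
  have c0 := K.ksign_mul_diag hZ i m
  have c1 := K.ksign_mul_diag hZ i (m + 1)
  have c2 := K.ksign_mul_diag hZ i (m + 2)
  have d0 := K.ksign_mul_diag hZ j m
  have d1 := K.ksign_mul_diag hZ j (m + 1)
  have d2 := K.ksign_mul_diag hZ j (m + 2)
  have p0 := S.ksign_mul_polar x0 z0 j
  have p1 := S.ksign_mul_polar x1 z1 j
  have p2 := S.ksign_mul_polar x2 z2 j
  have q0 := S.ksign_mul_polar y0 z0 i
  have q1 := S.ksign_mul_polar y1 z1 i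
  have q2 := S.ksign_mul_polar y2 z2 i
  have r1 := S.ksign_mul_polar x1 y1 l
  have r2 := S.ksign_mul_polar x2 y2 l
  simp only [map_add, map_sub, map_smul, LinearMap.add_apply, LinearMap.sub_apply,
    LinearMap.smul_apply, ksign_comm k j i, ksign_comm k l i,
    ksign_comm k l j, ksign_add_left, ksign_add_right, hS.symm _ _ _ _ z2 x2,
    hS.symm _ _ _ _ z2 y2, hS.symm _ _ _ _ y2 x2]
    at Ra Rb Rc La Lb Lc b0 b1 b2 c0 c1 c2 d0 d1 d2 p0 p1 p2 q0 q1 q2 r1 r2 ⊢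
  clear x0 x1 x2 y0 y1 y2 z0 z1 z2 hX hY hZ f1 f2 f3 f4
  generalize m + 1 = m1 at *
  generalize m + 2 = m2 at *
  linear_combination (norm := skip) Ra - ksign k i j • Rb +
    (ksign k i j * ksign k i l * ksign k j l) • La - (ksign k j l * ksign k i l) • Lb -
    ksign k j l • Rc - (ksign k i j * ksign k i l) • Lc
  clear Ra Rb Rc La Lb Lc
  match_scalars <;> grind

/-- All that is needed about inner derivations is read off from this pair: that they are
derivations, that they are cyclic, and what their images in g(S₄, S) are. -/
theorem innerDer_eq (hS : SymmComposition S) {i j : ZMod 2} {X Y : H}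
    (hX : X ∈ J.grading.part i) (hY : Y ∈ J.grading.part j) :
    innerDer J X Y = K.derOp (tSum S (K.off X) (K.off Y), K.innerVec X Y) :=
  J.grading.hom_ext fun _ _ hZ => K.ext (fun m => K.innerDer_diag hS hX hY hZ _ m)
    fun m => K.innerDer_off hS hX hY hZ m

end HermitianCoordinates

/-! ### Derivations of J from triality triples and vectors -/

namespace HermitianCoordinates

variable {k A H : Type*} [Field k] [AddCommGroup A] [Module k A] [AddCommGroup H] [Module k H]
  {S : NormedSuperalgebra k A} {J : Superalgebra k H} (K : HermitianCoordinates S J)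

theorem diag_smul_mem {i j : ZMod 2} {X : H} {y : A} (hX : X ∈ J.grading.part i)
    (hy : y ∈ S.grading.part j) (m : Fin 3) : K.diag X m • y ∈ S.grading.part (i + j) := by
  rcases zmod_two_cases i with rfl | rfl
  · rw [zero_add]
    exact Submodule.smul_mem _ _ hy
  · have h : K.diag X = 0 := ((K.mem_part 1 X).1 hX).1 rfl
    rw [h, Pi.zero_apply, zero_smul]
    exact zero_mem _

theorem polar_eq_zero_of_add {i j : ZMod 2} {x y : A} (hx : x ∈ S.grading.part i)
    (hy : y ∈ S.grading.part j) (h : i + j = 1) : S.polar x y = 0 := by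
  refine S.polar_even _ _ _ _ hx hy ?_
  rintro rfl
  rcases zmod_two_cases i with rfl | rfl <;> simp [zmod_two_one_add_one] at h

theorem derOp_hom {p : ZMod 2} {d : Fin 3 → Module.End k A} {v : Fin 3 → A}
    (hd : ∀ m, d m ∈ S.grading.hom.part p) (hv : ∀ m, v m ∈ S.grading.part p) :
    K.derOp (d, v) ∈ J.grading.hom.part p := by
  refine Grading.mem_hom_part.2 fun j X hX => (K.mem_part _ _).2 ⟨fun h => ?_, fun m => ?_⟩
  · funext m
    change K.diag (K.derOp (d, v) X) m = 0
    rw [diag_derOp, polar_eq_zero_of_add (hv _) (K.off_mem hX _) h,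
      polar_eq_zero_of_add (hv _) (K.off_mem hX _) h, sub_zero]
  · change K.off (K.derOp (d, v) X) m ∈ _
    rw [K.off_derOp' hv hX, sub_smul]
    refine sub_mem (add_mem (add_mem (Grading.hom_mem (hd m) (K.off_mem hX m)) ?_)
      (S.mul_mem _ _ _ _ (hv _) (K.off_mem hX _))) (Submodule.smul_mem _ _ ?_)
    · rw [add_comm]
      exact sub_mem (K.diag_smul_mem hX (hv _) _) (K.diag_smul_mem hX (hv _) _)
    · rw [add_comm]
      exact S.mul_mem _ _ _ _ (K.off_mem hX _) (hv _)

variable [CharP k 3]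

/-- The triple contributes nothing because its components are skew for b. The vector part reduces to
symmetry and cyclic invariance of the form. -/
theorem derOp_mul_diag (hS : SymmComposition S) {p i j : ZMod 2} {d : Fin 3 → Module.End k A}
    {v : Fin 3 → A} (hd : d ∈ triPart S p) (hv : ∀ m, v m ∈ S.grading.part p) {X Y : H}
    (hX : X ∈ J.grading.part i) (hY : Y ∈ J.grading.part j) (m : Fin 3) :
    K.diag (K.derOp (d, v) (J.mul X Y)) m =
      K.diag (J.mul (K.derOp (d, v) X) Y + ksign k p i • J.mul X (K.derOp (d, v) Y)) m := by
  obtain ⟨f1, f2, f3, f4⟩ := fin_three_add m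
  have x0 := K.off_mem hX m
  have x1 := K.off_mem hX (m + 1)
  have x2 := K.off_mem hX (m + 2)
  have y0 := K.off_mem hY m
  have y1 := K.off_mem hY (m + 1)
  have y2 := K.off_mem hY (m + 2)
  have v0 := hv m
  have v1 := hv (m + 1)
  have v2 := hv (m + 2)
  have h1 := (hd.1 (m + 1)).2 _ _ (K.off Y (m + 1)) x1
  have h2 := (hd.1 (m + 2)).2 _ _ (K.off Y (m + 2)) x2
  have s1 := ksign_mul_self k p i
  have s2 := ksign_mul_self k p j
  have s3 := ksign_mul_self k i j
  rw [diag_derOp, diag_add, diag_smul, diag_mul', diag_mul', diag_derOp, diag_derOp,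
    K.off_mul' hX hY, K.off_mul' hX hY, K.off_derOp' hv hX, K.off_derOp' hv hX,
    K.off_derOp' hv hY, K.off_derOp' hv hY]
  simp only [f1, f2, f3, f4]
  have F1 := polar_mul_cyclic hS v1 x2 y0
  have F2 := polar_mul_cyclic hS x1 v2 y0
  have F3 := polar_mul_cyclic hS x0 v1 y2
  have F4 := polar_mul_cyclic hS v0 x1 y2
  have a0 := K.ksign_mul_diag hX p m
  have a1 := K.ksign_mul_diag hX p (m + 1)
  have a2 := K.ksign_mul_diag hX p (m + 2)
  have e1 := hS.symm _ _ _ _ v1 x1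
  have e2 := hS.symm _ _ _ _ v2 x2
  have b0 := K.ksign_mul_diag hY p m
  have b1 := K.ksign_mul_diag hY p (m + 1)
  have b2 := K.ksign_mul_diag hY p (m + 2)
  have c0 := K.ksign_mul_diag hY i m
  have c1 := K.ksign_mul_diag hY i (m + 1)
  have c2 := K.ksign_mul_diag hY i (m + 2)
  simp only [map_add, map_sub, map_smul, LinearMap.add_apply, LinearMap.sub_apply,
    LinearMap.smul_apply, smul_eq_mul, hS.assoc, ksign_comm k i p, ksign_comm k j p,
    ksign_comm k j i] at *
  clear x0 x1 x2 y0 y1 y2 v0 v1 v2 hd hv hX hY f1 f2 f3 f4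
  generalize m + 1 = m1 at *
  generalize m + 2 = m2 at *
  grind

/-- The terms in d cancel by the triality relation at index m, and the cubic terms in v, x, y by
three right and three left identities. -/
theorem derOp_mul_off (hS : SymmComposition S) {p i j : ZMod 2} {d : Fin 3 → Module.End k A}
    {v : Fin 3 → A} (hd : d ∈ triPart S p) (hv : ∀ m, v m ∈ S.grading.part p) {X Y : H}
    (hX : X ∈ J.grading.part i) (hY : Y ∈ J.grading.part j) (m : Fin 3) :
    K.off (K.derOp (d, v) (J.mul X Y)) m =
      K.off (J.mul (K.derOp (d, v) X) Y + ksign k p i • J.mul X (K.derOp (d, v) Y)) m := by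
  obtain ⟨f1, f2, f3, f4⟩ := fin_three_add m
  have hdh : ∀ m, d m ∈ S.grading.hom.part p := fun m => (hd.1 m).1
  have x0 := K.off_mem hX m
  have x1 := K.off_mem hX (m + 1)
  have x2 := K.off_mem hX (m + 2)
  have y0 := K.off_mem hY m
  have y1 := K.off_mem hY (m + 1)
  have y2 := K.off_mem hY (m + 2)
  have v0 := hv m
  have v1 := hv (m + 1)
  have v2 := hv (m + 2)
  have h1 := triPart_mul hS hd m (K.off Y (m + 2)) x1
  have h2 := triPart_mul hS hd m (K.off X (m + 2)) y1
  have s1 := ksign_mul_self k p i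
  have s2 := ksign_mul_self k p j
  have s3 := ksign_mul_self k i j
  rw [K.off_derOp' hv (J.mul_mem _ _ _ _ hX hY), off_add, off_smul,
    K.off_mul' (Grading.hom_mem (K.derOp_hom hdh hv) hX) hY,
    K.off_mul' hX (Grading.hom_mem (K.derOp_hom hdh hv) hY)]
  simp only [diag_mul', diag_derOp, K.off_mul' hX hY, K.off_derOp' hv hX, K.off_derOp' hv hY,
    f1, f2, f3, f4]
  have R1 := hS.right _ _ _ _ _ _ v1 x0 y1
  have R2 := hS.right _ _ _ _ _ _ v1 y0 x1
  have R3 := hS.right _ _ _ _ _ _ x1 v0 y1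
  have L1 := hS.left _ _ _ _ _ _ x2 y0 v2
  have L2 := hS.left _ _ _ _ _ _ y2 x0 v2
  have L3 := hS.left _ _ _ _ _ _ x2 v0 y2
  have a0 := K.ksign_mul_diag hX p m
  have a1 := K.ksign_mul_diag hX p (m + 1)
  have a2 := K.ksign_mul_diag hX p (m + 2)
  have a0' := K.ksign_mul_diag hX j m
  have a1' := K.ksign_mul_diag hX j (m + 1)
  have a2' := K.ksign_mul_diag hX j (m + 2)
  have b0 := K.ksign_mul_diag hY p m
  have b1 := K.ksign_mul_diag hY p (m + 1)
  have b2 := K.ksign_mul_diag hY p (m + 2)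
  have c0 := K.ksign_mul_diag hY i m
  have c1 := K.ksign_mul_diag hY i (m + 1)
  have c2 := K.ksign_mul_diag hY i (m + 2)
  have e2 := hS.symm _ _ _ _ x2 v2
  have g2 := hS.symm _ _ _ _ y2 v2
  have p0 := S.ksign_mul_polar v0 x0 j
  have p1 := S.ksign_mul_polar v1 x1 j
  have p2 := S.ksign_mul_polar v2 x2 j
  have q0 := S.ksign_mul_polar v0 y0 i
  have q1 := S.ksign_mul_polar v1 y1 i
  have q2 := S.ksign_mul_polar v2 y2 i
  have r0 := S.ksign_mul_polar x0 y0 p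
  have r1 := S.ksign_mul_polar x1 y1 p
  have r2 := S.ksign_mul_polar x2 y2 p
  simp only [map_add, map_sub, map_smul, LinearMap.add_apply, LinearMap.sub_apply,
    LinearMap.smul_apply, ksign_comm k i p, ksign_comm k j p, ksign_comm k j i,
    ksign_add_left, ksign_add_right, e2, g2, h1, h2]
    at R1 R2 R3 L1 L2 L3 a0 a1 a2 b0 b1 b2 c0 c1 c2 p0 p1 p2 q0 q1 q2 r0 r1 r2 ⊢
  clear x0 x1 x2 y0 y1 y2 v0 v1 v2 hd hv hX hY f1 f2 f3 f4 e2 g2 h1 h2 hdh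
  generalize m + 1 = m1 at *
  generalize m + 2 = m2 at *
  linear_combination (norm := skip) R1 + ksign k i j • R2 - ksign k p i • R3 -
    (ksign k p i * ksign k p j) • L1 - (ksign k p i * ksign k p j * ksign k i j) • L2 +
    ksign k p i • L3
  clear R1 R2 R3 L1 L2 L3
  match_scalars <;> grind

theorem derOp_mem (hS : SymmComposition S) {p : ZMod 2} {d : Fin 3 → Module.End k A}
    {v : Fin 3 → A} (hd : d ∈ triPart S p) (hv : ∀ m, v m ∈ S.grading.part p) :
    K.derOp (d, v) ∈ derPart J p := by
  refine ⟨K.derOp_hom (fun m => (hd.1 m).1) hv, fun i X Y hX => ?_⟩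
  induction Y using J.grading.induction with
  | hadd Y Z hY hZ =>
    simp only [map_add, hY, hZ]
    module
  | hom j Y hY =>
    exact K.ext (K.derOp_mul_diag hS hd hv hX hY) (K.derOp_mul_off hS hd hv hX hY)

end HermitianCoordinates

/-! ### The cyclic identity for inner derivations -/

namespace HermitianCoordinates

variable {k A H : Type*} [Field k] [AddCommGroup A] [Module k A] [AddCommGroup H] [Module k H]
  {S : NormedSuperalgebra k A} {J : Superalgebra k H} (K : HermitianCoordinates S J) [CharP k 3]

/-- Each right or left identity replaces a pair of products x•(y•z), z•(y•x) or (x•y)•z, (z•y)•x by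
a value of b; these values cancel against those in the diagonal coordinates of the products. -/
theorem innerVec_cyclic (hS : SymmComposition S) {i j l : ZMod 2} {X Y Z : H}
    (hX : X ∈ J.grading.part i) (hY : Y ∈ J.grading.part j) (hZ : Z ∈ J.grading.part l) :
    ksign k i l • K.innerVec (J.mul X Y) Z + ksign k i j • K.innerVec (J.mul Y Z) X +
      ksign k j l • K.innerVec (J.mul Z X) Y = 0 := by
  funext m
  obtain ⟨f1, f2, f3, f4⟩ := fin_three_add m
  have x0 := K.off_mem hX m
  have x1 := K.off_mem hX (m + 1)
  have x2 := K.off_mem hX (m + 2)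
  have y0 := K.off_mem hY m
  have y1 := K.off_mem hY (m + 1)
  have y2 := K.off_mem hY (m + 2)
  have z0 := K.off_mem hZ m
  have z1 := K.off_mem hZ (m + 1)
  have z2 := K.off_mem hZ (m + 2)
  have s1 := ksign_mul_self k i j
  have s2 := ksign_mul_self k i l
  have s3 := ksign_mul_self k j l
  have Ra := hS.right _ _ _ _ _ _ x1 y0 z1
  have Rb := hS.right _ _ _ _ _ _ y1 z0 x1
  have Rc := hS.right _ _ _ _ _ _ z1 x0 y1
  have La := hS.left _ _ _ _ _ _ x2 y0 z2
  have Lb := hS.left _ _ _ _ _ _ y2 z0 x2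
  have Lc := hS.left _ _ _ _ _ _ z2 x0 y2
  rw [Pi.add_apply, Pi.add_apply, Pi.smul_apply, Pi.smul_apply, Pi.smul_apply, Pi.zero_apply,
    K.innerVec_apply (J.mul_mem _ _ _ _ hX hY) hZ, K.innerVec_apply (J.mul_mem _ _ _ _ hY hZ) hX,
    K.innerVec_apply (J.mul_mem _ _ _ _ hZ hX) hY]
  simp only [diag_mul', K.off_mul' hX hY, K.off_mul' hY hZ, K.off_mul' hZ hX, f1, f2, f3, f4]
  have a0 := K.ksign_mul_diag hX j m
  have a1 := K.ksign_mul_diag hX j (m + 1)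
  have a2 := K.ksign_mul_diag hX j (m + 2)
  have a0' := K.ksign_mul_diag hX l m
  have a1' := K.ksign_mul_diag hX l (m + 1)
  have a2' := K.ksign_mul_diag hX l (m + 2)
  have b0 := K.ksign_mul_diag hY i m
  have b1 := K.ksign_mul_diag hY i (m + 1)
  have b2 := K.ksign_mul_diag hY i (m + 2)
  have b0' := K.ksign_mul_diag hY l m
  have b1' := K.ksign_mul_diag hY l (m + 1)
  have b2' := K.ksign_mul_diag hY l (m + 2)
  have c0 := K.ksign_mul_diag hZ i m
  have c1 := K.ksign_mul_diag hZ i (m + 1)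
  have c2 := K.ksign_mul_diag hZ i (m + 2)
  have d0 := K.ksign_mul_diag hZ j m
  have d1 := K.ksign_mul_diag hZ j (m + 1)
  have d2 := K.ksign_mul_diag hZ j (m + 2)
  have p1 := S.ksign_mul_polar x1 z1 j
  have p2 := S.ksign_mul_polar x2 z2 j
  have q1 := S.ksign_mul_polar y1 z1 i
  have q2 := S.ksign_mul_polar y2 z2 i
  have r1 := S.ksign_mul_polar x1 y1 l
  have r2 := S.ksign_mul_polar x2 y2 l
  simp only [map_add, map_sub, map_smul, LinearMap.add_apply, LinearMap.sub_apply,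
    LinearMap.smul_apply, ksign_comm k j i, ksign_comm k l i, ksign_comm k l j, ksign_add_left,
    hS.symm _ _ _ _ z1 x1, hS.symm _ _ _ _ z2 x2, hS.symm _ _ _ _ z1 y1,
    hS.symm _ _ _ _ z2 y2, hS.symm _ _ _ _ y1 x1, hS.symm _ _ _ _ y2 x2]
    at Ra Rb Rc La Lb Lc b0 b1 b2 c0 c1 c2 d0 d1 d2 p1 p2 q1 q2 r1 r2 ⊢
  clear x0 x1 x2 y0 y1 y2 z0 z1 z2 hX hY hZ f1 f2 f3 f4
  generalize m + 1 = m1 at *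
  generalize m + 2 = m2 at *
  linear_combination (norm := skip) ksign k i l • Ra + ksign k i j • Rb + ksign k j l • Rc -
    ksign k i l • La - ksign k i j • Lb - ksign k j l • Lc
  clear Ra Rb Rc La Lb Lc
  match_scalars <;> grind

/-- An off-diagonal coordinate of a product consists of para-products and of multiples by diagonal
coordinates. The para-products cancel by the cyclic relation for t, used once for each order of X,
Y, Z; the multiples cancel in pairs since t is skew. -/
theorem tSum_cyclic (hS : SymmComposition S) {i j l : ZMod 2} {X Y Z : H}
    (hX : X ∈ J.grading.part i) (hY : Y ∈ J.grading.part j) (hZ : Z ∈ J.grading.part l) :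
    ksign k i l • tSum S (K.off (J.mul X Y)) (K.off Z) +
      ksign k i j • tSum S (K.off (J.mul Y Z)) (K.off X) +
      ksign k j l • tSum S (K.off (J.mul Z X)) (K.off Y) = 0 := by
  funext m
  obtain ⟨f1, f2, f3, f4⟩ := fin_three_add m
  have x0 := K.off_mem hX m
  have x1 := K.off_mem hX (m + 1)
  have x2 := K.off_mem hX (m + 2)
  have y0 := K.off_mem hY m
  have y1 := K.off_mem hY (m + 1)
  have y2 := K.off_mem hY (m + 2)
  have z0 := K.off_mem hZ m
  have z1 := K.off_mem hZ (m + 1)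
  have z2 := K.off_mem hZ (m + 2)
  have s1 := ksign_mul_self k i j
  have s2 := ksign_mul_self k i l
  have s3 := ksign_mul_self k j l
  have T1 := tElem_cyclic_zero hS x1 y2 z0
  have T2 := tElem_cyclic_zero hS y1 z2 x0
  have T3 := tElem_cyclic_zero hS z1 x2 y0
  have T4 := tElem_cyclic_zero hS y1 x2 z0
  have T5 := tElem_cyclic_zero hS z1 y2 x0
  have T6 := tElem_cyclic_zero hS x1 z2 y0
  have a0 := K.ksign_mul_diag hX j m
  have a1 := K.ksign_mul_diag hX j (m + 1)
  have a2 := K.ksign_mul_diag hX j (m + 2)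
  have a0' := K.ksign_mul_diag hX l m
  have a1' := K.ksign_mul_diag hX l (m + 1)
  have a2' := K.ksign_mul_diag hX l (m + 2)
  have b0 := K.ksign_mul_diag hY i m
  have b1 := K.ksign_mul_diag hY i (m + 1)
  have b2 := K.ksign_mul_diag hY i (m + 2)
  have b0' := K.ksign_mul_diag hY l m
  have b1' := K.ksign_mul_diag hY l (m + 1)
  have b2' := K.ksign_mul_diag hY l (m + 2)
  have c0 := K.ksign_mul_diag hZ i m
  have c1 := K.ksign_mul_diag hZ i (m + 1)
  have c2 := K.ksign_mul_diag hZ i (m + 2)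
  have d0 := K.ksign_mul_diag hZ j m
  have d1 := K.ksign_mul_diag hZ j (m + 1)
  have d2 := K.ksign_mul_diag hZ j (m + 2)
  simp only [tSum, Pi.add_apply, Pi.smul_apply, Pi.zero_apply, K.off_mul' hX hY,
    K.off_mul' hY hZ, K.off_mul' hZ hX, f1, f2, f3, f4, map_add, map_sub, map_smul,
    LinearMap.add_apply, LinearMap.sub_apply, LinearMap.smul_apply, Pi.sub_apply,
    tElem_skew hS y0 x0, tElem_skew hS z0 x0, tElem_skew hS z0 y0,
    tElem_skew hS y1 x1, tElem_skew hS z1 x1, tElem_skew hS z1 y1,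
    tElem_skew hS y2 x2, tElem_skew hS z2 x2, tElem_skew hS z2 y2, Pi.neg_apply,
    ksign_comm k j i, ksign_comm k l i, ksign_comm k l j,
    ksign_add_right] at T1 T2 T3 T4 T5 T6 b0 b1 b2 c0 c1 c2 d0 d1 d2 ⊢
  clear x0 x1 x2 y0 y1 y2 z0 z1 z2 hX hY hZ f1 f2 f3 f4
  generalize m + 1 = m1 at *
  generalize m + 2 = m2 at *
  linear_combination (norm := skip) ksign k i l • T1 + ksign k i j • T2 + ksign k j l • T3 +
    (ksign k i l * ksign k i j) • T4 + (ksign k i j * ksign k j l) • T5 +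
    (ksign k j l * ksign k i l) • T6
  clear T1 T2 T3 T4 T5 T6
  match_scalars <;> grind

/-- The operator of J depends linearly on the triple and the vector, and both satisfy the cyclic
relation. -/
theorem innerDer_cyclic (K : HermitianCoordinates S J) (hS : SymmComposition S) {i j l : ZMod 2} {X Y Z : H}
    (hX : X ∈ J.grading.part i) (hY : Y ∈ J.grading.part j) (hZ : Z ∈ J.grading.part l) :
    ksign k i l • innerDer J (J.mul X Y) Z + ksign k i j • innerDer J (J.mul Y Z) X +
      ksign k j l • innerDer J (J.mul Z X) Y = 0 := by
  rw [K.innerDer_eq hS (J.mul_mem _ _ _ _ hX hY) hZ, K.innerDer_eq hS (J.mul_mem _ _ _ _ hY hZ) hX,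
    K.innerDer_eq hS (J.mul_mem _ _ _ _ hZ hX) hY, ← map_smul, ← map_smul, ← map_smul, ← map_add,
    ← map_add]
  simp only [Prod.smul_mk, Prod.mk_add_mk]
  rw [K.innerVec_cyclic hS hX hY hZ, K.tSum_cyclic hS hX hY hZ, Prod.mk_zero_zero, map_zero]

theorem tSum_mem (hS : SymmComposition S) {i j : ZMod 2} {x y : Fin 3 → A}
    (hx : ∀ m, x m ∈ S.grading.part i) (hy : ∀ m, y m ∈ S.grading.part j) :
    tSum S x y ∈ triPart S (i + j) := by
  -- The sum of the shifts θ^i t_{x_i,y_i}, in terms of the shift m ↦ m + 1, which is the inverse of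
  -- θ.
  have e : tSum S x y = (fun m => tElem S (x 0) (y 0) m) + (fun m => tElem S (x 1) (y 1) (m + 1 + 1))
      + fun m => tElem S (x 2) (y 2) (m + 1) := by
    funext m
    fin_cases m <;> simp [tSum] <;> abel
  rw [e]
  have h := fun m => tElem_mem hS (hx m) (hy m)
  exact add_mem (add_mem (h 0) (triPart_rotate hS (triPart_rotate hS (h 1))))
    (triPart_rotate hS (h 2))

theorem innerDer_mem (K : HermitianCoordinates S J) (hS : SymmComposition S) {i j : ZMod 2} {X Y : H}
    (hX : X ∈ J.grading.part i) (hY : Y ∈ J.grading.part j) :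
    innerDer J X Y ∈ derPart J (i + j) := by
  rw [K.innerDer_eq hS hX hY]
  exact K.derOp_mem hS (tSum_mem hS (K.off_mem hX) (K.off_mem hY)) (K.innerVec_mem hX hY)

end HermitianCoordinates

/-! ### Peirce decomposition and the structure of der J -/

theorem fin_three_cases (i m : Fin 3) : i = m ∨ i = m + 1 ∨ i = m + 2 := by
  revert i m; decide

theorem fin_three_ne (m : Fin 3) : m + 1 ≠ m ∧ m + 2 ≠ m ∧ m + 1 ≠ m + 2 ∧ m ≠ m + 1 ∧ m ≠ m + 2 ∧
    m + 2 ≠ m + 1 := by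
  revert m; decide

namespace HermitianCoordinates

variable {k A H : Type*} [Field k] [AddCommGroup A] [Module k A] [AddCommGroup H] [Module k H]
  {S : NormedSuperalgebra k A} {J : Superalgebra k H} (K : HermitianCoordinates S J)

/-- The diagonal idempotents. -/
def idem (i : Fin 3) : H := K.coords.symm (Pi.single i 1, 0)

/-- The diagonal coordinates, as linear maps. -/
def diagMap (m : Fin 3) : H →ₗ[k] k :=
  LinearMap.proj m ∘ₗ LinearMap.fst k _ _ ∘ₗ K.coords.toLinearMap

/-- The off-diagonal coordinates, as linear maps. -/
def offMap (m : Fin 3) : H →ₗ[k] A :=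
  LinearMap.proj m ∘ₗ LinearMap.snd k _ _ ∘ₗ K.coords.toLinearMap

/-- The inclusions of the off-diagonal Peirce components. -/
def inj (m : Fin 3) : A →ₗ[k] H :=
  K.coords.symm.toLinearMap ∘ₗ LinearMap.inr k _ _ ∘ₗ LinearMap.single k (fun _ : Fin 3 => A) m

theorem diagMap_apply (m : Fin 3) (X : H) : K.diagMap m X = K.diag X m := rfl

theorem offMap_apply (m : Fin 3) (X : H) : K.offMap m X = K.off X m := rfl

theorem diag_idem (i m : Fin 3) : K.diag (K.idem i) m = if m = i then 1 else 0 := by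
  simp [diag, idem, Pi.single_apply]

theorem off_idem (i m : Fin 3) : K.off (K.idem i) m = 0 := by
  simp [off, idem]

theorem diag_inj (m n : Fin 3) (c : A) : K.diag (K.inj m c) n = 0 := by
  simp [diag, inj]

theorem off_inj (m n : Fin 3) (c : A) : K.off (K.inj m c) n = if n = m then c else 0 := by
  simp [off, inj, Pi.single_apply]

theorem diag_zero (m : Fin 3) : K.diag 0 m = 0 := by simp [diag]

theorem off_zero (m : Fin 3) : K.off 0 m = 0 := by simp [off]

theorem diag_neg (X : H) (m : Fin 3) : K.diag (-X) m = -K.diag X m := by simp [diag]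

theorem off_neg (X : H) (m : Fin 3) : K.off (-X) m = -K.off X m := by simp [off]

theorem idem_mem (i : Fin 3) : K.idem i ∈ J.grading.part 0 :=
  (K.mem_part _ _).2 ⟨fun h => absurd h (by decide), fun m => by
    change K.off (K.idem i) m ∈ _
    rw [off_idem]; exact zero_mem _⟩

theorem inj_mem {j : ZMod 2} {c : A} (hc : c ∈ S.grading.part j) (m : Fin 3) :
    K.inj m c ∈ J.grading.part j :=
  (K.mem_part _ _).2 ⟨fun _ => funext fun n => K.diag_inj m n c, fun n => by
    change K.off (K.inj m c) n ∈ _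
    rw [off_inj]
    split_ifs
    · exact hc
    · exact zero_mem _⟩

theorem sum_expand (X : H) :
    X = ∑ i, K.diag X i • K.idem i + ∑ m, K.inj m (K.off X m) := by
  refine K.ext (fun n => ?_) fun n => ?_
  · simp only [← diagMap_apply, map_add, map_sum, map_smul]
    simp [diagMap_apply, diag_idem, diag_inj]
  · simp only [← offMap_apply, map_add, map_sum, map_smul]
    simp [offMap_apply, off_idem, off_inj]

/-- The triple of operators on `S` induced by an operator on `J`. -/
def triple : Module.End k H →ₗ[k] (Fin 3 → Module.End k A) :=
  LinearMap.pi fun m => LinearMap.lcomp k A (K.inj m) ∘ₗ LinearMap.llcomp k H H A (K.offMap m)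

/-- The triple of elements of `S` given by the values of an operator at the idempotents. -/
def vec : Module.End k H →ₗ[k] (Fin 3 → A) :=
  LinearMap.pi fun m => K.offMap m ∘ₗ LinearMap.applyₗ (K.idem (m + 1))

theorem triple_apply (D : Module.End k H) (m : Fin 3) (c : A) :
    K.triple D m c = K.off (D (K.inj m c)) m := rfl

theorem vec_apply (D : Module.End k H) (m : Fin 3) : K.vec D m = K.off (D (K.idem (m + 1))) m := rfl

/-- On ι_m(c) only the triple contributes to the coordinate m; with `vec_derOp` this recovers the
pair (d, v) from the operator. -/
theorem triple_derOp (d : Fin 3 → Module.End k A) (v : Fin 3 → A) :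
    K.triple (K.derOp (d, v)) = d := by
  funext m
  ext c
  obtain ⟨h1, h2, -⟩ := fin_three_ne m
  rw [triple_apply, off_derOp]
  simp [diag_inj, off_inj, h1, h2]

theorem vec_derOp (d : Fin 3 → Module.End k A) (v : Fin 3 → A) :
    K.vec (K.derOp (d, v)) = v := by
  funext m
  obtain ⟨h1, h2, h3, h4, h5, h6⟩ := fin_three_ne m
  rw [vec_apply, off_derOp]
  simp [diag_idem, off_idem, h6]

theorem diag_idem_mul (i m : Fin 3) (X : H) :
    K.diag (J.mul (K.idem i) X) m = (if m = i then 1 else 0) * K.diag X m := by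
  simp [diag_mul', diag_idem, off_idem]

/-- The eigenvalue -1 is the Peirce eigenvalue 1/2. -/
theorem off_idem_mul {p : ZMod 2} {X : H} (hX : X ∈ J.grading.part p) (i m : Fin 3) :
    K.off (J.mul (K.idem i) X) m = if m = i then 0 else - K.off X m := by
  obtain ⟨h1, h2, h3, h4, h5, h6⟩ := fin_three_ne m
  rw [K.off_mul' (K.idem_mem i) hX]
  rcases fin_three_cases i m with rfl | rfl | rfl <;> simp [diag_idem, off_idem, *]

theorem mul_idem {p : ZMod 2} {X : H} (hX : X ∈ J.grading.part p) (i : Fin 3) :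
    J.mul X (K.idem i) = J.mul (K.idem i) X := by
  refine K.ext (fun m => ?_) fun m => ?_
  · simp [diag_mul', diag_idem, off_idem]
  · obtain ⟨h1, h2, h3, h4, h5, h6⟩ := fin_three_ne m
    rw [K.off_mul' (K.idem_mem i) hX, K.off_mul' hX (K.idem_mem i)]
    rcases fin_three_cases i m with rfl | rfl | rfl <;> simp [diag_idem, off_idem, *]

theorem idem_mul_self (i : Fin 3) : J.mul (K.idem i) (K.idem i) = K.idem i :=
  K.ext (fun m => by rw [diag_idem_mul, diag_idem]; split_ifs <;> simp)
    fun m => by rw [K.off_idem_mul (K.idem_mem i), off_idem, neg_zero, ite_self]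

theorem idem_mul_idem {i j : Fin 3} (h : i ≠ j) : J.mul (K.idem i) (K.idem j) = 0 :=
  K.ext (fun m => by
      rw [diag_idem_mul, diag_idem, diag_zero]
      split_ifs with h1 h2
      · exact absurd (h1.symm.trans h2) h
      all_goals simp)
    fun m => by rw [K.off_idem_mul (K.idem_mem j), off_idem, neg_zero, ite_self, off_zero]

theorem idem_mul_inj {j : ZMod 2} {c : A} (hc : c ∈ S.grading.part j) (i m : Fin 3) :
    J.mul (K.idem i) (K.inj m c) = if i = m then 0 else -K.inj m c := by
  refine K.ext (fun n => ?_) fun n => ?_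
  · rw [diag_idem_mul, diag_inj]
    split_ifs <;> simp [diag_zero, diag_neg, diag_inj]
  · rw [K.off_idem_mul (K.inj_mem hc m), off_inj]
    by_cases h : i = m
    · subst h
      by_cases h' : n = i <;> simp [off_zero, h']
    · rw [if_neg h, off_neg, off_inj]
      by_cases h' : n = i
      · subst h'; simp [h]
      · simp [h']

theorem inj_mul_inj (m : Fin 3) {j l : ZMod 2} {a b : A} (ha : a ∈ S.grading.part j)
    (hb : b ∈ S.grading.part l) :
    J.mul (K.inj m a) (K.inj m b) = -(S.polar a b • (K.idem (m + 1) + K.idem (m + 2))) := by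
  refine K.ext (fun n => ?_) fun n => ?_
  · obtain ⟨h1, h2, h3, h4, h5, h6⟩ := fin_three_ne m
    obtain ⟨f1, f2, f3, f4⟩ := fin_three_add m
    rw [diag_mul']
    simp only [← diagMap_apply, map_neg, map_smul, map_add, off_inj]
    simp only [diagMap_apply, diag_inj, diag_idem]
    rcases fin_three_cases n m with rfl | rfl | rfl <;> simp [*]
  · obtain ⟨h1, h2, h3, h4, h5, h6⟩ := fin_three_ne n
    rw [K.off_mul' (K.inj_mem ha m) (K.inj_mem hb m)]
    simp only [← offMap_apply, map_neg, map_smul, map_add, diag_inj]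
    simp only [offMap_apply, off_inj, off_idem]
    rcases fin_three_cases m n with rfl | rfl | rfl <;> simp [*]

theorem inj_one_mul_inj_two {j l : ZMod 2} {a b : A} (ha : a ∈ S.grading.part j)
    (hb : b ∈ S.grading.part l) :
    J.mul (K.inj 1 a) (K.inj 2 b) = K.inj 0 (S.mul a b) := by
  refine K.ext (fun n => ?_) fun n => ?_
  · rw [diag_mul']
    simp only [diag_inj, off_inj]
    fin_cases n <;> simp
  · rw [K.off_mul' (K.inj_mem ha 1) (K.inj_mem hb 2)]
    simp only [diag_inj, off_inj]
    fin_cases n <;> simp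

end HermitianCoordinates

namespace HermitianCoordinates

variable {k A H : Type*} [Field k] [AddCommGroup A] [Module k A] [AddCommGroup H]
  [Module k H] {S : NormedSuperalgebra k A} {J : Superalgebra k H} (K : HermitianCoordinates S J)

/-- Apply D to e∘e = e and compare diagonals in De = 2 e∘De: the value a at i satisfies a = 2a, and
elsewhere it is 0. -/
theorem der_idem_diag [CharP k 3] {p : ZMod 2} {D : Module.End k H} (hD : D ∈ derPart J p) (i m : Fin 3) :
    K.diag (D (K.idem i)) m = 0 := by
  have hX := Grading.hom_mem hD.1 (K.idem_mem i)
  have h := hD.2 0 (K.idem i) (K.idem i) (K.idem_mem i)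
  rw [idem_mul_self, ksign_zero_right, one_smul, K.mul_idem hX] at h
  have h' := congrArg (K.diag · m) h
  simp only [diag_add, diag_idem_mul] at h'
  split_ifs at h' <;> grind

/-- The coordinate i is the Peirce component annihilated by e_i, so De_i = 2 e_i∘De_i makes it
vanish. -/
theorem der_idem_off_self {p : ZMod 2} {D : Module.End k H} (hD : D ∈ derPart J p) (i : Fin 3) :
    K.off (D (K.idem i)) i = 0 := by
  have hX := Grading.hom_mem hD.1 (K.idem_mem i)
  have h := hD.2 0 (K.idem i) (K.idem i) (K.idem_mem i)
  rw [idem_mul_self, ksign_zero_right, one_smul, K.mul_idem hX] at h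
  have h' := congrArg (K.off · i) h
  simpa [off_add, K.off_idem_mul hX] using h'

/-- Apply D to e_{m+1}∘e_{m+2} = 0. Both idempotents act on the coordinate m as 1/2. Hence one
vector, with a component for each m, determines D on the idempotents. -/
theorem der_idem_off_add {p : ZMod 2} {D : Module.End k H} (hD : D ∈ derPart J p) (m : Fin 3) :
    K.off (D (K.idem (m + 2))) m = -K.off (D (K.idem (m + 1))) m := by
  obtain ⟨h1, h2, h3, h4, h5, h6⟩ := fin_three_ne m
  have hX := Grading.hom_mem hD.1 (K.idem_mem (m + 1))
  have hY := Grading.hom_mem hD.1 (K.idem_mem (m + 2))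
  have h := hD.2 0 (K.idem (m + 1)) (K.idem (m + 2)) (K.idem_mem _)
  rw [K.idem_mul_idem h3, map_zero, ksign_zero_right, one_smul, K.mul_idem hX] at h
  have h' := congrArg (K.off · m) h
  simp only [off_add, K.off_idem_mul hX, K.off_idem_mul hY, off_zero, h4, h5, if_false] at h'
  rw [← neg_add, eq_comm, neg_eq_zero, add_comm] at h'
  exact eq_neg_of_add_eq_zero_left h'

theorem vec_mem {p : ZMod 2} {D : Module.End k H} (hD : D ∈ J.grading.hom.part p) (m : Fin 3) :
    K.vec D m ∈ S.grading.part p := by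
  have := K.off_mem (Grading.hom_mem hD (K.idem_mem (m + 1))) m
  rwa [add_zero] at this

theorem derOp_vec_idem [CharP k 3] {p : ZMod 2} {D : Module.End k H} (hD : D ∈ derPart J p) (i : Fin 3) :
    K.derOp (0, K.vec D) (K.idem i) = D (K.idem i) := by
  refine K.ext (fun m => ?_) fun m => ?_
  · rw [K.der_idem_diag hD, diag_derOp, off_idem, off_idem, map_zero, map_zero, sub_zero]
  · rw [off_derOp]
    obtain ⟨h1, h2, h3, h4, h5, h6⟩ := fin_three_ne m
    simp only [off_idem, map_zero, diag_idem, vec_apply]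
    rcases fin_three_cases i m with rfl | rfl | rfl
    · simp [h1, h2, K.der_idem_off_self hD]
    · simp [h6]
    · simp [h3, K.der_idem_off_add hD]

theorem triple_hom {p : ZMod 2} {D : Module.End k H} (hD : D ∈ J.grading.hom.part p) (m : Fin 3) :
    K.triple D m ∈ S.grading.hom.part p :=
  Grading.mem_hom_part.2 fun _ _ hc => K.off_mem (Grading.hom_mem hD (K.inj_mem hc m)) m

/-- A derivation killing the idempotents commutes with their multiplications, so it preserves their
joint eigenspaces, in particular each off-diagonal component. -/
theorem der_inj [CharP k 3] {p : ZMod 2} {D : Module.End k H} (hD : D ∈ derPart J p)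
    (h0 : ∀ i, D (K.idem i) = 0) (m : Fin 3) (c : A) : D (K.inj m c) = K.inj m (K.triple D m c) := by
  induction c using S.grading.induction with
  | hadd a b ha hb => simp only [map_add, ha, hb]
  | hom j c hc =>
    have hX := Grading.hom_mem hD.1 (K.inj_mem hc m)
    have key : ∀ i, D (J.mul (K.idem i) (K.inj m c)) = J.mul (K.idem i) (D (K.inj m c)) := by
      intro i
      rw [hD.2 0 _ _ (K.idem_mem i), h0, map_zero, LinearMap.zero_apply, ksign_zero_right, one_smul,
        zero_add]
    have hd : ∀ i, K.diag (D (K.inj m c)) i = 0 := by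
      intro i
      have h := key i
      rw [K.idem_mul_inj hc] at h
      have h' := congrArg (K.diag · i) h
      simp only [diag_idem_mul, if_true, one_mul] at h'
      split_ifs at h'
      · simpa [diag_zero] using h'.symm
      -- Here ι_m(c) has eigenvalue -1 under e_i while the diagonal entry at i has eigenvalue 1, and
      -- 1 ≠ -1.
      · rw [map_neg, diag_neg] at h'
        have h3 : (3 : k) = 0 := CharP.cast_eq_zero k 3
        grind
    refine K.ext (fun n => ?_) fun n => ?_
    · rw [hd, diag_inj]
    · rw [off_inj, triple_apply]
      split_ifs with hn
      · rw [hn]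
      · have h := key m
        rw [K.idem_mul_inj hc, if_pos rfl, map_zero] at h
        have h' := congrArg (K.off · n) h
        rw [off_zero, K.off_idem_mul hX, if_neg hn] at h'
        exact neg_eq_zero.1 h'.symm

/-- Skewness for b comes from applying D to ι_m(x)∘ι_m(y), a multiple of idempotents killed by D;
triality comes from applying D to ι₁(x)∘ι₂(y) = ι₀(x•y). -/
theorem triple_mem_aux [CharP k 3] {p : ZMod 2} {D : Module.End k H} (hD : D ∈ derPart J p)
    (h0 : ∀ i, D (K.idem i) = 0) : K.triple D ∈ triPart S p := by
  refine mem_triPart.2 ⟨K.triple_hom hD.1, fun m j l x y hx hy => ?_, fun j l x y hx hy => ?_⟩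
  · have h := hD.2 j (K.inj m x) (K.inj m y) (K.inj_mem hx m)
    rw [K.inj_mul_inj m hx hy, K.der_inj hD h0, K.der_inj hD h0,
      K.inj_mul_inj m (Grading.hom_mem (K.triple_hom hD.1 m) hx) hy,
      K.inj_mul_inj m hx (Grading.hom_mem (K.triple_hom hD.1 m) hy)] at h
    simp only [map_neg, map_smul, map_add, h0, add_zero, smul_zero, neg_zero] at h
    have h' := congrArg (K.diag · (m + 1)) h
    obtain ⟨h1, h2, h3, -⟩ := fin_three_ne m
    simp only [diag_zero, diag_add, diag_neg, diag_smul, diag_idem, h3, if_true, if_false] at h'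
    linear_combination h'
  · have h := hD.2 j (K.inj 1 x) (K.inj 2 y) (K.inj_mem hx 1)
    rw [K.inj_one_mul_inj_two hx hy, K.der_inj hD h0, K.der_inj hD h0, K.der_inj hD h0,
      K.inj_one_mul_inj_two (Grading.hom_mem (K.triple_hom hD.1 1) hx) hy,
      K.inj_one_mul_inj_two hx (Grading.hom_mem (K.triple_hom hD.1 2) hy)] at h
    have h' := congrArg (K.off · 0) h
    simpa [off_add, off_smul, off_inj] using h'

theorem derOp_add_eq (d : Fin 3 → Module.End k A) (v : Fin 3 → A) :
    K.derOp (d, v) = K.derOp (d, 0) + K.derOp (0, v) := by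
  rw [← map_add, Prod.mk_add_mk, add_zero, zero_add]

/-- The derivations of `J` in coordinates. -/
theorem der_eq [CharP k 3] (hS : SymmComposition S) {p : ZMod 2} {D : Module.End k H} (hD : D ∈ derPart J p) :
    K.triple D ∈ triPart S p ∧ K.derOp (K.triple D, K.vec D) = D := by
  have hE := K.derOp_mem hS (zero_mem (triPart S p)) (K.vec_mem hD.1)
  have hF := sub_mem hD hE
  -- The subtracted derivation agrees with D on the idempotents and has zero triple, so F kills the
  -- idempotents and has the same triple as D.
  set F := D - K.derOp (0, K.vec D) with hFdef
  have h0 : ∀ i, F (K.idem i) = 0 := fun i => by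
    rw [hFdef, LinearMap.sub_apply, K.derOp_vec_idem hD, sub_self]
  have ht : K.triple F = K.triple D := by rw [hFdef, map_sub, triple_derOp, sub_zero]
  refine ⟨ht ▸ K.triple_mem_aux hF h0, ?_⟩
  have hF' : K.derOp (K.triple D, 0) = F := by
    ext X
    rw [K.sum_expand X, ← ht]
    simp only [map_add, map_sum, map_smul, h0, K.der_inj hF h0]
    congr 1
    · refine Finset.sum_congr rfl fun i _ => ?_
      congr 1
      refine K.ext (fun n => ?_) fun n => ?_
      · simp [diag_derOp, diag_zero]
      · simp [off_derOp, off_zero, off_idem]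
    · refine Finset.sum_congr rfl fun i _ => ?_
      refine K.ext (fun n => ?_) fun n => ?_
      · simp [diag_derOp, diag_inj]
      · rw [off_derOp]
        simp only [diag_inj, off_inj]
        by_cases h : n = i
        · subst h; simp
        · simp [h]
  rw [derOp_add_eq, hF', hFdef, sub_add_cancel]

end HermitianCoordinates

/-! ### Checking the Lie superalgebra axioms on generators -/

section

variable {k A B : Type*} [Field k] [AddCommGroup A] [Module k A] [AddCommGroup B] [Module k B]

theorem Grading.tmul_mem {P : Grading k A} {Q : Grading k B} {i j : ZMod 2} {x : A} {y : B}
    (hx : x ∈ P.part i) (hy : y ∈ Q.part j) : x ⊗ₜ[k] y ∈ (P.tensor Q).part (i + j) := by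
  rw [Grading.mem_part]
  have h0 := Grading.pr_of_mem hx
  have h1 := Grading.pr_of_mem hy
  rcases zmod_two_cases i with rfl | rfl <;> rcases zmod_two_cases j with rfl | rfl <;>
    simp [Grading.tensor, sum_zmod_two, h0, h1, zmod_two_one_add_one]

theorem Grading.mem_prod_part {P : Grading k A} {Q : Grading k B} {i : ZMod 2} {x : A × B} :
    x ∈ (P.prod Q).part i ↔ x.1 ∈ P.part i ∧ x.2 ∈ Q.part i := by
  rw [Grading.mem_part, Grading.mem_part, Grading.mem_part, Prod.ext_iff]
  rfl

theorem Grading.mem_pi_part {ι : Type*} {P : Grading k A} {i : ZMod 2} {x : ι → A} :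
    x ∈ (P.pi ι).part i ↔ ∀ m, x m ∈ P.part i := by
  rw [Grading.mem_part, funext_iff]
  exact forall_congr' fun m => Grading.mem_part.symm

/-- The projection to degree i fixes the generators of that degree and kills the others. Hence the
homogeneous elements of the span are combinations of generators of their own degree. -/
theorem BracketSpace.pr_mem_span {L : BracketSpace k A} {G : ZMod 2 → Set A}
    (hG : ∀ i, ∀ x ∈ G i, x ∈ L.grading.part i) {x : A}
    (hx : x ∈ Submodule.span k (G 0 ∪ G 1)) (i : ZMod 2) :
    L.grading.pr i x ∈ Submodule.span k (G i) := by
  induction hx using Submodule.span_induction with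
  | mem x hx =>
    have key : ∀ j, x ∈ G j → L.grading.pr i x ∈ Submodule.span k (G i) := by
      intro j hj
      rw [Grading.pr_of_mem (hG j x hj)]
      split_ifs with h
      · exact Submodule.subset_span (h ▸ hj)
      · exact zero_mem _
    exact hx.elim (key 0) (key 1)
  | zero => rw [map_zero]; exact zero_mem _
  | add x y _ _ hx hy => rw [map_add]; exact add_mem hx hy
  | smul c x _ hx => rw [map_smul]; exact Submodule.smul_mem _ _ hx

theorem BracketSpace.mem_span_of_mem {L : BracketSpace k A} {G : ZMod 2 → Set A}
    (hG : ∀ i, ∀ x ∈ G i, x ∈ L.grading.part i) {x : A} {i : ZMod 2}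
    (hx : x ∈ Submodule.span k (G 0 ∪ G 1)) (hi : x ∈ L.grading.part i) :
    x ∈ Submodule.span k (G i) :=
  Grading.mem_part.1 hi ▸ BracketSpace.pr_mem_span hG hx i

/-- The axioms of a Lie superalgebra may be checked on homogeneous generators of the space. -/
theorem BracketSpace.isLieSuperalgebra_of_span {L : BracketSpace k A} (G : ZMod 2 → Set A)
    (hG : ∀ i, ∀ x ∈ G i, x ∈ L.grading.part i)
    (hspan : L.carrier = Submodule.span k (G 0 ∪ G 1))
    (hmem : ∀ i j, ∀ x ∈ G i, ∀ y ∈ G j, L.bracket x y ∈ L.carrier)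
    (hdeg : ∀ i j, ∀ x ∈ G i, ∀ y ∈ G j, L.bracket x y ∈ L.grading.part (i + j))
    (hskew : ∀ i j, ∀ x ∈ G i, ∀ y ∈ G j, L.bracket x y = -(ksign k i j • L.bracket y x))
    (hjac : ∀ i j l, ∀ x ∈ G i, ∀ y ∈ G j, ∀ z ∈ G l, L.bracket x (L.bracket y z) =
      L.bracket (L.bracket x y) z + ksign k i j • L.bracket y (L.bracket x z))
    (hcube : ∀ x ∈ G 1, L.bracket x (L.bracket x x) = 0) : L.IsLieSuperalgebra := by
  have hsub : ∀ i, Submodule.span k (G i) ≤ L.carrier := by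
    intro i
    rw [hspan]
    refine Submodule.span_mono ?_
    rcases zmod_two_cases i with rfl | rfl
    · exact Set.subset_union_left
    · exact Set.subset_union_right
  have hof : ∀ {i x}, x ∈ L.carrier → x ∈ L.grading.part i → x ∈ Submodule.span k (G i) :=
    fun hx hi => BracketSpace.mem_span_of_mem hG (hspan ▸ hx) hi
  have hskew' : ∀ i j, ∀ x ∈ Submodule.span k (G i), ∀ y ∈ Submodule.span k (G j),
      L.bracket x y = -(ksign k i j • L.bracket y x) := by
    intro i j x hx y hy
    induction hx using Submodule.span_induction with
    | mem x hx =>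
      induction hy using Submodule.span_induction with
      | mem y hy => exact hskew i j x hx y hy
      | zero => simp
      | add y y' _ _ h h' => simp only [map_add, LinearMap.add_apply, h, h']; module
      | smul c y _ h => simp only [map_smul, LinearMap.smul_apply, h]; module
    | zero => simp
    | add y y' _ _ h h' => simp only [map_add, LinearMap.add_apply, h, h']; module
    | smul c y _ h => simp only [map_smul, LinearMap.smul_apply, h]; module
  have hdeg' : ∀ i j, ∀ x ∈ Submodule.span k (G i), ∀ y ∈ Submodule.span k (G j),
      L.bracket x y ∈ L.grading.part (i + j) := by
    intro i j x hx y hy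
    induction hx using Submodule.span_induction with
    | mem x hx =>
      induction hy using Submodule.span_induction with
      | mem y hy => exact hdeg i j x hx y hy
      | zero => rw [map_zero]; exact zero_mem _
      | add y y' _ _ h h' => rw [map_add]; exact add_mem h h'
      | smul c y _ h => rw [map_smul]; exact Submodule.smul_mem _ _ h
    | zero => rw [map_zero]; exact zero_mem _
    | add y y' _ _ h h' => rw [map_add]; exact add_mem h h'
    | smul c y _ h => rw [map_smul]; exact Submodule.smul_mem _ _ h
  have hmem' : ∀ x ∈ L.carrier, ∀ y ∈ L.carrier, L.bracket x y ∈ L.carrier := by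
    intro x hx y hy
    rw [hspan] at hx hy
    induction hx using Submodule.span_induction with
    | mem x hx =>
      induction hy using Submodule.span_induction with
      | mem y hy =>
        exact hx.elim (fun hx => hy.elim (hmem _ _ x hx y) (hmem _ _ x hx y))
          (fun hx => hy.elim (hmem _ _ x hx y) (hmem _ _ x hx y))
      | zero => rw [map_zero]; exact zero_mem _
      | add y y' _ _ h h' => rw [map_add]; exact add_mem h h'
      | smul c y _ h => rw [map_smul]; exact Submodule.smul_mem _ _ h
    | zero => rw [map_zero]; exact zero_mem _
    | add y y' _ _ h h' => rw [map_add]; exact add_mem h h'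
    | smul c y _ h => rw [map_smul]; exact Submodule.smul_mem _ _ h
  have hjac' : ∀ i j, ∀ x ∈ Submodule.span k (G i), ∀ y ∈ Submodule.span k (G j),
      ∀ z ∈ L.carrier, L.bracket x (L.bracket y z) =
      L.bracket (L.bracket x y) z + ksign k i j • L.bracket y (L.bracket x z) := by
    intro i j x hx y hy z hz
    rw [hspan] at hz
    induction hx using Submodule.span_induction with
    | mem x hx =>
      induction hy using Submodule.span_induction with
      | mem y hy =>
        induction hz using Submodule.span_induction with
        | mem z hz => exact hz.elim (hjac i j 0 x hx y hy z) (hjac i j 1 x hx y hy z)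
        | zero => simp
        | add z z' _ _ h h' => simp only [map_add, h, h']; module
        | smul c z _ h => simp only [map_smul, h]; module
      | zero => simp
      | add y y' _ _ h h' => simp only [map_add, LinearMap.add_apply, h, h']; module
      | smul c y _ h => simp only [map_smul, LinearMap.smul_apply, h]; module
    | zero => simp
    | add y y' _ _ h h' => simp only [map_add, LinearMap.add_apply, h, h']; module
    | smul c y _ h => simp only [map_smul, LinearMap.smul_apply, h]; module
  refine ⟨fun i x hx => hsub i (BracketSpace.pr_mem_span hG (hspan ▸ hx) i), hmem',
    fun i j x hx y hy hi hj => hdeg' i j x (hof hx hi) y (hof hy hj),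
    fun i j x hx y hy hi hj => hskew' i j x (hof hx hi) y (hof hy hj),
    fun i j x hx y hy z hz hi hj => hjac' i j x (hof hx hi) y (hof hy hj) z hz, ?_⟩
  intro x hx hi
  have hx' := hof hx hi
  clear hx hi
  induction hx' using Submodule.span_induction with
  | mem x hx => exact hcube x hx
  | zero => simp
  | smul c x _ h => simp only [map_smul, LinearMap.smul_apply, h, smul_zero]
  | add x y hx hy h h' =>
    -- The polarisation of the cube condition, which is needed because that condition is not linear.
    -- It follows from Jacobi: [x,[x,y]] = [[x,x],y] - [x,[x,y]], while [y,x] = [x,y] and [[x,x],y]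
    -- = -[y,[x,x]].
    have key : ∀ x ∈ Submodule.span k (G 1), ∀ y ∈ Submodule.span k (G 1),
        L.bracket x (L.bracket x y) + L.bracket x (L.bracket y x) + L.bracket y (L.bracket x x)
          = 0 := by
      intro x hx y hy
      have h1 := hjac' 1 1 x hx y hy x (hsub 1 hx)
      have h2 := hjac' 1 1 x hx x hx y (hsub 1 hy)
      have h3 := hskew' 1 1 x hx y hy
      have h4 := hskew' (1 + 1) 1 _ (hof (hmem' _ (hsub 1 hx) _ (hsub 1 hx)) (hdeg' 1 1 x hx x hx))
        y hy
      rw [ksign_one_one] at h1 h2 h3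
      rw [zmod_two_one_add_one, ksign_zero_left, one_smul] at h4
      rw [neg_one_smul, neg_neg] at h3
      rw [h4, neg_one_smul] at h2
      rw [← h3]
      linear_combination (norm := module) h2
    have k1 := key x hx y hy
    have k2 := key y hy x hx
    simp only [map_add, LinearMap.add_apply, h, h', zero_add, add_zero]
    linear_combination (norm := module) k1 + k2

end

/-! ### Supercommutators of superderivations -/

section

variable {k H : Type*} [Field k] [AddCommGroup H] [Module k H]

theorem superComm_mem (P : Grading k H) {i j : ZMod 2} {f g : Module.End k H}
    (hf : f ∈ P.hom.part i) (hg : g ∈ P.hom.part j) : superComm P f g ∈ P.hom.part (i + j) := by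
  rw [superComm_apply P hf hg]
  refine Grading.mem_hom_part.2 fun l x hx => sub_mem ?_ (Submodule.smul_mem _ _ ?_)
  · rw [add_assoc]
    exact Grading.hom_mem hf (x := g x) (Grading.hom_mem hg hx)
  · rw [add_comm i j, add_assoc]
    exact Grading.hom_mem hg (x := f x) (Grading.hom_mem hf hx)

theorem superComm_skew (P : Grading k H) {i j : ZMod 2} {f g : Module.End k H}
    (hf : f ∈ P.hom.part i) (hg : g ∈ P.hom.part j) :
    superComm P f g = -(ksign k i j • superComm P g f) := by
  rw [superComm_apply P hf hg, superComm_apply P hg hf, ksign_comm k j i]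
  have h := ksign_mul_self k i j
  match_scalars <;> grind

theorem superComm_jacobi (P : Grading k H) {i j l : ZMod 2} {f g h : Module.End k H}
    (hf : f ∈ P.hom.part i) (hg : g ∈ P.hom.part j) (hh : h ∈ P.hom.part l) :
    superComm P f (superComm P g h) =
      superComm P (superComm P f g) h + ksign k i j • superComm P g (superComm P f h) := by
  rw [superComm_apply P hf (superComm_mem P hg hh), superComm_apply P (superComm_mem P hf hg) hh,
    superComm_apply P hg (superComm_mem P hf hh), superComm_apply P hf hg, superComm_apply P hg hh,
    superComm_apply P hf hh]
  have h1 := ksign_mul_self k i j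
  simp only [ksign_add_left, ksign_add_right, ksign_comm k j i, mul_sub, sub_mul, smul_mul_assoc,
    mul_smul_comm, mul_assoc, smul_sub, smul_smul]
  match_scalars <;> grind

theorem superComm_der {J : Superalgebra k H} {i j : ZMod 2} {D E : Module.End k H}
    (hD : D ∈ derPart J i) (hE : E ∈ derPart J j) :
    superComm J.grading D E ∈ derPart J (i + j) := by
  refine ⟨superComm_mem _ hD.1 hE.1, fun l x y hx => ?_⟩
  have hDx := Grading.hom_mem hD.1 hx
  have hEx := Grading.hom_mem hE.1 hx
  rw [superComm_apply _ hD.1 hE.1]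
  simp only [LinearMap.sub_apply, LinearMap.smul_apply, Module.End.mul_apply, hD.2 _ _ _ hx,
    hE.2 _ _ _ hx, map_add, map_smul, map_sub, hD.2 _ _ _ hEx, hE.2 _ _ _ hDx, ksign_add_left,
    ksign_add_right, ksign_comm k j i]
  have h1 := ksign_mul_self k i j
  match_scalars <;> grind

theorem superComm_mul {J : Superalgebra k H} {i j : ZMod 2} {D : Module.End k H} {x : H}
    (hD : D ∈ derPart J i) (hx : x ∈ J.grading.part j) :
    superComm J.grading D (J.mul x) = J.mul (D x) := by
  rw [superComm_apply _ hD.1 (mul_mem_hom J hx)]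
  ext y
  simp [hD.2 _ _ _ hx]

/-- The Jacobi identity in End J, combined with [D, L_x] = L_{D(x)}. -/
theorem superComm_innerDer {J : Superalgebra k H} {p i j : ZMod 2} {D : Module.End k H} {x y : H}
    (hD : D ∈ derPart J p) (hx : x ∈ J.grading.part i) (hy : y ∈ J.grading.part j) :
    superComm J.grading D (innerDer J x y) =
      innerDer J (D x) y + ksign k p i • innerDer J x (D y) := by
  have h : ∀ x y, innerDer J x y = superComm J.grading (J.mul x) (J.mul y) := fun _ _ => rfl
  rw [h, h, h, superComm_jacobi _ hD.1 (mul_mem_hom J hx) (mul_mem_hom J hy), superComm_mul hD hx,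
    superComm_mul hD hy]

theorem innerDer_skew (J : Superalgebra k H) {i j : ZMod 2} {x y : H}
    (hx : x ∈ J.grading.part i) (hy : y ∈ J.grading.part j) :
    innerDer J x y = -(ksign k i j • innerDer J y x) :=
  superComm_skew _ (mul_mem_hom J hx) (mul_mem_hom J hy)

end

/-! ### The Tits–Kantor–Koecher superalgebra: sl₂ and the Jacobi identity -/

section

variable {k : Type*} [Field k]

theorem mat2_mem_zero (q : Matrix (Fin 2) (Fin 2) k) : q ∈ (mat2 k).grading.part 0 := by
  rw [Grading.mem_part]
  simp [mat2, Grading.trivial]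

theorem mat2_mul (q r : Matrix (Fin 2) (Fin 2) k) : (mat2 k).mul q r = q * r := rfl

theorem mem_traceZero {q : Matrix (Fin 2) (Fin 2) k} : q ∈ (mat2 k).traceZero ↔ q.trace = 0 := by
  have h : (mat2 k).polar q 1 = q.trace := by
    simp [mat2, Matrix.trace, Fin.sum_univ_two]
    ring
  rw [← h]
  rfl

theorem mat2_polar_eq (q r : Matrix (Fin 2) (Fin 2) k) :
    (mat2 k).polar q r = q.trace * r.trace - (q * r).trace := rfl

theorem mat2_polar_comm (q r : Matrix (Fin 2) (Fin 2) k) :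
    (mat2 k).polar q r = (mat2 k).polar r q := by
  rw [mat2_polar_eq, mat2_polar_eq, mul_comm, Matrix.trace_mul_comm]

theorem comm_mem_traceZero (q r : Matrix (Fin 2) (Fin 2) k) :
    q * r - r * q ∈ (mat2 k).traceZero := by
  rw [mem_traceZero, Matrix.trace_sub, Matrix.trace_mul_comm, sub_self]

/-- Invariance of the form under commutators, which makes b(q, [r,t]) an alternating trilinear form
on sl₂. -/
theorem mat2_polar_comm_assoc (q r t : Matrix (Fin 2) (Fin 2) k) :
    (mat2 k).polar (q * r - r * q) t = (mat2 k).polar q (r * t - t * r) := by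
  simp only [mat2_polar_eq, Matrix.trace_fin_two, Matrix.sub_apply, Matrix.mul_apply,
    Fin.sum_univ_two]
  ring

/-- The double vector-product identity of sl₂. It explains the coefficient -2b(a,c) of the inner
derivation: these terms compensate exactly those coming from iterated commutators. -/
theorem double_comm {q r t : Matrix (Fin 2) (Fin 2) k} (hq : q ∈ (mat2 k).traceZero)
    (hr : r ∈ (mat2 k).traceZero) (ht : t ∈ (mat2 k).traceZero) :
    (q * r - r * q) * t - t * (q * r - r * q) =
      (2 * (mat2 k).polar q t) • r - (2 * (mat2 k).polar r t) • q := by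
  rw [mem_traceZero, Matrix.trace_fin_two] at hq hr ht
  have hq' : q 1 1 = -q 0 0 := by linear_combination hq
  have hr' : r 1 1 = -r 0 0 := by linear_combination hr
  have ht' : t 1 1 = -t 0 0 := by linear_combination ht
  rw [mat2_polar_eq, mat2_polar_eq]
  ext i j
  fin_cases i <;> fin_cases j <;>
    simp [Matrix.trace_fin_two, Matrix.mul_apply, Fin.sum_univ_two, hq', hr', ht'] <;> ring

end

section

variable {k H : Type*} [Field k] [AddCommGroup H] [Module k H] {J : Superalgebra k H}

theorem TKK_bracket_tmul_tmul (q r : Matrix (Fin 2) (Fin 2) k) (x y : H) :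
    (TKK J).bracket (q ⊗ₜ x, 0) (r ⊗ₜ y, 0) =
      ((q * r - r * q) ⊗ₜ J.mul x y, -((2 * (mat2 k).polar q r) • innerDer J x y)) := by
  refine Prod.ext ?_ ?_
  · simp [TKK, tits, titsBracket, mat2_mul]
  · simp [TKK, tits, titsBracket, mul_smul]

theorem TKK_bracket_der_tmul (D : Module.End k H) (q : Matrix (Fin 2) (Fin 2) k) (x : H) :
    (TKK J).bracket (0, D) (q ⊗ₜ x, 0) = (q ⊗ₜ D x, 0) := by
  refine Prod.ext ?_ ?_ <;> simp [TKK, tits, titsBracket]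

theorem TKK_bracket_tmul_der {i j : ZMod 2} {D : Module.End k H} {x : H}
    (hx : x ∈ J.grading.part i) (hD : D ∈ J.grading.hom.part j) (q : Matrix (Fin 2) (Fin 2) k) :
    (TKK J).bracket (q ⊗ₜ x, 0) (0, D) = (-(ksign k i j • q ⊗ₜ D x), 0) := by
  have h := Grading.tmul_mem (mat2_mem_zero q) hx
  rw [zero_add] at h
  have h' := superFlip_apply J.grading.hom ((mat2 k).grading.tensor J.grading)
    (LinearMap.lTensorHom (Matrix (Fin 2) (Fin 2) k)) hD h
  rw [ksign_comm] at h'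
  refine Prod.ext ?_ ?_
  · simp [TKK, tits, titsBracket, h']
  · simp [TKK, tits, titsBracket]

theorem TKK_bracket_der_der (D E : Module.End k H) :
    (TKK J).bracket (0, D) (0, E) = (0, superComm J.grading D E) := by
  refine Prod.ext ?_ ?_ <;> simp [TKK, tits, titsBracket]

/-- Homogeneous generators of the Tits-Kantor-Koecher Lie superalgebra. -/
def tkkGen (J : Superalgebra k H) (i : ZMod 2) :
    Set ((Matrix (Fin 2) (Fin 2) k ⊗[k] H) × Module.End k H) :=
  {X | ∃ q ∈ (mat2 k).traceZero, ∃ x ∈ J.grading.part i, X = (q ⊗ₜ x, 0)} ∪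
    {X | ∃ D ∈ derPart J i, X = (0, D)}

theorem tkkGen_mem {i : ZMod 2} {X : (Matrix (Fin 2) (Fin 2) k ⊗[k] H) × Module.End k H}
    (hX : X ∈ tkkGen J i) : X ∈ (TKK J).grading.part i := by
  refine Grading.mem_prod_part.2 ?_
  rcases hX with ⟨q, -, x, hx, rfl⟩ | ⟨D, hD, rfl⟩
  · have h := Grading.tmul_mem (mat2_mem_zero q) hx
    rw [zero_add] at h
    exact ⟨h, zero_mem _⟩
  · exact ⟨zero_mem _, hD.1⟩

theorem tkkGen_tmul_mem {q : Matrix (Fin 2) (Fin 2) k} (hq : q ∈ (mat2 k).traceZero) (x : H)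
    {i : ZMod 2} {D : Module.End k H} (hD : D ∈ derPart J i) :
    (q ⊗ₜ x, D) ∈ (TKK J).carrier := by
  refine ⟨⟨⟨q, hq⟩ ⊗ₜ x, by simp⟩, ?_⟩
  rcases zmod_two_cases i with rfl | rfl
  · exact (le_sup_left : _ ≤ der J) hD
  · exact (le_sup_right : _ ≤ der J) hD

theorem tkkGen_carrier {i : ZMod 2} {X : (Matrix (Fin 2) (Fin 2) k ⊗[k] H) × Module.End k H}
    (hX : X ∈ tkkGen J i) : X ∈ (TKK J).carrier := by
  rcases hX with ⟨q, hq, x, -, rfl⟩ | ⟨D, hD, rfl⟩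
  · exact tkkGen_tmul_mem hq x (zero_mem (derPart J 0))
  · simpa using tkkGen_tmul_mem (zero_mem _) (0 : H) hD

theorem tkk_carrier_eq_span :
    (TKK J).carrier = Submodule.span k (tkkGen J 0 ∪ tkkGen J 1) := by
  refine le_antisymm ?_ (Submodule.span_le.2 (Set.union_subset (fun _ h => tkkGen_carrier h)
    fun _ h => tkkGen_carrier h))
  have hsub : ∀ i, tkkGen J i ⊆ tkkGen J 0 ∪ tkkGen J 1 := by
    intro i
    rcases zmod_two_cases i with rfl | rfl
    · exact Set.subset_union_left
    · exact Set.subset_union_right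
  rintro ⟨t, D⟩ ⟨⟨u, hu⟩, hD⟩
  have h1 : (t, (0 : Module.End k H)) ∈ Submodule.span k (tkkGen J 0 ∪ tkkGen J 1) := by
    change _ = t at hu
    rw [← hu]
    clear hu
    induction u with
    | zero => rw [map_zero]; exact zero_mem _
    | add u v hu hv =>
      rw [map_add, ← add_zero (0 : Module.End k H), ← Prod.mk_add_mk]
      exact add_mem hu hv
    | tmul q x =>
      rw [LinearMap.rTensor_tmul]
      induction x using J.grading.induction with
      | hadd x y hx hy =>
        rw [TensorProduct.tmul_add, ← add_zero (0 : Module.End k H), ← Prod.mk_add_mk]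
        exact add_mem hx hy
      | hom i x hx =>
        exact Submodule.subset_span (hsub i (Or.inl ⟨_, q.2, x, hx, rfl⟩))
  have h2 : ((0 : Matrix (Fin 2) (Fin 2) k ⊗[k] H), D) ∈
      Submodule.span k (tkkGen J 0 ∪ tkkGen J 1) := by
    obtain ⟨D0, h0, D1, h1, rfl⟩ := Submodule.mem_sup.1 hD
    rw [← add_zero (0 : Matrix (Fin 2) (Fin 2) k ⊗[k] H), ← Prod.mk_add_mk]
    exact add_mem (Submodule.subset_span (hsub 0 (Or.inr ⟨D0, h0, rfl⟩)))
      (Submodule.subset_span (hsub 1 (Or.inr ⟨D1, h1, rfl⟩)))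
  have := add_mem h1 h2
  rwa [Prod.mk_add_mk, add_zero, zero_add] at this

end

/-- The properties of a Jordan superalgebra on which the Tits-Kantor-Koecher construction is
based. -/
structure Superalgebra.InnerCyclic {k H : Type*} [Field k] [AddCommGroup H] [Module k H]
    (J : Superalgebra k H) : Prop where
  comm : ∀ i j x y, x ∈ J.grading.part i → y ∈ J.grading.part j →
    J.mul x y = ksign k i j • J.mul y x
  inner_mem : ∀ i j x y, x ∈ J.grading.part i → y ∈ J.grading.part j →
    innerDer J x y ∈ derPart J (i + j)
  cyclic : ∀ i j l x y z, x ∈ J.grading.part i → y ∈ J.grading.part j → z ∈ J.grading.part l →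
    ksign k i l • innerDer J (J.mul x y) z + ksign k i j • innerDer J (J.mul y z) x +
      ksign k j l • innerDer J (J.mul z x) y = 0

section

variable {k H : Type*} [Field k] [AddCommGroup H] [Module k H] {J : Superalgebra k H}

/-- The bracket formulas apply to elements lying in one of the two summands, so a mixed element is
split before a second bracket is taken. -/
theorem TKK_split (t : Matrix (Fin 2) (Fin 2) k ⊗[k] H) (D : Module.End k H) :
    (t, D) = (t, 0) + (0, D) := by simp

theorem TKK_split_smul (c : k) (q : Matrix (Fin 2) (Fin 2) k) (x : H) :
    (-(c • q ⊗ₜ[k] x), (0 : Module.End k H)) = (-c) • (q ⊗ₜ x, 0) := by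
  refine Prod.ext ?_ (smul_zero _).symm
  change _ = (-c) • q ⊗ₜ[k] x
  module

theorem TKK_split_der (c : k) (D : Module.End k H) :
    ((0 : Matrix (Fin 2) (Fin 2) k ⊗[k] H), -(c • D)) = (-c) • (0, D) := by simp

/-- In the summand sl₂ ⊗ J the double commutators are combinations of q, r, t, and the coefficient
of each vanishes by supercommutativity and d_{x,y} = [L_x, L_y]. In der J all the coefficients are
multiples of b(q,[r,t]), and the cyclic identity finishes the proof. -/
theorem TKK_jacobi_tmul (hJ : J.InnerCyclic) {i j l : ZMod 2} {q r t : Matrix (Fin 2) (Fin 2) k}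
    {x y z : H} (hq : q ∈ (mat2 k).traceZero) (hr : r ∈ (mat2 k).traceZero)
    (ht : t ∈ (mat2 k).traceZero) (hx : x ∈ J.grading.part i) (hy : y ∈ J.grading.part j)
    (hz : z ∈ J.grading.part l) {X Y Z : (Matrix (Fin 2) (Fin 2) k ⊗[k] H) × Module.End k H}
    (hX : X = (q ⊗ₜ x, 0)) (hY : Y = (r ⊗ₜ y, 0)) (hZ : Z = (t ⊗ₜ z, 0)) :
    (TKK J).bracket X ((TKK J).bracket Y Z) = (TKK J).bracket ((TKK J).bracket X Y) Z +
      ksign k i j • (TKK J).bracket Y ((TKK J).bracket X Z) := by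
  subst hX hY hZ
  simp only [TKK_bracket_tmul_tmul]
  rw [TKK_split ((r * t - t * r) ⊗ₜ J.mul y z), TKK_split ((q * r - r * q) ⊗ₜ J.mul x y),
    TKK_split ((q * t - t * q) ⊗ₜ J.mul x z), TKK_split_der, TKK_split_der, TKK_split_der]
  simp only [map_add, map_smul, LinearMap.add_apply, LinearMap.smul_apply, TKK_bracket_tmul_tmul,
    TKK_bracket_der_tmul, TKK_bracket_tmul_der hx (hJ.inner_mem _ _ _ _ hy hz).1,
    TKK_bracket_tmul_der hy (hJ.inner_mem _ _ _ _ hx hz).1, mat2_polar_comm_assoc]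
  have e1 : q * (r * t - t * r) - (r * t - t * r) * q =
      (2 * (mat2 k).polar q t) • r - (2 * (mat2 k).polar q r) • t := by
    have := double_comm hr ht hq
    rw [mat2_polar_comm r q, mat2_polar_comm t q] at this
    rw [← neg_sub, this, neg_sub]
  have e2 : r * (q * t - t * q) - (q * t - t * q) * r =
      (2 * (mat2 k).polar r t) • q - (2 * (mat2 k).polar q r) • t := by
    have := double_comm hq ht hr
    rw [mat2_polar_comm t r] at this
    rw [← neg_sub, this, neg_sub]
  have e3 : (mat2 k).polar r (q * t - t * q) = -(mat2 k).polar q (r * t - t * r) := by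
    rw [← mat2_polar_comm_assoc, ← mat2_polar_comm_assoc, ← neg_sub, map_neg, LinearMap.neg_apply]
  rw [double_comm hq hr ht, e1, e2, e3]
  have hs := ksign_mul_self k i j
  have hs' := ksign_mul_self k i l
  have hs'' := ksign_mul_self k j l
  refine Prod.ext ?_ ?_
  · simp only [Prod.fst_add, Prod.smul_fst]
    rw [innerDer_apply J hx hy, innerDer_apply J hx hz, innerDer_apply J hy hz,
      hJ.comm _ _ (J.mul x y) z (J.mul_mem _ _ _ _ hx hy) hz, hJ.comm _ _ y x hy hx,
      hJ.comm _ _ z x hz hx, hJ.comm _ _ z y hz hy]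
    simp only [TensorProduct.sub_tmul, TensorProduct.tmul_sub, TensorProduct.tmul_smul,
      ← TensorProduct.smul_tmul', ksign_add_left, ksign_add_right, map_smul, ksign_comm k j i,
      ksign_comm k l i, ksign_comm k l j]
    match_scalars <;> grind
  · simp only [Prod.snd_add, Prod.smul_snd]
    have hc := hJ.cyclic i j l x y z hx hy hz
    rw [innerDer_skew J (J.mul_mem _ _ _ _ hy hz) hx, innerDer_skew J (J.mul_mem _ _ _ _ hz hx) hy,
      hJ.comm _ _ z x hz hx] at hc
    simp only [ksign_add_left, map_smul, ksign_comm k j i,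
      ksign_comm k l i, ksign_comm k l j] at hc ⊢
    linear_combination (norm := skip)
      (2 * (mat2 k).polar q (r * t - t * r) * ksign k i l) • hc
    clear hc
    match_scalars <;> grind

-- Apart from the case of three tensors, everything expresses that a superderivation acts as a
-- derivation on products and on inner derivations, and that End J is a Lie superalgebra.
set_option maxHeartbeats 1000000 in
theorem TKK_jacobi_gen (hJ : J.InnerCyclic) {i j l : ZMod 2}
    {X Y Z : (Matrix (Fin 2) (Fin 2) k ⊗[k] H) × Module.End k H} (hX : X ∈ tkkGen J i)
    (hY : Y ∈ tkkGen J j) (hZ : Z ∈ tkkGen J l) :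
    (TKK J).bracket X ((TKK J).bracket Y Z) = (TKK J).bracket ((TKK J).bracket X Y) Z +
      ksign k i j • (TKK J).bracket Y ((TKK J).bracket X Z) := by
  have hs := ksign_mul_self k i j
  have hs' := ksign_mul_self k i l
  have hs'' := ksign_mul_self k j l
  rcases hX with ⟨q, hq, x, hx, hX⟩ | ⟨D, hD, hX⟩ <;>
  rcases hY with ⟨r, hr, y, hy, hY⟩ | ⟨E, hE, hY⟩ <;>
  rcases hZ with ⟨t, ht, z, hz, hZ⟩ | ⟨F, hF, hZ⟩
  · exact TKK_jacobi_tmul hJ hq hr ht hx hy hz hX hY hZ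
  all_goals subst hX hY hZ
  · have hFd := superComm_innerDer hF hx hy
    rw [superComm_skew _ hF.1 (hJ.inner_mem _ _ _ _ hx hy).1, neg_eq_iff_eq_neg] at hFd
    rw [TKK_bracket_tmul_der hy hF.1, TKK_bracket_tmul_der hx hF.1, TKK_bracket_tmul_tmul,
      TKK_split ((q * r - r * q) ⊗ₜ J.mul x y), TKK_split_der, TKK_split_smul, TKK_split_smul]
    simp only [map_add, map_smul, LinearMap.add_apply, LinearMap.smul_apply, TKK_bracket_tmul_tmul,
      TKK_bracket_tmul_der (J.mul_mem _ _ _ _ hx hy) hF.1, TKK_bracket_der_der,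
      hF.2 _ _ _ hx]
    rw [innerDer_skew J hy (Grading.hom_mem hF.1 hx), mat2_polar_comm r q,
      hJ.comm _ _ y _ hy (Grading.hom_mem hF.1 hx)]
    refine Prod.ext ?_ ?_
    · simp only [Prod.fst_add, Prod.smul_fst, ksign_add_left, ksign_add_right, ksign_comm k j i,
        ksign_comm k l i, TensorProduct.sub_tmul, TensorProduct.tmul_add,
        TensorProduct.tmul_smul]
      match_scalars <;> grind
    · simp only [Prod.snd_add, Prod.smul_snd]
      simp only [ksign_add_right, ksign_comm k j i,
        ksign_comm k l i, ksign_comm k l j] at hFd ⊢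
      linear_combination (norm := skip)
        (2 * (mat2 k).polar q r * ksign k i l * ksign k j l) • hFd
      clear hFd
      match_scalars <;> grind
  · rw [TKK_bracket_tmul_der hx hE.1, TKK_bracket_tmul_tmul, TKK_bracket_der_tmul,
      TKK_split ((q * t - t * q) ⊗ₜ J.mul x z), TKK_split_der, TKK_split_smul]
    simp only [map_add, map_smul, LinearMap.smul_apply, TKK_bracket_tmul_tmul,
      TKK_bracket_der_tmul, TKK_bracket_der_der, superComm_innerDer hE hx hz, hE.2 _ _ _ hx]
    refine Prod.ext ?_ ?_
    · simp only [Prod.fst_add, Prod.smul_fst, TensorProduct.tmul_add, TensorProduct.tmul_smul,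
        ksign_comm k j i]
      match_scalars <;> grind
    · simp only [Prod.snd_add, Prod.smul_snd, ksign_comm k j i]
      match_scalars <;> grind
  · rw [TKK_bracket_tmul_der hx hE.1, TKK_bracket_tmul_der hx hF.1, TKK_bracket_der_der,
      TKK_bracket_tmul_der hx (superComm_mem _ hE.1 hF.1), superComm_apply _ hE.1 hF.1,
      TKK_split_smul _ q (E x), TKK_split_smul _ q (F x), map_smul, map_smul, LinearMap.smul_apply,
      TKK_bracket_tmul_der (Grading.hom_mem hE.1 hx) hF.1, TKK_bracket_der_tmul]
    refine Prod.ext ?_ ?_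
    · simp only [Prod.fst_add, Prod.smul_fst, LinearMap.sub_apply, LinearMap.smul_apply,
        Module.End.mul_apply, TensorProduct.tmul_sub, TensorProduct.tmul_smul, ksign_add_left,
        ksign_add_right]
      match_scalars <;> grind
    · simp
  · simp only [TKK_bracket_der_tmul, TKK_bracket_tmul_tmul]
    rw [TKK_split ((r * t - t * r) ⊗ₜ J.mul y z), TKK_split_der]
    simp only [map_add, map_smul,
      TKK_bracket_der_tmul, TKK_bracket_der_der, superComm_innerDer hD hy hz, hD.2 _ _ _ hy]
    refine Prod.ext ?_ ?_
    · simp only [Prod.fst_add, Prod.smul_fst, TensorProduct.tmul_add, TensorProduct.tmul_smul]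
      match_scalars <;> grind
    · simp only [Prod.snd_add, Prod.smul_snd]
      match_scalars <;> grind
  · rw [TKK_bracket_tmul_der hy hF.1, TKK_bracket_der_tmul, TKK_bracket_der_der, TKK_split_smul,
      map_smul, TKK_bracket_der_tmul, TKK_bracket_tmul_der (Grading.hom_mem hD.1 hy) hF.1,
      TKK_bracket_tmul_der hy (superComm_mem _ hD.1 hF.1), superComm_apply _ hD.1 hF.1]
    refine Prod.ext ?_ ?_
    · simp only [Prod.fst_add, Prod.smul_fst, LinearMap.sub_apply, LinearMap.smul_apply,
        Module.End.mul_apply, TensorProduct.tmul_sub, TensorProduct.tmul_smul, ksign_add_left,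
        ksign_add_right, ksign_comm k j i]
      match_scalars <;> grind
    · simp
  · simp only [TKK_bracket_der_tmul, TKK_bracket_der_der, superComm_apply _ hD.1 hE.1]
    refine Prod.ext ?_ ?_
    · simp only [Prod.fst_add, Prod.smul_fst, LinearMap.sub_apply, LinearMap.smul_apply,
        Module.End.mul_apply, TensorProduct.tmul_sub, TensorProduct.tmul_smul]
      match_scalars <;> grind
    · simp
  · simp only [TKK_bracket_der_der]
    rw [superComm_jacobi _ hD.1 hE.1 hF.1]
    simp

theorem TKK_isLieSuperalgebra (hJ : J.InnerCyclic) (h2 : (2 : k) ≠ 0) :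
    (TKK J).IsLieSuperalgebra := by
  refine BracketSpace.isLieSuperalgebra_of_span (tkkGen J) (fun i x hx => tkkGen_mem hx)
    tkk_carrier_eq_span ?_ ?_ ?_ (fun i j l x hx y hy z hz => TKK_jacobi_gen hJ hx hy hz) ?_
  · rintro i j _ (⟨q, hq, x, hx, rfl⟩ | ⟨D, hD, rfl⟩) _ (⟨r, hr, y, hy, rfl⟩ | ⟨E, hE, rfl⟩)
    · rw [TKK_bracket_tmul_tmul]
      exact tkkGen_tmul_mem (comm_mem_traceZero q r) _
        (neg_mem (Submodule.smul_mem _ _ (hJ.inner_mem _ _ _ _ hx hy)))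
    · rw [TKK_bracket_tmul_der hx hE.1, TKK_split_smul]
      exact Submodule.smul_mem _ _ (tkkGen_tmul_mem hq _ (zero_mem (derPart J 0)))
    · rw [TKK_bracket_der_tmul]
      exact tkkGen_tmul_mem hr _ (zero_mem (derPart J 0))
    · rw [TKK_bracket_der_der]
      exact tkkGen_carrier (Or.inr ⟨_, superComm_der hD hE, rfl⟩)
  · have hm : ∀ {i} (q : Matrix (Fin 2) (Fin 2) k) {x : H}, x ∈ J.grading.part i →
        q ⊗ₜ x ∈ ((mat2 k).grading.tensor J.grading).part i := by
      intro i q x hx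
      have := Grading.tmul_mem (mat2_mem_zero q) hx
      rwa [zero_add] at this
    rintro i j _ (⟨q, hq, x, hx, rfl⟩ | ⟨D, hD, rfl⟩) _ (⟨r, hr, y, hy, rfl⟩ | ⟨E, hE, rfl⟩) <;>
      refine Grading.mem_prod_part.2 ?_
    · rw [TKK_bracket_tmul_tmul]
      exact ⟨hm _ (J.mul_mem _ _ _ _ hx hy),
        neg_mem (Submodule.smul_mem _ _ (hJ.inner_mem _ _ _ _ hx hy).1)⟩
    · rw [TKK_bracket_tmul_der hx hE.1]
      refine ⟨neg_mem (Submodule.smul_mem _ _ (hm _ ?_)), zero_mem _⟩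
      rw [add_comm]
      exact Grading.hom_mem hE.1 hx
    · rw [TKK_bracket_der_tmul]
      exact ⟨hm _ (Grading.hom_mem hD.1 hy), zero_mem _⟩
    · rw [TKK_bracket_der_der]
      exact ⟨zero_mem _, superComm_mem _ hD.1 hE.1⟩
  · rintro i j _ (⟨q, hq, x, hx, rfl⟩ | ⟨D, hD, rfl⟩) _ (⟨r, hr, y, hy, rfl⟩ | ⟨E, hE, rfl⟩)
    · have hs := ksign_mul_self k i j
      rw [TKK_bracket_tmul_tmul, TKK_bracket_tmul_tmul, hJ.comm _ _ x y hx hy,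
        innerDer_skew J hx hy, mat2_polar_comm r q]
      refine Prod.ext ?_ ?_
      · simp only [Prod.fst_neg, Prod.smul_fst, TensorProduct.tmul_smul, TensorProduct.sub_tmul]
        module
      · simp only [Prod.snd_neg, Prod.smul_snd]
        module
    · rw [TKK_bracket_tmul_der hx hE.1, TKK_bracket_der_tmul]
      simp
    · rw [TKK_bracket_tmul_der hy hD.1, TKK_bracket_der_tmul, ksign_comm k j i]
      simp [smul_smul, ksign_mul_self]
    · rw [TKK_bracket_der_der, TKK_bracket_der_der, superComm_skew _ hD.1 hE.1]
      simp
  · rintro _ (⟨q, hq, x, hx, rfl⟩ | ⟨D, hD, rfl⟩)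
    -- Supercommutativity gives x∘x = -x∘x for odd x. So d_{x,x} kills x.
    · have hxx : J.mul x x = 0 := by
        have h := hJ.comm 1 1 x x hx hx
        rw [ksign_one_one, neg_one_smul, eq_neg_iff_add_eq_zero, ← two_smul k] at h
        exact (smul_eq_zero.1 h).resolve_left h2
      rw [TKK_bracket_tmul_tmul, sub_self, TensorProduct.zero_tmul, TKK_split_der, map_smul,
        TKK_bracket_tmul_der hx (hJ.inner_mem _ _ _ _ hx hx).1, innerDer_apply J hx hx, hxx]
      simp
    -- For odd D the supercommutator [D,D] is 2D², which is even and commutes with D.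
    · rw [TKK_bracket_der_der, TKK_bracket_der_der, superComm_apply _ hD.1 hD.1,
        ksign_one_one, neg_one_smul, sub_neg_eq_add, map_add, superComm_apply _ hD.1 (j := 0)]
      · simp [ksign_zero_right, mul_assoc]
      · exact Grading.mem_hom_part.2 fun l x hx => by
          have := Grading.hom_mem hD.1 (Grading.hom_mem hD.1 hx)
          rwa [← add_assoc, zmod_two_one_add_one] at this

theorem HermitianCoordinates.innerCyclic {A : Type*} [CharP k 3] [AddCommGroup A] [Module k A]
    {S : NormedSuperalgebra k A} (K : HermitianCoordinates S J) (hS : SymmComposition S) :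
    J.InnerCyclic where
  comm i j x y hx hy := by
    have hs := ksign_mul_self k i j
    refine K.ext (fun m => ?_) fun m => ?_
    · rw [K.diag_smul, K.diag_mul', K.diag_mul', hS.symm _ _ _ _ (K.off_mem hx _) (K.off_mem hy _),
        hS.symm _ _ _ _ (K.off_mem hx _) (K.off_mem hy _)]
      linear_combination (-K.diag y m) * K.ksign_mul_diag hx j m
    · rw [K.off_smul, K.off_mul' hx hy, K.off_mul' hy hx, ksign_comm k j i]
      have h1 := K.ksign_mul_diag hx j
      have h2 := K.ksign_mul_diag hy i
      rw [ksign_comm k j i] at h2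
      have h1' := h1 (m + 1)
      have h1'' := h1 (m + 2)
      have h2' := h2 (m + 1)
      have h2'' := h2 (m + 2)
      clear h1 h2
      match_scalars <;> grind
  inner_mem i j x y hx hy := K.innerDer_mem hS hx hy
  cyclic i j l x y z hx hy hz := K.innerDer_cyclic hS hx hy hz

end

/-! ### Hermitian matrices over a Hurwitz superalgebra in coordinates -/

theorem fin_three_sum {M : Type*} [AddCommMonoid M] (f : Fin 3 → M) (m : Fin 3) :
    ∑ l, f l = f m + f (m + 1) + f (m + 2) := by
  rw [Fin.sum_univ_three]
  fin_cases m
  · rfl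
  · change f 0 + f 1 + f 2 = f 1 + f 2 + f 0
    abel
  · change f 0 + f 1 + f 2 = f 2 + f 0 + f 1
    abel

namespace HurwitzSuperalgebra

variable {k A : Type*} [Field k] [AddCommGroup A] [Module k A] (C : HurwitzSuperalgebra k A)

theorem mem_H3_part {i : ZMod 2} {X : C.hermitian} :
    X ∈ C.H3.grading.part i ↔ ∀ a b, (X : Matrix (Fin 3) (Fin 3) A) a b ∈ C.grading.part i := by
  rw [← C.mem_matrix_part, Grading.mem_part, Grading.mem_part, Subtype.ext_iff]
  rfl

theorem bar_entry (X : C.hermitian) (a b : Fin 3) : C.bar (X.1 a b) = X.1 b a :=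
  congrFun (congrFun X.2 b) a

/-- The hermitian matrix with given coordinates. -/
def ofCoords (Z : (Fin 3 → k) × (Fin 3 → A)) : Matrix (Fin 3) (Fin 3) A :=
  Matrix.of fun r c => if c = r then Z.1 r • C.one
    else if c = r + 2 then -Z.2 (r + 1) else -C.bar (Z.2 (r + 2))

theorem ofCoords_diag (Z : (Fin 3 → k) × (Fin 3 → A)) (r : Fin 3) :
    C.ofCoords Z r r = Z.1 r • C.one := by simp [ofCoords]

theorem ofCoords_two (Z : (Fin 3 → k) × (Fin 3 → A)) (r : Fin 3) :
    C.ofCoords Z r (r + 2) = -Z.2 (r + 1) := by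
  simp [ofCoords]

theorem ofCoords_one (Z : (Fin 3 → k) × (Fin 3 → A)) (r : Fin 3) :
    C.ofCoords Z r (r + 1) = -C.bar (Z.2 (r + 2)) := by
  simp [ofCoords]

theorem ofCoords_mem (Z : (Fin 3 → k) × (Fin 3 → A)) :
    C.ofCoords Z ∈ C.hermitian := by
  refine Matrix.ext fun r c => ?_
  change C.bar (C.ofCoords Z c r) = C.ofCoords Z r c
  obtain ⟨f1, f2, f3, f4⟩ := fin_three_add r
  rcases fin_three_cases c r with rfl | rfl | rfl
  · rw [ofCoords_diag, map_smul, C.bar_one]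
  · have := C.ofCoords_two Z (r + 1)
    rw [f2, f1] at this
    rw [this, ofCoords_one, map_neg]
  · have := C.ofCoords_one Z (r + 2)
    rw [f3, f4] at this
    rw [this, ofCoords_two, map_neg, C.bar_bar]

/-- The coordinates of the hermitian matrices. -/
def coordsEquiv [CharP k 3] (h : C.polar C.one C.one = 2) :
    C.hermitian ≃ₗ[k] (Fin 3 → k) × (Fin 3 → A) where
  toFun X := (fun m => -C.polar (X.1 m m) C.one, fun m => -X.1 (m + 2) (m + 1))
  map_add' X Y := by
    refine Prod.ext (funext fun m => ?_) (funext fun m => ?_) <;> simp <;> abel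
  map_smul' c X := by
    refine Prod.ext (funext fun m => ?_) (funext fun m => ?_) <;> simp
  invFun Z := ⟨C.ofCoords Z, C.ofCoords_mem Z⟩
  left_inv X := by
    refine Subtype.ext (Matrix.ext fun r c => ?_)
    obtain ⟨f1, f2, f3, f4⟩ := fin_three_add r
    change C.ofCoords _ r c = X.1 r c
    rcases fin_three_cases c r with rfl | rfl | rfl
    -- A fixed point x of the involution satisfies 2x = b(x,1)1, that is, x = -b(x,1)1 in
    -- characteristic 3. This is why the diagonal coordinate is -b(x,1).
    · have := C.bar_entry X c c
      rw [C.bar_apply] at this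
      rw [ofCoords_diag]
      have h3 : (3 : k) = 0 := CharP.cast_eq_zero k 3
      linear_combination (norm := module) -this - h3 • X.1 c c
    · rw [ofCoords_one]
      change -C.bar (-X.1 (r + 2 + 2) (r + 2 + 1)) = _
      rw [f3, f4, map_neg, neg_neg, C.bar_entry]
    · rw [ofCoords_two]
      change - -X.1 (r + 1 + 2) (r + 1 + 1) = _
      rw [f2, f1, neg_neg]
  right_inv Z := by
    refine Prod.ext (funext fun m => ?_) (funext fun m => ?_)
    · change -C.polar (C.ofCoords Z m m) C.one = _
      rw [ofCoords_diag, map_smul, LinearMap.smul_apply, h, two_eq_neg_one]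
      simp
    · change -C.ofCoords Z (m + 2) (m + 1) = _
      have := C.ofCoords_two Z (m + 2)
      obtain ⟨f1, f2, f3, f4⟩ := fin_three_add m
      rw [f3, f4] at this
      rw [this, neg_neg]

/-- The factor 1/2 is -1, and the sum over the inner index starts at m so that the entries can be
named relative to m. The same factor cancels the sign that the coordinates put on off-diagonal
entries. -/
theorem H3_mul_apply [CharP k 3] {i j : ZMod 2} {X Y : C.hermitian} (hX : X ∈ C.H3.grading.part i)
    (hY : Y ∈ C.H3.grading.part j) (a b m : Fin 3) : (C.H3.mul X Y).1 a b =
      -((C.mul (X.1 a m) (Y.1 m b) + C.mul (X.1 a (m + 1)) (Y.1 (m + 1) b) +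
        C.mul (X.1 a (m + 2)) (Y.1 (m + 2) b)) + ksign k i j •
        (C.mul (Y.1 a m) (X.1 m b) + C.mul (Y.1 a (m + 1)) (X.1 (m + 1) b) +
        C.mul (Y.1 a (m + 2)) (X.1 (m + 2) b))) := by
  have h := C.jordanMul_apply (C.mem_matrix_part.2 (C.mem_H3_part.1 hX))
    (C.mem_matrix_part.2 (C.mem_H3_part.1 hY))
  rw [inv_two_eq_neg_one, neg_one_smul] at h
  have h' := congrFun (congrFun h a) b
  rw [← fin_three_sum (fun l => C.mul (X.1 a l) (Y.1 l b)),
    ← fin_three_sum (fun l => C.mul (Y.1 a l) (X.1 l b))]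
  exact h'

theorem polar_mul_one (x y : A) : C.polar (C.mul x y) C.one = C.polar x (C.bar y) := by
  have h := C.para_assoc (C.bar x) (C.bar y) C.one
  rw [para_mul, para_mul, C.bar_bar, C.bar_bar, C.bar_one, C.mul_one] at h
  change C.polar _ _ = C.polar _ _ at h
  rw [h, C.polar_bar]

theorem entry_of_coords [CharP k 3] (h : C.polar C.one C.one = 2) (X : C.hermitian) (m : Fin 3) :
    X.1 m m = (C.coordsEquiv h X).1 m • C.one ∧
    X.1 m (m + 1) = -C.bar ((C.coordsEquiv h X).2 (m + 2)) ∧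
    X.1 m (m + 2) = -(C.coordsEquiv h X).2 (m + 1) ∧
    X.1 (m + 1) m = -(C.coordsEquiv h X).2 (m + 2) ∧
    X.1 (m + 2) m = -C.bar ((C.coordsEquiv h X).2 (m + 1)) ∧
    X.1 (m + 2) (m + 1) = -(C.coordsEquiv h X).2 m := by
  have e : X.1 = C.ofCoords (C.coordsEquiv h X) :=
    congrArg Subtype.val ((C.coordsEquiv h).symm_apply_apply X).symm
  generalize C.coordsEquiv h X = Z at e
  obtain ⟨f1, f2, f3, f4⟩ := fin_three_add m
  have e1 := C.ofCoords_two Z (m + 1)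
  have e2 := C.ofCoords_one Z (m + 2)
  have e3 := C.ofCoords_two Z (m + 2)
  rw [f2, f1] at e1
  rw [f3, f4] at e2 e3
  exact ⟨e ▸ C.ofCoords_diag Z m, e ▸ C.ofCoords_one Z m, e ▸ C.ofCoords_two Z m, e ▸ e1, e ▸ e2,
    e ▸ e3⟩

theorem coords_mem [CharP k 3] (h : C.polar C.one C.one = 2) {i : ZMod 2} {X : C.hermitian}
    (hX : X ∈ C.H3.grading.part i) (m : Fin 3) : (C.coordsEquiv h X).2 m ∈ C.grading.part i :=
  neg_mem (C.mem_H3_part.1 hX _ _)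

theorem coords_odd [CharP k 3] (h : C.polar C.one C.one = 2) {i : ZMod 2} {X : C.hermitian}
    (hX : X ∈ C.H3.grading.part i) (hi : i = 1) : (C.coordsEquiv h X).1 = 0 := by
  funext m
  change -C.polar (X.1 m m) C.one = 0
  rw [C.polar_even i 0 _ _ (C.mem_H3_part.1 hX m m) C.one_mem (by rw [hi]; decide), neg_zero]

theorem ksign_mul_coords [CharP k 3] (h : C.polar C.one C.one = 2) {i : ZMod 2} {X : C.hermitian}
    (hX : X ∈ C.H3.grading.part i) (j : ZMod 2) (m : Fin 3) :
    ksign k i j * (C.coordsEquiv h X).1 m = (C.coordsEquiv h X).1 m := by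
  rcases zmod_two_cases i with rfl | rfl
  · rw [ksign_zero_left, _root_.one_mul]
  · rw [C.coords_odd h hX rfl, Pi.zero_apply, mul_zero]

/-- The coordinates of the Jordan superalgebra of the hermitian `3 × 3` matrices. -/
def H3Coordinates [CharP k 3] (h : C.polar C.one C.one = 2) :
    HermitianCoordinates C.para C.H3 where
  coords := C.coordsEquiv h
  mem_part i X := by
    rw [C.mem_H3_part]
    refine ⟨fun hX => ⟨C.coords_odd h (C.mem_H3_part.2 hX), C.coords_mem h (C.mem_H3_part.2 hX)⟩, ?_⟩
    rintro ⟨h0, h1⟩ a b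
    obtain ⟨e1, e2, e3, -⟩ := C.entry_of_coords h X a
    rcases fin_three_cases b a with h' | h' | h'
    · rw [← h'] at e1
      rw [← h', e1]
      rcases zmod_two_cases i with rfl | rfl
      · exact Submodule.smul_mem _ _ C.one_mem
      · rw [h0 rfl, Pi.zero_apply, zero_smul]
        exact zero_mem _
    · rw [h', e2]
      exact neg_mem (C.bar_mem (h1 _))
    · rw [h', e3]
      exact neg_mem (h1 _)
  diag_mul X Y m := by
    induction X using C.H3.grading.induction with
    | hadd X X' hX hX' =>
      simp only [map_add, LinearMap.add_apply, Prod.fst_add, Prod.snd_add, Pi.add_apply, hX, hX']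
      ring
    | hom i X hX =>
    induction Y using C.H3.grading.induction with
    | hadd Y Y' hY hY' =>
      simp only [map_add, Prod.fst_add, Prod.snd_add, Pi.add_apply, hY, hY']
      ring
    | hom j Y hY =>
    obtain ⟨a1, a2, a3, a4, a5, a6⟩ := C.entry_of_coords h X m
    obtain ⟨b1, b2, b3, b4, b5, b6⟩ := C.entry_of_coords h Y m
    change -C.polar ((C.H3.mul X Y).1 m m) C.one = _
    have hXm : ∀ m, (C.coordsEquiv h X).2 m ∈ C.grading.part i := C.coords_mem h hX
    have hYm : ∀ m, (C.coordsEquiv h Y).2 m ∈ C.grading.part j := C.coords_mem h hY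
    have hXd : ∀ m, ksign k i j * (C.coordsEquiv h X).1 m = (C.coordsEquiv h X).1 m :=
      C.ksign_mul_coords h hX j
    rw [C.H3_mul_apply hX hY m m m, a1, a2, a3, a4, a5, b1, b2, b3, b4, b5]
    have s1 := C.polar_symm _ _ _ _ (hYm (m + 1)) (hXm (m + 1))
    have s2 := C.polar_symm _ _ _ _ (hYm (m + 2)) (hXm (m + 2))
    have hd := hXd m
    have hs := ksign_mul_self k i j
    change _ = _ - C.polar _ _ - C.polar _ _
    rw [ksign_comm k j i] at s1 s2
    simp only [map_neg, map_add, map_smul, LinearMap.neg_apply, LinearMap.add_apply,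
      LinearMap.smul_apply, C.polar_mul_one, C.bar_bar, C.polar_bar_bar, neg_neg, C.bar_one, h,
      smul_eq_mul, s1, s2]
    grind
  off_mul i j X Y m hX hY := by
    have hXd : ∀ m, ksign k i j * (C.coordsEquiv h X).1 m = (C.coordsEquiv h X).1 m :=
      C.ksign_mul_coords h hX j
    have hYd : ∀ m, ksign k i j * (C.coordsEquiv h Y).1 m = (C.coordsEquiv h Y).1 m := by
      rw [ksign_comm]
      exact C.ksign_mul_coords h hY i
    have hX1 := hXd (m + 1)
    have hX2 := hXd (m + 2)
    have hY1 := hYd (m + 1)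
    have hY2 := hYd (m + 2)
    obtain ⟨-, a2, -, -, a5, a6⟩ := C.entry_of_coords h X m
    obtain ⟨-, b2, -, -, b5, b6⟩ := C.entry_of_coords h Y m
    obtain ⟨a1, -⟩ := C.entry_of_coords h X (m + 1)
    obtain ⟨b1, -⟩ := C.entry_of_coords h Y (m + 1)
    obtain ⟨c1, -⟩ := C.entry_of_coords h X (m + 2)
    obtain ⟨d1, -⟩ := C.entry_of_coords h Y (m + 2)
    change -(C.H3.mul X Y).1 (m + 2) (m + 1) = C.mul (C.bar _) (C.bar _) +
      ksign k i j • C.mul (C.bar _) (C.bar _) - _ - _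
    rw [C.H3_mul_apply hX hY _ _ m, a1, b1, c1, d1, a2, b2, a5, b5, a6, b6]
    simp only [map_neg, map_smul, LinearMap.neg_apply, LinearMap.smul_apply, C.one_mul, C.mul_one,
      neg_neg]
    match_scalars <;> grind

end HurwitzSuperalgebra

/-! ### The elements t_{q,r} of the para-quaternions -/

section

variable {k : Type*} [Field k]

theorem mat2_bar (q : Matrix (Fin 2) (Fin 2) k) : (mat2 k).bar q = q.trace • 1 - q := by
  have h : (mat2 k).polar q 1 = q.trace := by
    rw [mat2_polar_eq, Matrix.trace_one, Fintype.card_fin, mul_one]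
    push_cast
    ring
  rw [HurwitzSuperalgebra.bar_apply, ← h]
  rfl

theorem mat2_bar_of_mem {q : Matrix (Fin 2) (Fin 2) k} (hq : q ∈ (mat2 k).traceZero) :
    (mat2 k).bar q = -q := by
  rw [mat2_bar, mem_traceZero.1 hq, zero_smul, zero_sub]

theorem mat2_para_mul (q r : Matrix (Fin 2) (Fin 2) k) :
    (mat2 k).para.mul q r = (mat2 k).bar q * (mat2 k).bar r := rfl

theorem mat2_bar_one : (mat2 k).bar 1 = 1 := (mat2 k).bar_one

theorem mat2_para_polar (q r : Matrix (Fin 2) (Fin 2) k) :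
    (mat2 k).para.polar q r = (mat2 k).polar q r := rfl

theorem mat2_polar_one {q : Matrix (Fin 2) (Fin 2) k} (hq : q ∈ (mat2 k).traceZero) :
    (mat2 k).polar 1 q = 0 := by
  rw [mat2_polar_comm]
  exact hq

theorem mat2_polar_one_one : (mat2 k).polar 1 1 = 2 := by
  rw [mat2_polar_eq, mul_one, Matrix.trace_one, Fintype.card_fin]
  push_cast
  ring

theorem mat2_para_mem (q : Matrix (Fin 2) (Fin 2) k) : q ∈ (mat2 k).para.grading.part 0 :=
  mat2_mem_zero q

theorem mat2_symmComposition : SymmComposition (mat2 k).para := (mat2 k).para_symmComposition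

/-- The polarised Cayley–Hamilton identity: qr + rq = -b(q,r)1 for trace zero matrices. -/
theorem mat2_anticomm {q r : Matrix (Fin 2) (Fin 2) k} (hq : q ∈ (mat2 k).traceZero)
    (hr : r ∈ (mat2 k).traceZero) : r * q = -((mat2 k).polar q r • 1) - q * r := by
  rw [mem_traceZero, Matrix.trace_fin_two] at hq hr
  have hq' : q 1 1 = -q 0 0 := by linear_combination hq
  have hr' : r 1 1 = -r 0 0 := by linear_combination hr
  rw [mat2_polar_eq]
  ext i j
  fin_cases i <;> fin_cases j <;>
    simp [Matrix.trace_fin_two, Matrix.mul_apply, Fin.sum_univ_two, hq', hr'] <;> ring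

variable [CharP k 3]

/-- With c = [q,r], this is the triple z ↦ p_{m+2} z - z p_{m+1} for (p₀, p₁, p₂) = (0, -c, -c). It
corresponds to ι₀(x)∘ι₀(y) = -b(x,y)(e₁ + e₂) in J. -/
theorem mat2_tElem {q r : Matrix (Fin 2) (Fin 2) k} (hq : q ∈ (mat2 k).traceZero)
    (hr : r ∈ (mat2 k).traceZero) (z : Matrix (Fin 2) (Fin 2) k) :
    tElem (mat2 k).para q r 0 z = z * (q * r - r * q) - (q * r - r * q) * z ∧
    tElem (mat2 k).para q r 1 z = z * (q * r - r * q) ∧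
    tElem (mat2 k).para q r 2 z = -((q * r - r * q) * z) := by
  rw [tElem_zero _ (mat2_para_mem q) (mat2_para_mem r) (mat2_para_mem z),
    tElem_one _ (mat2_para_mem q) (mat2_para_mem r) (mat2_para_mem z),
    tElem_two _ (mat2_para_mem q) (mat2_para_mem r) (mat2_para_mem z)]
  simp only [mat2_para_mul, mat2_para_polar, ksign_zero_left, mat2_bar_of_mem hq,
    mat2_bar_of_mem hr, one_mul, one_smul]
  rw [mem_traceZero, Matrix.trace_fin_two] at hq hr
  have hq' : q 1 1 = -q 0 0 := by linear_combination hq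
  have hr' : r 1 1 = -r 0 0 := by linear_combination hr
  have h3 : (3 : k) = 0 := CharP.cast_eq_zero k 3
  simp only [mat2_polar_eq, mat2_bar]
  clear hq hr
  refine ⟨?_, ?_, ?_⟩ <;> ext i j <;> fin_cases i <;> fin_cases j <;>
    simp [Matrix.trace_fin_two, Matrix.mul_apply, Fin.sum_univ_two, hq', hr'] <;> grind

/-- The triple z ↦ p_{m+2} z - z p_{m+1} for (p₀, p₁, p₂) = (0, -q, q). It corresponds to a vector
derivation sending ι₀(x) to a multiple of e₂ - e₁ on the diagonal. -/
theorem mat2_tElem_one {q : Matrix (Fin 2) (Fin 2) k} (hq : q ∈ (mat2 k).traceZero)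
    (z : Matrix (Fin 2) (Fin 2) k) :
    tElem (mat2 k).para 1 q 0 z = q * z + z * q ∧ tElem (mat2 k).para 1 q 1 z = -(z * q) ∧
    tElem (mat2 k).para 1 q 2 z = -(q * z) := by
  rw [tElem_zero _ (mat2_para_mem 1) (mat2_para_mem q) (mat2_para_mem z),
    tElem_one _ (mat2_para_mem 1) (mat2_para_mem q) (mat2_para_mem z),
    tElem_two _ (mat2_para_mem 1) (mat2_para_mem q) (mat2_para_mem z)]
  simp only [mat2_para_mul, mat2_para_polar, ksign_zero_left, mat2_bar_of_mem hq,
    mat2_bar_one, one_mul, one_smul]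
  rw [mem_traceZero, Matrix.trace_fin_two] at hq
  have hq' : q 1 1 = -q 0 0 := by linear_combination hq
  have h3 : (3 : k) = 0 := CharP.cast_eq_zero k 3
  simp only [mat2_polar_eq, mat2_bar]
  clear hq
  refine ⟨?_, ?_, ?_⟩ <;> ext i j <;> fin_cases i <;> fin_cases j <;>
    simp [Matrix.trace_fin_two, Matrix.mul_apply, Fin.sum_univ_two, hq'] <;> grind

theorem mat2_tElem_one_right (q : Matrix (Fin 2) (Fin 2) k) :
    tElem (mat2 k).para q 1 = -tElem (mat2 k).para 1 q := by
  rw [tElem_skew mat2_symmComposition (mat2_para_mem q) (mat2_para_mem 1), ksign_zero_left,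
    one_smul]

theorem mat2_tElem_one_one : tElem (mat2 k).para 1 1 = 0 := by
  have h := mat2_tElem_one_right (1 : Matrix (Fin 2) (Fin 2) k)
  rw [eq_neg_iff_add_eq_zero, ← two_smul k, two_eq_neg_one, neg_one_smul, neg_eq_zero] at h
  exact h

end

/-! ### The bracket of g(S₄, S) on tensors -/

section

variable {k A : Type*} [Field k] [AddCommGroup A] [Module k A] (S : NormedSuperalgebra k A)

theorem mat2_tmul_mem {i : ZMod 2} {x : A} (hx : x ∈ S.grading.part i)
    (q : Matrix (Fin 2) (Fin 2) k) :
    q ⊗ₜ x ∈ ((mat2 k).para.grading.tensor S.grading).part i := by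
  have h := Grading.tmul_mem (mat2_para_mem q) hx
  rwa [zero_add] at h

/-- Mat₂(k) has no odd part, so all its operators are even and every sign involving the first tensor
factor is 1. -/
theorem mat2_hom_mem (f : Module.End k (Matrix (Fin 2) (Fin 2) k)) :
    f ∈ (mat2 k).para.grading.hom.part 0 := by
  refine Grading.mem_hom_part.2 fun j x hx => ?_
  rcases zmod_two_cases j with rfl | rfl
  · exact mat2_para_mem _
  · have h : x = 0 := by
      have := Grading.pr_of_mem (mat2_para_mem x) 1
      rw [Grading.mem_part.1 hx] at this
      simpa using this
    rw [h, map_zero]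
    exact zero_mem _

theorem brNext_mat2 {i j : ZMod 2} {x y : A} (hx : x ∈ S.grading.part i)
    (hy : y ∈ S.grading.part j) (q r : Matrix (Fin 2) (Fin 2) k) :
    brNext (mat2 k).para S (q ⊗ₜ x) (r ⊗ₜ y) = (mat2 k).para.mul q r ⊗ₜ S.mul x y := by
  rw [brNext, tensorBilin_apply _ _ _ _ _ (mat2_para_mem q) hx (mat2_para_mem r) hy,
    ksign_zero_right, one_smul]

theorem superFlip_brNext_mat2 {i j : ZMod 2} {x y : A} (hx : x ∈ S.grading.part i)
    (hy : y ∈ S.grading.part j) (q r : Matrix (Fin 2) (Fin 2) k) :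
    superFlip ((mat2 k).para.grading.tensor S.grading) ((mat2 k).para.grading.tensor S.grading)
      (brNext (mat2 k).para S) (q ⊗ₜ x) (r ⊗ₜ y) =
      ksign k i j • (mat2 k).para.mul r q ⊗ₜ S.mul y x := by
  rw [superFlip_apply _ _ _ (mat2_tmul_mem S hy r) (mat2_tmul_mem S hx q), brNext_mat2 S hy hx,
    ksign_comm]

theorem brSameLeft_mat2 {i j : ZMod 2} {x y : A} (hx : x ∈ S.grading.part i)
    (hy : y ∈ S.grading.part j) (q r : Matrix (Fin 2) (Fin 2) k) :
    brSameLeft (mat2 k).para S (q ⊗ₜ x) (r ⊗ₜ y) = S.polar x y • tElem (mat2 k).para q r := by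
  rw [brSameLeft, LinearMap.compr₂_apply, tensorBilin_apply _ _ _ _ _ (mat2_para_mem q) hx
    (mat2_para_mem r) hy, ksign_zero_left, ksign_zero_left, mul_one, mul_one,
    one_smul]
  rfl

theorem brSameRight_mat2 {i j : ZMod 2} {x y : A} (hx : x ∈ S.grading.part i)
    (hy : y ∈ S.grading.part j) (q r : Matrix (Fin 2) (Fin 2) k) :
    brSameRight (mat2 k).para S (q ⊗ₜ x) (r ⊗ₜ y) = (mat2 k).polar q r • tElem S x y := by
  rw [brSameRight, LinearMap.compr₂_apply, tensorBilin_apply _ _ _ _ _ (mat2_para_mem q) hx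
    (mat2_para_mem r) hy, ksign_zero_left, one_smul]
  rfl

theorem superFlip_rTensor_mat2 {i : ZMod 2} {x : A} (hx : x ∈ S.grading.part i)
    (q : Matrix (Fin 2) (Fin 2) k) (f : Module.End k (Matrix (Fin 2) (Fin 2) k)) :
    superFlip (mat2 k).para.grading.hom ((mat2 k).para.grading.tensor S.grading)
      (LinearMap.rTensorHom A) (q ⊗ₜ x) f = f q ⊗ₜ x := by
  rw [superFlip_apply _ _ _ (mat2_hom_mem f) (mat2_tmul_mem S hx q), ksign_zero_left, one_smul]
  rfl

theorem actRight_mat2 (q : Matrix (Fin 2) (Fin 2) k) (x : A) (f : Module.End k A) :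
    actRight (mat2 k).para.grading S.grading f (q ⊗ₜ x) = q ⊗ₜ f x := by
  have h0 := Grading.pr_of_mem (mat2_para_mem q)
  conv_rhs => rw [← S.grading.hom.pr_add f]
  simp [actRight, sum_zmod_two, h0, ksign_zero_right, TensorProduct.tmul_add]

theorem superFlip_actRight_mat2 {i j : ZMod 2} {x : A} {f : Module.End k A}
    (hx : x ∈ S.grading.part i) (hf : f ∈ S.grading.hom.part j) (q : Matrix (Fin 2) (Fin 2) k) :
    superFlip S.grading.hom ((mat2 k).para.grading.tensor S.grading)
      (actRight (mat2 k).para.grading S.grading) (q ⊗ₜ x) f = ksign k i j • q ⊗ₜ f x := by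
  rw [superFlip_apply _ _ _ hf (mat2_tmul_mem S hx q), actRight_mat2, ksign_comm]

end

/-- `∑ i, f_i (m - i)`, a term of the bracket of `g(S, S')`. -/
theorem sum_rotate {M : Type*} [AddCommMonoid M] (f : Fin 3 → Fin 3 → M) (m : Fin 3) :
    ∑ i, f i (m - i) = f m 0 + f (m + 1) 2 + f (m + 2) 1 := by
  rw [fin_three_sum _ m]
  have h : m - m = 0 ∧ m - (m + 1) = 2 ∧ m - (m + 2) = 1 := by revert m; decide
  rw [h.1, h.2.1, h.2.2]

section

variable {k A B : Type*} [Field k] [AddCommGroup A] [Module k A] [AddCommGroup B] [Module k B]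
  (S : NormedSuperalgebra k A) (S' : NormedSuperalgebra k B)

theorem squareBracket_fst (X Y : Amb k A B) (m : Fin 3) :
    (squareBracket S S' X Y).1 m = superComm S.grading (X.1 m) (Y.1 m) +
      (brSameLeft S S' (X.2.2 m) (Y.2.2 m) 0 + brSameLeft S S' (X.2.2 (m + 1)) (Y.2.2 (m + 1)) 2 +
        brSameLeft S S' (X.2.2 (m + 2)) (Y.2.2 (m + 2)) 1) := by
  rw [← sum_rotate fun i => brSameLeft S S' (X.2.2 i) (Y.2.2 i)]
  rfl

theorem squareBracket_snd (X Y : Amb k A B) (m : Fin 3) :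
    (squareBracket S S' X Y).2.1 m = superComm S'.grading (X.2.1 m) (Y.2.1 m) +
      (brSameRight S S' (X.2.2 m) (Y.2.2 m) 0 +
        brSameRight S S' (X.2.2 (m + 1)) (Y.2.2 (m + 1)) 2 +
        brSameRight S S' (X.2.2 (m + 2)) (Y.2.2 (m + 2)) 1) := by
  rw [← sum_rotate fun i => brSameRight S S' (X.2.2 i) (Y.2.2 i)]
  rfl

theorem squareBracket_thd (X Y : Amb k A B) (m : Fin 3) :
    (squareBracket S S' X Y).2.2 m =
      LinearMap.rTensorHom B (X.1 m) (Y.2.2 m)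
          - superFlip S.grading.hom (S.grading.tensor S'.grading) (LinearMap.rTensorHom B)
            (X.2.2 m) (Y.1 m)
          + actRight S.grading S'.grading (X.2.1 m) (Y.2.2 m)
          - superFlip S'.grading.hom (S.grading.tensor S'.grading)
            (actRight S.grading S'.grading) (X.2.2 m) (Y.2.1 m)
          + brNext S S' (X.2.2 (m + 1)) (Y.2.2 (m + 2))
          - superFlip (S.grading.tensor S'.grading) (S.grading.tensor S'.grading)
            (brNext S S') (X.2.2 (m + 2)) (Y.2.2 (m + 1)) :=
  rfl

end

/-! ### The map into g(S₄, S) respects brackets -/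

namespace HermitianCoordinates

variable {k A H : Type*} [Field k] [AddCommGroup A] [Module k A] [AddCommGroup H]
  [Module k H] {S : NormedSuperalgebra k A} {J : Superalgebra k H} (K : HermitianCoordinates S J)

/-- The map from the Tits-Kantor-Koecher Lie superalgebra to the Lie superalgebra of the magic
square. -/
def toSquare : ((Matrix (Fin 2) (Fin 2) k ⊗[k] H) × Module.End k H) →ₗ[k]
    Amb k (Matrix (Fin 2) (Fin 2) k) A :=
  LinearMap.prod
    (LinearMap.pi fun m =>
      ((TensorProduct.rid k _).toLinearMap ∘ₗ TensorProduct.map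
          (LinearMap.mul k (Matrix (Fin 2) (Fin 2) k)) (K.diagMap (m + 2)) -
        (TensorProduct.rid k _).toLinearMap ∘ₗ TensorProduct.map
          (LinearMap.mul k (Matrix (Fin 2) (Fin 2) k)).flip (K.diagMap (m + 1))) ∘ₗ
        LinearMap.fst k _ _)
    (LinearMap.prod (K.triple ∘ₗ LinearMap.snd k _ _)
      (LinearMap.pi fun m => -(LinearMap.lTensor (Matrix (Fin 2) (Fin 2) k) (K.offMap m) ∘ₗ LinearMap.fst k _ _) -
        TensorProduct.mk k (Matrix (Fin 2) (Fin 2) k) A 1 ∘ₗ LinearMap.proj m ∘ₗ K.vec ∘ₗ LinearMap.snd k _ _))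

theorem toSquare_fst (q : Matrix (Fin 2) (Fin 2) k) (X : H) (D : Module.End k H) (m : Fin 3)
    (z : Matrix (Fin 2) (Fin 2) k) : (K.toSquare (q ⊗ₜ X, D)).1 m z =
      K.diag X (m + 2) • (q * z) - K.diag X (m + 1) • (z * q) := rfl

theorem toSquare_snd (t : Matrix (Fin 2) (Fin 2) k ⊗[k] H) (D : Module.End k H) :
    (K.toSquare (t, D)).2.1 = K.triple D := rfl

theorem toSquare_thd (q : Matrix (Fin 2) (Fin 2) k) (X : H) (D : Module.End k H) (m : Fin 3) :
    (K.toSquare (q ⊗ₜ X, D)).2.2 m = -(q ⊗ₜ K.off X m) - 1 ⊗ₜ K.vec D m := rfl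

theorem toSquare_der_fst (D : Module.End k H) : (K.toSquare (0, D)).1 = 0 := by
  funext m
  simp [toSquare]

theorem toSquare_der_thd (D : Module.End k H) (m : Fin 3) :
    (K.toSquare (0, D)).2.2 m = -(1 ⊗ₜ K.vec D m) := by
  simp [toSquare]

theorem toSquare_tmul_thd (q : Matrix (Fin 2) (Fin 2) k) (X : H) (m : Fin 3) :
    (K.toSquare (q ⊗ₜ X, 0)).2.2 m = -(q ⊗ₜ K.off X m) := by
  simp [toSquare, offMap_apply]

theorem toSquare_tmul_snd (t : Matrix (Fin 2) (Fin 2) k ⊗[k] H) : (K.toSquare (t, 0)).2.1 = 0 := by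
  simp [toSquare_snd]

theorem innerDer_triple [CharP k 3] (hS : SymmComposition S) {i j : ZMod 2} {X Y : H}
    (hX : X ∈ J.grading.part i) (hY : Y ∈ J.grading.part j) :
    K.triple (innerDer J X Y) = tSum S (K.off X) (K.off Y) ∧
    K.vec (innerDer J X Y) = K.innerVec X Y := by
  rw [K.innerDer_eq hS hX hY, triple_derOp, vec_derOp]
  exact ⟨rfl, rfl⟩

/-- The component in tri(S₄) contains commutators of the diagonal parts and the t_{q,r}; the one in
tri(S) is the triple of the inner derivation. In Mat₂ ⊗ S the terms [q,r] ⊗ (X∘Y) and b(q,r)1 = -(qr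
+ rq), coming from d_{X,Y}, combine into single products qr and rq. -/
theorem toSquare_tmul_tmul [CharP k 3] (hS : SymmComposition S) {i j : ZMod 2}
    {q r : Matrix (Fin 2) (Fin 2) k} (hq : q ∈ (mat2 k).traceZero) (hr : r ∈ (mat2 k).traceZero)
    {X Y : H} (hX : X ∈ J.grading.part i) (hY : Y ∈ J.grading.part j) :
    K.toSquare ((TKK J).bracket (q ⊗ₜ X, 0) (r ⊗ₜ Y, 0)) =
      squareBracket (mat2 k).para S (K.toSquare (q ⊗ₜ X, 0)) (K.toSquare (r ⊗ₜ Y, 0)) := by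
  rw [TKK_bracket_tmul_tmul]
  obtain ⟨e1, e2⟩ := K.innerDer_triple hS hX hY
  refine Prod.ext (funext fun m => ?_) (Prod.ext (funext fun m => ?_) (funext fun m => ?_))
  · rw [squareBracket_fst, superComm_apply _ (mat2_hom_mem _) (mat2_hom_mem _), ksign_zero_left,
      one_smul]
    simp only [toSquare_tmul_thd, map_neg, LinearMap.neg_apply, neg_neg,
      brSameLeft_mat2 S (K.off_mem hX _) (K.off_mem hY _)]
    refine LinearMap.ext fun z => ?_
    obtain ⟨t0, t1, t2⟩ := mat2_tElem hq hr z
    obtain ⟨f1, f2, f3, f4⟩ := fin_three_add m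
    simp only [LinearMap.sub_apply, LinearMap.add_apply, Pi.smul_apply, LinearMap.smul_apply,
      Module.End.mul_apply, toSquare_fst, t0, t1, t2, diag_mul', f1, f2, f3, f4, mul_sub, sub_mul,
      mul_smul_comm, smul_mul_assoc, mul_assoc]
    match_scalars <;> grind
  · rw [squareBracket_snd]
    simp only [toSquare_tmul_thd, map_neg, LinearMap.neg_apply, neg_neg, toSquare_snd, map_smul,
      brSameRight_mat2 S (K.off_mem hX _) (K.off_mem hY _), e1, tSum, Pi.neg_apply,
      Pi.smul_apply]
    rw [map_zero, Pi.zero_apply, map_zero, zero_add]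
    match_scalars <;> grind
  · rw [squareBracket_thd]
    -- This rewrites the part in 1 ⊗ S through qr and rq, the only products that occur in the
    -- bracket of the square.
    have hb : (mat2 k).polar q r • (1 : Matrix (Fin 2) (Fin 2) k) = -(q * r) - r * q := by
      rw [mat2_anticomm hq hr]; abel
    have hb' : ∀ x : A, (mat2 k).polar q r • ((1 : Matrix (Fin 2) (Fin 2) k) ⊗ₜ[k] x) =
        -((q * r) ⊗ₜ x) - (r * q) ⊗ₜ x := by
      intro x
      rw [TensorProduct.smul_tmul', hb, TensorProduct.sub_tmul, TensorProduct.neg_tmul]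
    simp only [toSquare_tmul_thd, toSquare_tmul_snd]
    simp only [toSquare_thd, map_smul, map_neg, e2,
      Pi.zero_apply, Pi.neg_apply, Pi.smul_apply, map_zero, LinearMap.zero_apply,
      LinearMap.neg_apply, sub_zero, LinearMap.coe_rTensorHom, LinearMap.rTensor_tmul,
      toSquare_fst, neg_neg, brNext_mat2 S (K.off_mem hX _) (K.off_mem hY _),
      superFlip_brNext_mat2 S (K.off_mem hX _) (K.off_mem hY _),
      superFlip_rTensor_mat2 S (K.off_mem hX _), mat2_para_mul, mat2_bar_of_mem hq,
      mat2_bar_of_mem hr, neg_mul_neg, K.innerVec_apply hX hY, K.off_mul' hX hY,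
      TensorProduct.tmul_neg, TensorProduct.tmul_smul, mul_smul, hb']
    simp only [TensorProduct.tmul_add, TensorProduct.tmul_sub, TensorProduct.tmul_smul,
      TensorProduct.sub_tmul, ← TensorProduct.smul_tmul']
    match_scalars <;> grind

end HermitianCoordinates

namespace HermitianCoordinates

variable {k A H : Type*} [Field k] [CharP k 3] [AddCommGroup A] [Module k A] [AddCommGroup H]
  [Module k H] {S : NormedSuperalgebra k A} {J : Superalgebra k H} (K : HermitianCoordinates S J)

theorem diag_der (hS : SymmComposition S) {p : ZMod 2} {D : Module.End k H} (hD : D ∈ derPart J p)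
    (X : H) (m : Fin 3) : K.diag (D X) m = S.polar (K.vec D (m + 1)) (K.off X (m + 1)) -
      S.polar (K.vec D (m + 2)) (K.off X (m + 2)) := by
  rw [← K.diag_derOp (K.triple D) (K.vec D), (K.der_eq hS hD).2]

theorem off_der (hS : SymmComposition S) {p j : ZMod 2} {D : Module.End k H}
    (hD : D ∈ derPart J p) {X : H} (hX : X ∈ J.grading.part j) (m : Fin 3) :
    K.off (D X) m = K.triple D m (K.off X m) +
      (K.diag X (m + 1) - K.diag X (m + 2)) • K.vec D m +
      S.mul (K.vec D (m + 1)) (K.off X (m + 2)) -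
      ksign k p j • S.mul (K.off X (m + 1)) (K.vec D (m + 2)) := by
  rw [← K.off_derOp' (d := K.triple D) (K.vec_mem hD.1) hX, (K.der_eq hS hD).2]

/-- The triple of D acts through tri(S). Its vector appears as 1 ⊗ v, whose brackets with q ⊗ x
involve t_{1,q} and no element of tri(S), because b(1,q) = 0. -/
theorem toSquare_der_tmul (hS : SymmComposition S) {p j : ZMod 2} {D : Module.End k H}
    (hD : D ∈ derPart J p) {q : Matrix (Fin 2) (Fin 2) k} (hq : q ∈ (mat2 k).traceZero)
    {X : H} (hX : X ∈ J.grading.part j) :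
    K.toSquare ((TKK J).bracket (0, D) (q ⊗ₜ X, 0)) =
      squareBracket (mat2 k).para S (K.toSquare (0, D)) (K.toSquare (q ⊗ₜ X, 0)) := by
  rw [TKK_bracket_der_tmul]
  have hv := K.vec_mem hD.1
  refine Prod.ext (funext fun m => ?_) (Prod.ext (funext fun m => ?_) (funext fun m => ?_))
  · rw [squareBracket_fst, superComm_apply _ (mat2_hom_mem _) (mat2_hom_mem _)]
    simp only [toSquare_tmul_thd, toSquare_der_thd, map_neg, LinearMap.neg_apply, neg_neg,
      brSameLeft_mat2 S (hv _) (K.off_mem hX _), toSquare_der_fst, Pi.zero_apply, zero_mul,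
      mul_zero, smul_zero, sub_zero, zero_add]
    refine LinearMap.ext fun z => ?_
    obtain ⟨t0, t1, t2⟩ := mat2_tElem_one hq z
    obtain ⟨f1, f2, f3, f4⟩ := fin_three_add m
    simp only [LinearMap.add_apply, Pi.smul_apply, LinearMap.smul_apply,
      toSquare_fst, t0, t1, t2, K.diag_der hS hD, f1, f2, f3, f4]
    match_scalars <;> grind
  · rw [squareBracket_snd]
    simp only [toSquare_tmul_thd, toSquare_der_thd, map_neg, LinearMap.neg_apply, neg_neg,
      toSquare_tmul_snd, brSameRight_mat2 S (hv _) (K.off_mem hX _), mat2_polar_one hq, zero_smul,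
      Pi.zero_apply, map_zero, add_zero]
  · rw [squareBracket_thd]
    have hb : (mat2 k).bar q = -q := mat2_bar_of_mem hq
    simp only [toSquare_tmul_thd, toSquare_der_thd, toSquare_der_fst,
      toSquare_snd, map_neg, LinearMap.neg_apply, Pi.zero_apply, map_zero, LinearMap.zero_apply,
      sub_zero, neg_neg, superFlip_rTensor_mat2 S (hv _), actRight_mat2,
      brNext_mat2 S (hv _) (K.off_mem hX _), superFlip_brNext_mat2 S (hv _) (K.off_mem hX _),
      mat2_para_mul, hb, mat2_bar_one, toSquare_fst, K.off_der hS hD hX, mul_one, one_mul]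
    simp only [TensorProduct.tmul_add, TensorProduct.tmul_sub, TensorProduct.tmul_smul,
      TensorProduct.sub_tmul, TensorProduct.neg_tmul, ← TensorProduct.smul_tmul']
    match_scalars <;> grind

/-- The opposite order is checked separately since superanticommutativity of the bracket of the
square is not yet available; it will itself follow by transport. -/
theorem toSquare_tmul_der (hS : SymmComposition S) {p j : ZMod 2} {D : Module.End k H}
    (hD : D ∈ derPart J p) {q : Matrix (Fin 2) (Fin 2) k} (hq : q ∈ (mat2 k).traceZero)
    {X : H} (hX : X ∈ J.grading.part j) :
    K.toSquare ((TKK J).bracket (q ⊗ₜ X, 0) (0, D)) =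
      squareBracket (mat2 k).para S (K.toSquare (q ⊗ₜ X, 0)) (K.toSquare (0, D)) := by
  rw [TKK_bracket_tmul_der hX hD.1, TKK_split_smul, map_smul]
  have hv := K.vec_mem hD.1
  have hs := ksign_mul_self k j p
  refine Prod.ext (funext fun m => ?_) (Prod.ext (funext fun m => ?_) (funext fun m => ?_))
  · rw [squareBracket_fst, superComm_apply _ (mat2_hom_mem _) (mat2_hom_mem _)]
    simp only [toSquare_tmul_thd, toSquare_der_thd, map_neg, LinearMap.neg_apply, neg_neg,
      brSameLeft_mat2 S (K.off_mem hX _) (hv _), toSquare_der_fst, Pi.zero_apply, zero_mul,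
      mul_zero, smul_zero, sub_zero, zero_add]
    refine LinearMap.ext fun z => ?_
    obtain ⟨t0, t1, t2⟩ := mat2_tElem_one hq z
    obtain ⟨f1, f2, f3, f4⟩ := fin_three_add m
    have hsym := fun m => S.ksign_mul_polar (hv m) (K.off_mem hX m)
    simp only [LinearMap.add_apply, Pi.smul_apply, LinearMap.smul_apply, Prod.smul_fst,
      mat2_tElem_one_right, Pi.neg_apply, LinearMap.neg_apply,
      toSquare_fst, t0, t1, t2, K.diag_der hS hD, f1, f2, f3, f4,
      hS.symm _ _ _ _ (K.off_mem hX _) (hv _)]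
    match_scalars <;> grind
  · rw [squareBracket_snd]
    simp only [toSquare_tmul_thd, toSquare_der_thd, map_neg, LinearMap.neg_apply, neg_neg,
      toSquare_tmul_snd, brSameRight_mat2 S (K.off_mem hX _) (hv _), mat2_polar_comm q,
      mat2_polar_one hq, zero_smul, Prod.smul_snd, Prod.smul_fst, smul_zero,
      Pi.zero_apply, map_zero, LinearMap.zero_apply, add_zero]
  · rw [squareBracket_thd]
    have hb : (mat2 k).bar q = -q := mat2_bar_of_mem hq
    simp only [toSquare_tmul_thd, toSquare_der_thd, toSquare_der_fst,
      toSquare_snd, map_neg, LinearMap.neg_apply, Pi.zero_apply, map_zero, LinearMap.zero_apply,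
      Prod.smul_snd, Pi.smul_apply,
      sub_zero, neg_neg, superFlip_actRight_mat2 S (K.off_mem hX _) (K.triple_hom hD.1 _),
      brNext_mat2 S (K.off_mem hX _) (hv _), superFlip_brNext_mat2 S (K.off_mem hX _) (hv _),
      LinearMap.coe_rTensorHom, LinearMap.rTensor_tmul,
      mat2_para_mul, hb, mat2_bar_one, toSquare_fst, K.off_der hS hD hX, mul_one, one_mul]
    have hk := fun m => K.ksign_mul_diag hX p m
    have h1 := hk (m + 1)
    have h2 := hk (m + 2)
    rw [ksign_comm k p j]
    simp only [TensorProduct.tmul_add, TensorProduct.tmul_sub, TensorProduct.tmul_smul,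
      TensorProduct.sub_tmul, TensorProduct.neg_tmul, ← TensorProduct.smul_tmul']
    match_scalars <;> grind

theorem der_idem (hS : SymmComposition S) {p : ZMod 2} {D : Module.End k H}
    (hD : D ∈ derPart J p) (m : Fin 3) : K.off (D (K.idem (m + 1))) m = K.vec D m ∧
      K.off (D (K.idem (m + 1))) (m + 1) = 0 ∧
      K.off (D (K.idem (m + 1))) (m + 2) = -K.vec D (m + 2) := by
  obtain ⟨h1, h2, h3, h4, h5, h6⟩ := fin_three_ne m
  obtain ⟨f1, f2, f3, f4⟩ := fin_three_add m
  refine ⟨rfl, ?_, ?_⟩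
  · rw [K.off_der hS hD (K.idem_mem _)]
    simp [off_idem, diag_idem, f1, f2, h3.symm, h4]
  · rw [K.off_der hS hD (K.idem_mem _)]
    simp [off_idem, diag_idem, f3, f4, h4]

theorem vec_superComm (hS : SymmComposition S) {p j : ZMod 2} {D E : Module.End k H}
    (hD : D ∈ derPart J p) (hE : E ∈ derPart J j) (m : Fin 3) :
    K.vec (superComm J.grading D E) m = K.triple D m (K.vec E m) -
      S.mul (K.vec D (m + 1)) (K.vec E (m + 2)) - ksign k p j • (K.triple E m (K.vec D m) -
      S.mul (K.vec E (m + 1)) (K.vec D (m + 2))) := by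
  -- Evaluation at e_{m+1}: its image under E has coordinates v_m, 0, -v_{m+2} (with v the vector of
  -- E) and zero diagonal, so the vector part of D contributes one product only.
  have key : ∀ p j (D E : Module.End k H), D ∈ derPart J p → E ∈ derPart J j →
      K.off (D (E (K.idem (m + 1)))) m = K.triple D m (K.vec E m) -
        S.mul (K.vec D (m + 1)) (K.vec E (m + 2)) := by
    intro p j D E hD hE
    obtain ⟨e1, e2, e3⟩ := K.der_idem hS hE m
    rw [K.off_der hS hD (Grading.hom_mem hE.1 (K.idem_mem _)), e1, e2, e3]
    simp only [K.diag_der hS hE, off_idem, map_zero, LinearMap.zero_apply, sub_self, zero_smul,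
      smul_zero, map_neg, sub_zero, add_zero]
    abel
  rw [vec_apply, superComm_apply _ hD.1 hE.1, LinearMap.sub_apply, LinearMap.smul_apply, off_sub,
    off_smul, Module.End.mul_apply, Module.End.mul_apply, key _ _ _ _ hD hE, key _ _ _ _ hE hD]

/-- The vector derivations do not close under the commutator; their defect is a sum of elements
t_{v,w}. Its coefficient -1 is b(1,1) = 2, as in the bracket of 1 ⊗ v with 1 ⊗ w. -/
theorem triple_superComm (hS : SymmComposition S) {p j : ZMod 2} {D E : Module.End k H}
    (hD : D ∈ derPart J p) (hE : E ∈ derPart J j) (m : Fin 3) :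
    K.triple (superComm J.grading D E) m = superComm S.grading (K.triple D m) (K.triple E m) -
      tSum S (K.vec D) (K.vec E) m := by
  rw [superComm_apply _ (K.triple_hom hD.1 m) (K.triple_hom hE.1 m)]
  refine S.grading.hom_ext fun l c hc => ?_
  -- E takes ι_m(c) to all the components, and the vector part of D brings the diagonal and the two
  -- other off-diagonal ones back to the index m.
  have key : ∀ p j (D E : Module.End k H), D ∈ derPart J p → E ∈ derPart J j →
      K.off (D (E (K.inj m c))) m = K.triple D m (K.triple E m c) +
        S.polar (K.vec E m) c • K.vec D m -
        ksign k j l • S.mul (K.vec D (m + 1)) (S.mul c (K.vec E (m + 1))) -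
        (ksign k p j * ksign k p l) • S.mul (S.mul (K.vec E (m + 2)) c) (K.vec D (m + 2)) := by
    intro p j D E hD hE
    obtain ⟨h1, h2, h3, h4, h5, h6⟩ := fin_three_ne m
    obtain ⟨f1, f2, f3, f4⟩ := fin_three_add m
    rw [K.off_der hS hD (Grading.hom_mem hE.1 (K.inj_mem hc m)),
      K.off_der hS hE (K.inj_mem hc m), K.off_der hS hE (K.inj_mem hc m),
      K.off_der hS hE (K.inj_mem hc m)]
    simp only [K.diag_der hS hE, off_inj, diag_inj, f1, f2, f3, f4, h1, h2,
      if_true, if_false, map_zero, LinearMap.zero_apply, sub_self, zero_smul, sub_zero, add_zero,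
      smul_zero, zero_add, zero_sub, map_neg, map_smul,
      ksign_add_right]
    match_scalars <;> grind
  rw [triple_apply, superComm_apply _ hD.1 hE.1, LinearMap.sub_apply, LinearMap.smul_apply, off_sub,
    off_smul, Module.End.mul_apply, Module.End.mul_apply, key _ _ _ _ hD hE, key _ _ _ _ hE hD]
  have hv := K.vec_mem hD.1
  have hw := K.vec_mem hE.1
  simp only [tSum, LinearMap.sub_apply, LinearMap.add_apply, LinearMap.smul_apply,
    Module.End.mul_apply, tElem_zero S (hv _) (hw _) hc, tElem_one S (hv _) (hw _) hc,
    tElem_two S (hv _) (hw _) hc]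
  have s1 := ksign_mul_self k p j
  have s2 := ksign_mul_self k p l
  have s3 := ksign_mul_self k j l
  have e1 := S.ksign_mul_polar (hv m) hc j
  have e2 := S.ksign_mul_polar (hw m) hc p
  have R1 := hS.right _ _ _ _ _ _ (hv (m + 1)) hc (hw (m + 1))
  have R2 := hS.left _ _ _ _ _ _ (hw (m + 2)) hc (hv (m + 2))
  have e3 := hS.symm _ _ _ _ (hw (m + 2)) (hv (m + 2))
  have e4 := S.ksign_mul_polar (hv (m + 1)) (hw (m + 1)) l
  simp only [ksign_comm k j p, ksign_comm k l p, ksign_comm k l j] at *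
  clear hv hw hD hE key
  linear_combination (norm := skip) ksign k j l • R1 + (ksign k p j * ksign k p l) • R2
  clear R1 R2
  match_scalars <;> grind

/-- In tri(S₄) nothing arises because t_{1,1} = 0, and in Mat₂ ⊗ S all remains in 1 ⊗ S because 1 is
its own conjugate. -/
theorem toSquare_der_der (hS : SymmComposition S) {p j : ZMod 2} {D E : Module.End k H}
    (hD : D ∈ derPart J p) (hE : E ∈ derPart J j) :
    K.toSquare ((TKK J).bracket (0, D) (0, E)) =
      squareBracket (mat2 k).para S (K.toSquare (0, D)) (K.toSquare (0, E)) := by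
  rw [TKK_bracket_der_der]
  have hv := K.vec_mem hD.1
  have hw := K.vec_mem hE.1
  refine Prod.ext (funext fun m => ?_) (Prod.ext (funext fun m => ?_) (funext fun m => ?_))
  · rw [squareBracket_fst]
    simp only [toSquare_der_thd, map_neg, LinearMap.neg_apply, neg_neg,
      brSameLeft_mat2 S (hv _) (hw _), toSquare_der_fst, Pi.zero_apply, map_zero, smul_zero,
      mat2_tElem_one_one, add_zero]
  · rw [squareBracket_snd]
    simp only [toSquare_der_thd, map_neg, LinearMap.neg_apply, neg_neg, toSquare_snd,
      brSameRight_mat2 S (hv _) (hw _), K.triple_superComm hS hD hE, mat2_polar_one_one, tSum,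
      Pi.smul_apply]
    match_scalars <;> grind
  · rw [squareBracket_thd]
    simp only [toSquare_der_thd, toSquare_der_fst, map_neg, LinearMap.neg_apply, Pi.zero_apply,
      map_zero, LinearMap.zero_apply, sub_zero, neg_neg, toSquare_snd, actRight_mat2,
      superFlip_actRight_mat2 S (hv _) (K.triple_hom hE.1 _), brNext_mat2 S (hv _) (hw _),
      superFlip_brNext_mat2 S (hv _) (hw _), mat2_para_mul, mat2_bar_one, mul_one,
      K.vec_superComm hS hD hE]
    simp only [TensorProduct.tmul_sub, TensorProduct.tmul_smul]
    match_scalars <;> grind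

end HermitianCoordinates

/-! ### The triality algebra of Mat₂(k) -/

section

variable {k : Type*} [Field k]

/-- The triples of operators `z ↦ q_{m+2} z - z q_{m+1}` on `Mat₂(k)`. -/
def mat2Triple (q : Fin 3 → Matrix (Fin 2) (Fin 2) k) :
    Fin 3 → Module.End k (Matrix (Fin 2) (Fin 2) k) := fun m =>
  LinearMap.mulLeft k (q (m + 2)) - LinearMap.mulRight k (q (m + 1))

theorem mat2Triple_apply (q : Fin 3 → Matrix (Fin 2) (Fin 2) k) (m : Fin 3)
    (z : Matrix (Fin 2) (Fin 2) k) : mat2Triple q m z = q (m + 2) * z - z * q (m + 1) := rfl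

theorem mat2_bar_mul (x y : Matrix (Fin 2) (Fin 2) k) :
    (mat2 k).bar (x * y) = (mat2 k).bar y * (mat2 k).bar x := by
  have h := (mat2 k).bar_mul (mat2_mem_zero x) (mat2_mem_zero y)
  rwa [ksign_zero_left, one_smul] at h

/-- Trace zero makes the operators skew for b. In the triality relation conjugation turns q into -q
and reverses products, and the two terms with q₀ between x̄ and ȳ cancel. -/
theorem mat2Triple_mem {q : Fin 3 → Matrix (Fin 2) (Fin 2) k}
    (hq : ∀ m, q m ∈ (mat2 k).traceZero) : mat2Triple q ∈ triPart (mat2 k).para 0 := by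
  refine mem_triPart.2 ⟨fun m => mat2_hom_mem _, fun m j l x y _ _ => ?_, fun j l x y _ _ => ?_⟩
  · rw [ksign_zero_left, one_mul, mat2_para_polar, mat2_para_polar, mat2Triple_apply,
      mat2Triple_apply]
    have h1 := mem_traceZero.1 (hq (m + 1))
    have h2 := mem_traceZero.1 (hq (m + 2))
    generalize q (m + 1) = r at *
    generalize q (m + 2) = s at *
    rw [Matrix.trace_fin_two] at h1 h2
    have hr : r 1 1 = -r 0 0 := by linear_combination h1
    have hs : s 1 1 = -s 0 0 := by linear_combination h2
    clear h1 h2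
    simp only [mat2_polar_eq, Matrix.trace_fin_two, Matrix.sub_apply, Matrix.mul_apply,
      Fin.sum_univ_two, hr, hs]
    ring
  · rw [ksign_zero_left, one_smul]
    simp only [mat2_para_mul, mat2Triple_apply]
    simp only [map_sub, mat2_bar_mul, mat2_bar_of_mem (hq _)]
    have e : (0 : Fin 3) + 2 = 2 ∧ (0 : Fin 3) + 1 = 1 ∧ (1 : Fin 3) + 2 = 0 ∧ (1 : Fin 3) + 1 = 2 ∧
        (2 : Fin 3) + 2 = 1 ∧ (2 : Fin 3) + 1 = 0 := by decide
    obtain ⟨e1, e2, e3, e4, e5, e6⟩ := e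
    rw [e1, e2, e3, e4, e5, e6]
    noncomm_ring

theorem mat2_derivation_inner {e : Module.End k (Matrix (Fin 2) (Fin 2) k)}
    (he : ∀ x y, e (x * y) = e x * y + x * e y) :
    ∃ p : Matrix (Fin 2) (Fin 2) k, ∀ x, e x = p * x - x * p := by
  -- The witness is p = ∑ e(E_{i0}) E_{0i}. Since ∑ E_{i0} ⊗ E_{0i} is the same whether multiplied
  -- by x on the left or on the right, and ∑ E_{i0} E_{0i} = 1, the commutator with p is e.
  refine ⟨e !![1, 0; 0, 0] * !![1, 0; 0, 0] + e !![0, 0; 1, 0] * !![0, 1; 0, 0], fun x => ?_⟩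
  have h1 : x * !![1, 0; 0, 0] = x 0 0 • !![1, 0; 0, 0] + x 1 0 • !![0, 0; 1, 0] := by
    ext i j
    fin_cases i <;> fin_cases j <;> simp [Matrix.mul_apply, Fin.sum_univ_two]
  have h2 : x * !![0, 0; 1, 0] = x 0 1 • !![1, 0; 0, 0] + x 1 1 • !![0, 0; 1, 0] := by
    ext i j
    fin_cases i <;> fin_cases j <;> simp [Matrix.mul_apply, Fin.sum_univ_two]
  have h3 : (!![1, 0; 0, 0] : Matrix (Fin 2) (Fin 2) k) * x =
      x 0 0 • !![1, 0; 0, 0] + x 0 1 • !![0, 1; 0, 0] := by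
    ext i j
    fin_cases i <;> fin_cases j <;> simp [Matrix.mul_apply, Fin.sum_univ_two]
  have h4 : (!![0, 1; 0, 0] : Matrix (Fin 2) (Fin 2) k) * x =
      x 1 0 • !![1, 0; 0, 0] + x 1 1 • !![0, 1; 0, 0] := by
    ext i j
    fin_cases i <;> fin_cases j <;> simp [Matrix.mul_apply, Fin.sum_univ_two]
  have h5 : (1 : Matrix (Fin 2) (Fin 2) k) =
      !![1, 0; 0, 0] * !![1, 0; 0, 0] + !![0, 0; 1, 0] * !![0, 1; 0, 0] := by
    ext i j
    fin_cases i <;> fin_cases j <;> simp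
  have e1 := he x !![1, 0; 0, 0]
  have e2 := he x !![0, 0; 1, 0]
  rw [h1, map_add, map_smul, map_smul, ← sub_eq_iff_eq_add'] at e1
  rw [h2, map_add, map_smul, map_smul, ← sub_eq_iff_eq_add'] at e2
  rw [add_mul, mul_assoc, mul_assoc, h3, h4, mul_add x, ← mul_assoc x, ← mul_assoc x, ← e1, ← e2]
  conv_lhs => rw [← mul_one (e x), h5]
  simp only [mul_add, add_mul, sub_mul, smul_mul_assoc, mul_smul_comm, mul_assoc]
  abel

variable [CharP k 3]

/-- In characteristic 3 this is the usual projection q - tr(q)/2 onto the trace zero part. -/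
theorem add_trace_mem (p : Matrix (Fin 2) (Fin 2) k) : p + p.trace • 1 ∈ (mat2 k).traceZero := by
  rw [mem_traceZero, Matrix.trace_add, Matrix.trace_smul, Matrix.trace_one, Fintype.card_fin]
  have h3 : (3 : k) = 0 := CharP.cast_eq_zero k 3
  rw [smul_eq_mul]
  push_cast
  linear_combination p.trace * h3

/-- After a correction by a known triple, d₁ and d₂ kill 1 and commute with conjugation; triality
for the ordinary product then forces all three components to be one derivation of Mat₂(k), which is
inner. -/
theorem exists_mat2Triple {d : Fin 3 → Module.End k (Matrix (Fin 2) (Fin 2) k)}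
    (hd : d ∈ triPart (mat2 k).para 0) :
    ∃ q, (∀ m, q m ∈ (mat2 k).traceZero) ∧ d = mat2Triple q := by
  have htr : ∀ {d : Fin 3 → Module.End k (Matrix (Fin 2) (Fin 2) k)},
      d ∈ triPart (mat2 k).para 0 → ∀ m x, (d m x).trace = -(mat2 k).polar x (d m 1) := by
    intro d hd m x
    have h := (mem_triPart.1 hd).2.1 m 0 0 x 1 (mat2_para_mem x) (mat2_para_mem 1)
    rw [ksign_zero_left, one_mul, mat2_para_polar, mat2_para_polar, mat2_polar_eq] at h
    rw [Matrix.trace_one, Fintype.card_fin, mul_one] at h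
    push_cast at h
    linear_combination h
  have h1 : ∀ m, d m 1 ∈ (mat2 k).traceZero := by
    intro m
    have h := htr hd m 1
    rw [mat2_polar_eq, Matrix.trace_one, Fintype.card_fin, one_mul] at h
    push_cast at h
    rw [mem_traceZero]
    have h3 : (3 : k) = 0 := CharP.cast_eq_zero k 3
    linear_combination -h + (d m 1).trace * h3
  -- Chosen so that the components 1 and 2 of the corresponding triple take 1 to d₁(1) and d₂(1).
  set q : Fin 3 → Matrix (Fin 2) (Fin 2) k := ![0, d 2 1, -d 1 1] with hqdef
  have hq : ∀ m, q m ∈ (mat2 k).traceZero := by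
    intro m
    fin_cases m
    · exact zero_mem _
    · exact h1 2
    · exact neg_mem (h1 1)
  have he := sub_mem hd (mat2Triple_mem hq)
  set e := d - mat2Triple q with hedef
  have e1 : e 1 1 = 0 := by
    rw [hedef, Pi.sub_apply, LinearMap.sub_apply, mat2Triple_apply]
    change d 1 1 - ((0 : Matrix (Fin 2) (Fin 2) k) * 1 - 1 * -d 1 1) = 0
    simp
  have e2 : e 2 1 = 0 := by
    rw [hedef, Pi.sub_apply, LinearMap.sub_apply, mat2Triple_apply]
    change d 2 1 - (d 2 1 * 1 - 1 * (0 : Matrix (Fin 2) (Fin 2) k)) = 0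
    simp
  have t1 : ∀ x, (mat2 k).bar (e 1 x) = e 1 ((mat2 k).bar x) := by
    intro x
    rw [mat2_bar, mat2_bar, htr he, e1, map_zero, map_sub, map_smul, e1]
    simp
  have t2 : ∀ x, (mat2 k).bar (e 2 x) = e 2 ((mat2 k).bar x) := by
    intro x
    rw [mat2_bar, mat2_bar, htr he, e2, map_zero, map_sub, map_smul, e2]
    simp
  -- Conjugated arguments turn the para-product back into the matrix product.
  have ht : ∀ x y, e 0 (x * y) = e 1 x * y + x * e 2 y := by
    intro x y
    have h := (mem_triPart.1 he).2.2 0 0 ((mat2 k).bar x) ((mat2 k).bar y) (mat2_para_mem _)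
      (mat2_para_mem _)
    have hbb : ∀ z, (mat2 k).bar ((mat2 k).bar z) = z := (mat2 k).bar_bar
    rw [ksign_zero_left, one_smul, mat2_para_mul, mat2_para_mul, mat2_para_mul, t1, t2, hbb,
      hbb] at h
    exact h
  have e01 : ∀ x, e 0 x = e 1 x := fun x => by
    have h := ht x 1
    rwa [e2, mul_zero, mul_one, mul_one, add_zero] at h
  have e02 : ∀ x, e 0 x = e 2 x := fun x => by
    have h := ht 1 x
    rwa [e1, zero_mul, one_mul, one_mul, zero_add] at h
  obtain ⟨p, hp⟩ := mat2_derivation_inner (e := e 0) fun x y => by rw [ht, e01 x, e02 y]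
  have hp' : ∀ m x, e m x = p * x - x * p := by
    intro m x
    fin_cases m
    · exact hp x
    · exact (e01 x).symm.trans (hp x)
    · exact (e02 x).symm.trans (hp x)
  -- A constant triple (p, p, p) gives the commutator with p, which is unchanged when p is made
  -- traceless by adding a scalar.
  refine ⟨fun m => q m + (p + p.trace • 1), fun m => add_mem (hq m) (add_trace_mem p), ?_⟩
  funext m
  refine LinearMap.ext fun x => ?_
  have h : d m x = e m x + mat2Triple q m x := by
    rw [hedef, Pi.sub_apply, LinearMap.sub_apply, sub_add_cancel]
  rw [h, hp', mat2Triple_apply, mat2Triple_apply]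
  simp only [add_mul, mul_add, smul_mul_assoc, mul_smul_comm, one_mul, mul_one]
  abel

theorem mem_tri_mat2 {d : Fin 3 → Module.End k (Matrix (Fin 2) (Fin 2) k)} :
    d ∈ tri (mat2 k).para ↔ ∃ q, (∀ m, q m ∈ (mat2 k).traceZero) ∧ d = mat2Triple q := by
  constructor
  · intro hd
    obtain ⟨d0, h0, d1, h1, rfl⟩ := Submodule.mem_sup.1 hd
    have h : d1 = 0 := funext fun m => by
      have h' := Grading.pr_of_mem (mat2_hom_mem (d1 m)) 1
      rw [Grading.mem_part.1 ((mem_triPart.1 h1).1 m)] at h'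
      simpa using h'
    rw [h, add_zero]
    exact exists_mat2Triple h0
  · rintro ⟨q, hq, rfl⟩
    exact (le_sup_left : _ ≤ tri (mat2 k).para) (mat2Triple_mem hq)

/-- Evaluation at 1 shows that the q_m coincide; the common value is then central, and a scalar of
trace zero vanishes as 2 ≠ 0. -/
theorem mat2Triple_injective {q : Fin 3 → Matrix (Fin 2) (Fin 2) k}
    (hq : ∀ m, q m ∈ (mat2 k).traceZero) (h : mat2Triple q = 0) (m : Fin 3) : q m = 0 := by
  have h1 : ∀ m z, q (m + 2) * z = z * q (m + 1) := fun m z => by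
    rw [← sub_eq_zero, ← mat2Triple_apply, h]
    rfl
  have h2 : ∀ m, q (m + 2) = q (m + 1) := fun m => by simpa using h1 m 1
  have h3 : ∀ z, q m * z = z * q m := fun z => by
    have h := h1 (m + 1) z
    obtain ⟨f1, f2, f3, f4⟩ := fin_three_add m
    have h' := h2 (m + 1)
    rw [f2, f1] at h h'
    rwa [← h'] at h
  have ht := mem_traceZero.1 (hq m)
  rw [Matrix.trace_fin_two] at ht
  have a := h3 !![1, 0; 0, 0]
  have b := h3 !![0, 1; 0, 0]
  have a01 := congrFun (congrFun a 0) 1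
  have a10 := congrFun (congrFun a 1) 0
  have b01 := congrFun (congrFun b 0) 1
  simp [Matrix.mul_apply, Fin.sum_univ_two] at a01 a10 b01
  ext i j
  fin_cases i <;> fin_cases j <;> simp [*] <;> grind

end

/-! ### Bijectivity between TKK(J) and g(S₄, S) -/

namespace HermitianCoordinates

variable {k A H : Type*} [Field k] [AddCommGroup A] [Module k A] [AddCommGroup H]
  [Module k H] {S : NormedSuperalgebra k A} {J : Superalgebra k H} (K : HermitianCoordinates S J)

theorem toSquare_bracket_gen [CharP k 3] (hS : SymmComposition S) {i j : ZMod 2}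
    {X Y : (Matrix (Fin 2) (Fin 2) k ⊗[k] H) × Module.End k H} (hX : X ∈ tkkGen J i)
    (hY : Y ∈ tkkGen J j) : K.toSquare ((TKK J).bracket X Y) =
      squareBracket (mat2 k).para S (K.toSquare X) (K.toSquare Y) := by
  rcases hX with ⟨q, hq, x, hx, rfl⟩ | ⟨D, hD, rfl⟩ <;>
    rcases hY with ⟨r, hr, y, hy, rfl⟩ | ⟨E, hE, rfl⟩
  · rw [K.toSquare_tmul_tmul hS hq hr hx hy]
  · rw [K.toSquare_tmul_der hS hE hq hx]
  · rw [K.toSquare_der_tmul hS hD hr hy]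
  · rw [K.toSquare_der_der hS hD hE]

theorem toSquare_bracket [CharP k 3] (hS : SymmComposition S)
    {X Y : (Matrix (Fin 2) (Fin 2) k ⊗[k] H) × Module.End k H} (hX : X ∈ (TKK J).carrier)
    (hY : Y ∈ (TKK J).carrier) : K.toSquare ((TKK J).bracket X Y) =
      squareBracket (mat2 k).para S (K.toSquare X) (K.toSquare Y) := by
  rw [tkk_carrier_eq_span] at hX hY
  induction hX using Submodule.span_induction with
  | zero => simp only [map_zero, LinearMap.zero_apply]
  | add X X' _ _ h h' => simp only [map_add, LinearMap.add_apply, h, h']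
  | smul c X _ h => simp only [map_smul, LinearMap.smul_apply, h]
  | mem X hX =>
    induction hY using Submodule.span_induction with
    | zero => simp only [map_zero]
    | add Y Y' _ _ h h' => simp only [map_add, h, h']
    | smul c Y _ h => simp only [map_smul, h]
    | mem Y hY =>
      rcases hX with hX | hX <;> rcases hY with hY | hY
      · exact K.toSquare_bracket_gen hS hX hY
      · exact K.toSquare_bracket_gen hS hX hY
      · exact K.toSquare_bracket_gen hS hX hY
      · exact K.toSquare_bracket_gen hS hX hY

/-- The coordinates in `Mat₂(k)` of the elements of `Mat₂(k) ⊗ J`. -/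
def tensorDiag (m : Fin 3) : Matrix (Fin 2) (Fin 2) k ⊗[k] H →ₗ[k] Matrix (Fin 2) (Fin 2) k :=
  (TensorProduct.rid k _).toLinearMap ∘ₗ LinearMap.lTensor (Matrix (Fin 2) (Fin 2) k) (K.diagMap m)

/-- The coordinates in `Mat₂(k) ⊗ S` of the elements of `Mat₂(k) ⊗ J`. -/
def tensorOff (m : Fin 3) :
    Matrix (Fin 2) (Fin 2) k ⊗[k] H →ₗ[k] Matrix (Fin 2) (Fin 2) k ⊗[k] A :=
  LinearMap.lTensor (Matrix (Fin 2) (Fin 2) k) (K.offMap m)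

/-- The element of `Mat₂(k) ⊗ J` with given coordinates. -/
def tensorMk (q : Fin 3 → Matrix (Fin 2) (Fin 2) k) (y : Fin 3 → Matrix (Fin 2) (Fin 2) k ⊗[k] A) :
    Matrix (Fin 2) (Fin 2) k ⊗[k] H :=
  ∑ i, q i ⊗ₜ K.idem i + ∑ m, LinearMap.lTensor (Matrix (Fin 2) (Fin 2) k) (K.inj m) (y m)

theorem tensorMk_tensorDiag (t : Matrix (Fin 2) (Fin 2) k ⊗[k] H) :
    K.tensorMk (fun m => K.tensorDiag m t) (fun m => K.tensorOff m t) = t := by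
  induction t with
  | zero => simp [tensorMk]
  | add t u ht hu =>
    conv_rhs => rw [← ht, ← hu]
    simp only [tensorMk, map_add, TensorProduct.add_tmul, Finset.sum_add_distrib]
    abel
  | tmul q X =>
    conv_rhs => rw [K.sum_expand X]
    simp [tensorMk, tensorDiag, tensorOff, TensorProduct.tmul_add, TensorProduct.tmul_sum,
      diagMap_apply, offMap_apply, TensorProduct.smul_tmul]

theorem tensorDiag_tensorMk (q : Fin 3 → Matrix (Fin 2) (Fin 2) k)
    (y : Fin 3 → Matrix (Fin 2) (Fin 2) k ⊗[k] A) (m : Fin 3) :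
    K.tensorDiag m (K.tensorMk q y) = q m := by
  have h : ∀ i, K.diagMap m ∘ₗ K.inj i = 0 := fun i => LinearMap.ext fun c => K.diag_inj i m c
  rw [tensorMk, map_add, map_sum, map_sum]
  simp only [tensorDiag, LinearMap.comp_apply, ← LinearMap.lTensor_comp_apply, h]
  simp [diagMap_apply, diag_idem]

theorem tensorOff_tensorMk (q : Fin 3 → Matrix (Fin 2) (Fin 2) k)
    (y : Fin 3 → Matrix (Fin 2) (Fin 2) k ⊗[k] A) (m : Fin 3) :
    K.tensorOff m (K.tensorMk q y) = y m := by
  have h : ∀ i, K.offMap m ∘ₗ K.inj i = if m = i then LinearMap.id else 0 := fun i =>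
    LinearMap.ext fun c => by
      rw [LinearMap.comp_apply, offMap_apply, off_inj]
      split_ifs <;> rfl
  rw [tensorMk, map_add, map_sum, map_sum]
  simp only [tensorOff, ← LinearMap.lTensor_comp_apply, h]
  simp [offMap_apply, off_idem, apply_ite, ite_apply]

theorem toSquare_fst_eq (t : Matrix (Fin 2) (Fin 2) k ⊗[k] H) (D : Module.End k H) :
    (K.toSquare (t, D)).1 = mat2Triple fun m => K.tensorDiag m t := by
  funext m
  refine LinearMap.ext fun z => ?_
  rw [mat2Triple_apply]
  induction t with
  | zero => simp [toSquare]
  | add t u ht hu =>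
    -- The derivation is counted twice in the sum; it does not affect the component in tri(S₄), so
    -- the correction is harmless.
    have h : (t + u, D) = (t, D) + (u, D) - ((0 : Matrix (Fin 2) (Fin 2) k ⊗[k] H), D) := by simp
    rw [h, map_sub, map_add, Prod.fst_sub, Prod.fst_add, toSquare_der_fst, sub_zero, Pi.add_apply,
      LinearMap.add_apply, ht, hu, map_add, map_add, add_mul, mul_add]
    abel
  | tmul q X =>
    rw [toSquare_fst]
    simp [tensorDiag, diagMap_apply]

theorem toSquare_thd_eq (t : Matrix (Fin 2) (Fin 2) k ⊗[k] H) (D : Module.End k H) (m : Fin 3) :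
    (K.toSquare (t, D)).2.2 m = -K.tensorOff m t - 1 ⊗ₜ K.vec D m := rfl

/-- The map `q ⊗ x ↦ tr(q) x`. -/
def tensorTrace (k B : Type*) [Field k] [AddCommGroup B] [Module k B] :
    Matrix (Fin 2) (Fin 2) k ⊗[k] B →ₗ[k] B :=
  (TensorProduct.lid k B).toLinearMap ∘ₗ LinearMap.rTensor B (Matrix.traceLinearMap (Fin 2) k k)

theorem tensorTrace_tmul {B : Type*} [AddCommGroup B] [Module k B]
    (q : Matrix (Fin 2) (Fin 2) k) (x : B) : tensorTrace k B (q ⊗ₜ x) = q.trace • x := by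
  simp [tensorTrace]

theorem tensorTrace_of_mem {B : Type*} [AddCommGroup B] [Module k B]
    {t : Matrix (Fin 2) (Fin 2) k ⊗[k] B}
    (ht : t ∈ LinearMap.range (LinearMap.rTensor B (mat2 k).traceZero.subtype)) :
    tensorTrace k B t = 0 := by
  obtain ⟨u, rfl⟩ := ht
  induction u with
  | zero => rw [map_zero, map_zero]
  | add u v hu hv => rw [map_add, map_add, hu, hv, add_zero]
  | tmul q x =>
    rw [LinearMap.rTensor_tmul, tensorTrace_tmul, Submodule.subtype_apply, mem_traceZero.1 q.2,
      zero_smul]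

/-- The projection of Mat₂ ⊗ B onto sl₂ ⊗ B along 1 ⊗ B. It separates the contributions of sl₂ ⊗ J
and of der J to Mat₂ ⊗ S. -/
theorem add_tensorTrace_mem [CharP k 3] {B : Type*} [AddCommGroup B] [Module k B]
    (t : Matrix (Fin 2) (Fin 2) k ⊗[k] B) : t + 1 ⊗ₜ tensorTrace k B t ∈
      LinearMap.range (LinearMap.rTensor B (mat2 k).traceZero.subtype) := by
  induction t with
  | zero => rw [map_zero, TensorProduct.tmul_zero, add_zero]; exact zero_mem _
  | add t u ht hu =>
    rw [map_add, TensorProduct.tmul_add, add_add_add_comm]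
    exact add_mem ht hu
  | tmul q x =>
    refine ⟨⟨q + q.trace • 1, add_trace_mem q⟩ ⊗ₜ x, ?_⟩
    rw [LinearMap.rTensor_tmul, tensorTrace_tmul, Submodule.subtype_apply, TensorProduct.add_tmul,
      TensorProduct.smul_tmul]

theorem range_lTensor_mem {B C : Type*} [AddCommGroup B] [Module k B] [AddCommGroup C] [Module k C]
    (f : B →ₗ[k] C) {t : Matrix (Fin 2) (Fin 2) k ⊗[k] B}
    (ht : t ∈ LinearMap.range (LinearMap.rTensor B (mat2 k).traceZero.subtype)) :
    LinearMap.lTensor (Matrix (Fin 2) (Fin 2) k) f t ∈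
      LinearMap.range (LinearMap.rTensor C (mat2 k).traceZero.subtype) := by
  obtain ⟨u, rfl⟩ := ht
  refine ⟨LinearMap.lTensor _ f u, ?_⟩
  rw [← LinearMap.comp_apply, ← LinearMap.comp_apply, LinearMap.rTensor_comp_lTensor,
    LinearMap.lTensor_comp_rTensor]

theorem tensorDiag_mem {t : Matrix (Fin 2) (Fin 2) k ⊗[k] H}
    (ht : t ∈ LinearMap.range (LinearMap.rTensor H (mat2 k).traceZero.subtype)) (m : Fin 3) :
    K.tensorDiag m t ∈ (mat2 k).traceZero := by
  obtain ⟨u, rfl⟩ := ht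
  induction u with
  | zero => rw [map_zero, map_zero]; exact zero_mem _
  | add u v hu hv => rw [map_add, map_add]; exact add_mem hu hv
  | tmul q x =>
    rw [LinearMap.rTensor_tmul, tensorDiag, LinearMap.comp_apply, LinearMap.lTensor_tmul]
    exact Submodule.smul_mem _ _ q.2

variable [CharP k 3]

theorem der_eq_of_mem (hS : SymmComposition S) {D : Module.End k H} (hD : D ∈ der J) :
    K.triple D ∈ tri S ∧ K.derOp (K.triple D, K.vec D) = D := by
  obtain ⟨D0, h0, D1, h1, rfl⟩ := Submodule.mem_sup.1 hD
  obtain ⟨a0, b0⟩ := K.der_eq hS h0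
  obtain ⟨a1, b1⟩ := K.der_eq hS h1
  refine ⟨?_, ?_⟩
  · rw [map_add]
    exact Submodule.add_mem_sup a0 a1
  · rw [map_add, map_add, ← Prod.mk_add_mk, map_add, b0, b1]

/-- The vector need not be homogeneous: its even part goes with the even part of d, and its odd part
with the odd one. -/
theorem derOp_mem_der (hS : SymmComposition S) {d : Fin 3 → Module.End k A} (hd : d ∈ tri S)
    (v : Fin 3 → A) : K.derOp (d, v) ∈ der J := by
  obtain ⟨d0, h0, d1, h1, rfl⟩ := Submodule.mem_sup.1 hd
  have hv : v = (fun m => S.grading.pr 0 (v m)) + fun m => S.grading.pr 1 (v m) :=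
    funext fun m => (S.grading.pr_add (v m)).symm
  rw [hv, ← Prod.mk_add_mk, map_add]
  exact Submodule.add_mem_sup (K.derOp_mem hS h0 fun m => S.grading.pr_mem _ _)
    (K.derOp_mem hS h1 fun m => S.grading.pr_mem _ _)

theorem toSquare_mem (hS : SymmComposition S)
    {X : (Matrix (Fin 2) (Fin 2) k ⊗[k] H) × Module.End k H} (hX : X ∈ (TKK J).carrier) :
    K.toSquare X ∈ (supermagic (mat2 k).para S).carrier := by
  obtain ⟨t, D⟩ := X
  obtain ⟨ht, hD⟩ := hX
  refine ⟨?_, (K.der_eq_of_mem hS hD).1, trivial⟩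
  rw [toSquare_fst_eq]
  exact mem_tri_mat2.2 ⟨_, K.tensorDiag_mem ht, rfl⟩

theorem toSquare_injOn (hS : SymmComposition S)
    {X : (Matrix (Fin 2) (Fin 2) k ⊗[k] H) × Module.End k H} (hX : X ∈ (TKK J).carrier)
    (h : K.toSquare X = 0) : X = 0 := by
  obtain ⟨t, D⟩ := X
  obtain ⟨ht, hD⟩ := hX
  have h1 := congrArg Prod.fst h
  have h2 : K.triple D = 0 := congrArg (fun Z => Z.2.1) h
  rw [toSquare_fst_eq] at h1
  have hq := mat2Triple_injective (K.tensorDiag_mem ht) h1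
  have h3 : ∀ m, -K.tensorOff m t - 1 ⊗ₜ K.vec D m = 0 := fun m => by
    rw [← toSquare_thd_eq, h]
    rfl
  -- The trace kills the part in sl₂ ⊗ S and multiplies 1 ⊗ v by tr 1 = 2, which is invertible.
  have hv : ∀ m, K.vec D m = 0 := fun m => by
    have h' := congrArg (tensorTrace k A) (h3 m)
    rw [map_zero, map_sub, map_neg, tensorOff, tensorTrace_of_mem (range_lTensor_mem _ ht), neg_zero,
      zero_sub, tensorTrace_tmul, Matrix.trace_one, Fintype.card_fin, Nat.cast_two, two_eq_neg_one,
      neg_one_smul, neg_neg] at h'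
    exact h'
  have ho : ∀ m, K.tensorOff m t = 0 := fun m => by
    have h' := h3 m
    rwa [hv, TensorProduct.tmul_zero, sub_zero, neg_eq_zero] at h'
  have hD' := (K.der_eq_of_mem hS hD).2
  rw [h2, show K.vec D = 0 from funext hv, Prod.mk_zero_zero, map_zero] at hD'
  have ht' := K.tensorMk_tensorDiag t
  have hq' : ∀ m, K.tensorDiag m t = 0 := hq
  have ht0 : t = 0 := by
    rw [← ht']
    simp [tensorMk, hq', ho]
  have hD0 : D = 0 := hD'.symm
  rw [ht0, hD0, Prod.mk_zero_zero]

theorem toSquare_surjOn (hS : SymmComposition S) {Z : Amb k (Matrix (Fin 2) (Fin 2) k) A}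
    (hZ : Z ∈ (supermagic (mat2 k).para S).carrier) :
    ∃ X ∈ (TKK J).carrier, K.toSquare X = Z := by
  obtain ⟨d, d', z⟩ := Z
  obtain ⟨hd, hd', -⟩ := hZ
  obtain ⟨q, hq, hdq⟩ := mem_tri_mat2.1 hd
  -- The preimage comes from z = (z + 1 ⊗ tr z) - 1 ⊗ tr z: the first summand lies in sl₂ ⊗ S, and
  -- the second is the image of the vector tr z.
  refine ⟨(K.tensorMk q fun m => -(z m + 1 ⊗ₜ tensorTrace k A (z m)),
    K.derOp (d', fun m => tensorTrace k A (z m))), ⟨?_, K.derOp_mem_der hS hd' _⟩, ?_⟩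
  · refine add_mem (sum_mem fun i _ => ⟨⟨q i, hq i⟩ ⊗ₜ K.idem i, rfl⟩) (sum_mem fun m _ => ?_)
    exact range_lTensor_mem _ (neg_mem (add_tensorTrace_mem _))
  · refine Prod.ext ?_ (Prod.ext ?_ (funext fun m => ?_))
    · rw [toSquare_fst_eq]
      simp only [tensorDiag_tensorMk]
      exact hdq.symm
    · rw [toSquare_snd, triple_derOp]
    · rw [toSquare_thd_eq, tensorOff_tensorMk, vec_derOp]
      abel

end HermitianCoordinates

/-! ### Compatibility with the gradings -/

namespace HermitianCoordinates

variable {k A H : Type*} [Field k] [AddCommGroup A] [Module k A] [AddCommGroup H]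
  [Module k H] {S : NormedSuperalgebra k A} {J : Superalgebra k H} (K : HermitianCoordinates S J)

theorem toSquare_part_gen {i : ZMod 2}
    {X : (Matrix (Fin 2) (Fin 2) k ⊗[k] H) × Module.End k H} (hX : X ∈ tkkGen J i) :
    K.toSquare X ∈ (ambGrading (mat2 k).para S).part i := by
  refine Grading.mem_prod_part.2 ⟨Grading.mem_pi_part.2 fun m => ?_, Grading.mem_prod_part.2
    ⟨Grading.mem_pi_part.2 fun m => ?_, Grading.mem_pi_part.2 fun m => ?_⟩⟩
  · rcases hX with ⟨q, -, x, hx, rfl⟩ | ⟨D, -, rfl⟩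
    · rcases zmod_two_cases i with rfl | rfl
      · exact mat2_hom_mem _
      · have h : K.diag x = 0 := ((K.mem_part 1 x).1 hx).1 rfl
        have h0 : (K.toSquare (q ⊗ₜ x, 0)).1 m = 0 := LinearMap.ext fun z => by
          rw [toSquare_fst, h, Pi.zero_apply, Pi.zero_apply, zero_smul, zero_smul, sub_zero,
            LinearMap.zero_apply]
        rw [h0]
        exact zero_mem _
    · rw [toSquare_der_fst]
      exact zero_mem _
  · rcases hX with ⟨q, -, x, -, rfl⟩ | ⟨D, hD, rfl⟩
    · rw [toSquare_tmul_snd]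
      exact zero_mem _
    · exact K.triple_hom hD.1 m
  · rcases hX with ⟨q, -, x, hx, rfl⟩ | ⟨D, hD, rfl⟩
    · rw [toSquare_tmul_thd]
      exact neg_mem (mat2_tmul_mem S (K.off_mem hx m) q)
    · rw [toSquare_der_thd]
      exact neg_mem (mat2_tmul_mem S (K.vec_mem hD.1 m) 1)

theorem toSquare_part {i : ZMod 2} {X : (Matrix (Fin 2) (Fin 2) k ⊗[k] H) × Module.End k H}
    (hX : X ∈ (TKK J).carrier) (hi : X ∈ (TKK J).grading.part i) :
    K.toSquare X ∈ (ambGrading (mat2 k).para S).part i := by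
  rw [tkk_carrier_eq_span] at hX
  have h := BracketSpace.mem_span_of_mem (fun _ _ h => tkkGen_mem h) hX hi
  have hle : Submodule.span k (tkkGen J i) ≤
      ((ambGrading (mat2 k).para S).part i).comap K.toSquare :=
    Submodule.span_le.2 fun Y hY => K.toSquare_part_gen hY
  exact hle h

end HermitianCoordinates

/-! ### Transport of the Lie superalgebra structure -/

section

variable {k A B : Type*} [Field k] [AddCommGroup A] [Module k A] [AddCommGroup B] [Module k B]

/-- A linear map that identifies two bracket spaces, the first of which is a Lie superalgebra. -/
structure BracketSpace.Transport (L : BracketSpace k A) (M : BracketSpace k B) (f : A →ₗ[k] B) :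
    Prop where
  lie : L.IsLieSuperalgebra
  map_mem : ∀ x ∈ L.carrier, f x ∈ M.carrier
  injective : ∀ x ∈ L.carrier, f x = 0 → x = 0
  surjective : ∀ y ∈ M.carrier, ∃ x ∈ L.carrier, f x = y
  degree : ∀ i, ∀ x ∈ L.carrier, x ∈ L.grading.part i → f x ∈ M.grading.part i
  bracket : ∀ x ∈ L.carrier, ∀ y ∈ L.carrier, f (L.bracket x y) = M.bracket (f x) (f y)

namespace BracketSpace.Transport

variable {L : BracketSpace k A} {M : BracketSpace k B} {f : A →ₗ[k] B} (h : Transport L M f)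
include h

/-- A map that preserves degrees on a graded subspace commutes with the projections; together with
injectivity it therefore also reflects degrees. -/
theorem map_pr {x : A} (hx : x ∈ L.carrier) (i : ZMod 2) :
    f (L.grading.pr i x) = M.grading.pr i (f x) := by
  have hd : ∀ j, M.grading.pr i (f (L.grading.pr j x)) =
      if i = j then f (L.grading.pr j x) else 0 := fun j =>
    Grading.pr_of_mem (h.degree j _ (h.lie.pr_mem j x hx) (L.grading.pr_mem j x)) i
  conv_rhs => rw [← L.grading.pr_add x, map_add, map_add, hd, hd]
  rcases zmod_two_cases i with rfl | rfl <;> simp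

theorem eq_of_map_eq {x y : A} (hx : x ∈ L.carrier) (hy : y ∈ L.carrier) (hxy : f x = f y) :
    x = y :=
  sub_eq_zero.1 (h.injective _ (sub_mem hx hy) (by rw [map_sub, hxy, sub_self]))

theorem mem_part {x : A} (hx : x ∈ L.carrier) {i : ZMod 2} (hi : f x ∈ M.grading.part i) :
    x ∈ L.grading.part i :=
  Grading.mem_part.2 (h.eq_of_map_eq (h.lie.pr_mem i x hx) hx
    (by rw [h.map_pr hx, Grading.mem_part.1 hi]))

/-- Every axiom is checked on preimages, which are homogeneous of the right degree because degrees
are reflected. Nothing has to be known in advance about the bracket of the target. -/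
theorem isLieSuperalgebra : M.IsLieSuperalgebra where
  pr_mem i y hy := by
    obtain ⟨x, hx, rfl⟩ := h.surjective y hy
    rw [← h.map_pr hx]
    exact h.map_mem _ (h.lie.pr_mem i x hx)
  bracket_mem y hy y' hy' := by
    obtain ⟨x, hx, rfl⟩ := h.surjective y hy
    obtain ⟨x', hx', rfl⟩ := h.surjective y' hy'
    rw [← h.bracket x hx x' hx']
    exact h.map_mem _ (h.lie.bracket_mem x hx x' hx')
  bracket_degree i j y hy y' hy' hi hj := by
    obtain ⟨x, hx, rfl⟩ := h.surjective y hy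
    obtain ⟨x', hx', rfl⟩ := h.surjective y' hy'
    rw [← h.bracket x hx x' hx']
    exact h.degree _ _ (h.lie.bracket_mem x hx x' hx')
      (h.lie.bracket_degree i j x hx x' hx' (h.mem_part hx hi) (h.mem_part hx' hj))
  skew i j y hy y' hy' hi hj := by
    obtain ⟨x, hx, rfl⟩ := h.surjective y hy
    obtain ⟨x', hx', rfl⟩ := h.surjective y' hy'
    rw [← h.bracket x hx x' hx', ← h.bracket x' hx' x hx,
      h.lie.skew i j x hx x' hx' (h.mem_part hx hi) (h.mem_part hx' hj), map_neg, map_smul]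
  jacobi i j y hy y' hy' z hz hi hj := by
    obtain ⟨x, hx, rfl⟩ := h.surjective y hy
    obtain ⟨x', hx', rfl⟩ := h.surjective y' hy'
    obtain ⟨w, hw, rfl⟩ := h.surjective z hz
    have h1 := h.lie.bracket_mem x' hx' w hw
    have h2 := h.lie.bracket_mem x hx x' hx'
    have h3 := h.lie.bracket_mem x hx w hw
    rw [← h.bracket x' hx' w hw, ← h.bracket x hx x' hx', ← h.bracket x hx w hw,
      ← h.bracket x hx _ h1, ← h.bracket _ h2 w hw, ← h.bracket x' hx' _ h3,
      h.lie.jacobi i j x hx x' hx' w hw (h.mem_part hx hi) (h.mem_part hx' hj), map_add, map_smul]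
  odd_cube y hy hi := by
    obtain ⟨x, hx, rfl⟩ := h.surjective y hy
    rw [← h.bracket x hx x hx, ← h.bracket x hx _ (h.lie.bracket_mem x hx x hx),
      h.lie.odd_cube x hx (h.mem_part hx hi), map_zero]

theorem isomorphic : M.Isomorphic L := by
  let g : L.carrier →ₗ[k] M.carrier := f.restrict h.map_mem
  have hg : Function.Bijective g := by
    refine ⟨fun x y hxy => Subtype.ext (h.eq_of_map_eq x.2 y.2 (congrArg Subtype.val hxy)),
      fun y => ?_⟩
    obtain ⟨x, hx, hy⟩ := h.surjective y y.2
    exact ⟨⟨x, hx⟩, Subtype.ext hy⟩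
  let e := LinearEquiv.ofBijective g hg
  have he : ∀ y : M.carrier, f (e.symm y) = y := fun y => congrArg Subtype.val (e.apply_symm_apply y)
  -- The isomorphism goes from the target back to the source, so all its properties are those of the
  -- inverse and are tested after applying f.
  refine ⟨e.symm, fun i y hi => h.mem_part (e.symm y).2 (by rwa [he]), fun x y z hz => ?_⟩
  refine h.eq_of_map_eq (e.symm z).2 (h.lie.bracket_mem _ (e.symm x).2 _ (e.symm y).2) ?_
  rw [he, h.bracket _ (e.symm x).2 _ (e.symm y).2, he, he, hz]

end BracketSpace.Transport

end

/-! ### Conclusion for B(1,2) and B(4,2) -/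

section

variable {k A H : Type*} [Field k] [CharP k 3] [AddCommGroup A] [Module k A] [AddCommGroup H]
  [Module k H]

theorem HermitianCoordinates.transport {S : NormedSuperalgebra k A} {J : Superalgebra k H}
    (K : HermitianCoordinates S J) (hS : SymmComposition S) :
    (TKK J).Transport (supermagic (mat2 k).para S) K.toSquare where
  lie := TKK_isLieSuperalgebra (K.innerCyclic hS)
    (by rw [two_eq_neg_one]; exact neg_ne_zero.2 one_ne_zero)
  map_mem X hX := by exact K.toSquare_mem hS hX
  injective X hX h := by exact K.toSquare_injOn hS hX h
  surjective Z hZ := by exact K.toSquare_surjOn hS hZ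
  degree i X hX hi := by exact K.toSquare_part hX hi
  bracket X hX Y hY := by rw [K.toSquare_bracket hS hX hY]; rfl

theorem HurwitzSuperalgebra.tkk_isomorphic (C : HurwitzSuperalgebra k A)
    (hC : C.polar C.one C.one = 2) :
    (supermagic (mat2 k).para C.para).IsLieSuperalgebra ∧ (TKK C.H3).IsLieSuperalgebra ∧
      (supermagic (mat2 k).para C.para).Isomorphic (TKK C.H3) :=
  have h := (C.H3Coordinates hC).transport C.para_symmComposition
  ⟨h.isLieSuperalgebra, h.lie, h.isomorphic⟩

end

/-- The normalisation b(1,1) = 2 is the only fact about B(1,2) needed beyond its Hurwitz structure;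
it makes the diagonal coordinate of the unit equal to 1. Likewise for B(4,2). -/
theorem B12_polar_one {k V : Type*} [Field k] [CharP k 3] [AddCommGroup V] [Module k V]
    (P : SymplecticPlane k V) : (B12 P).polar (B12 P).one (B12 P).one = 2 := by
  change 2 * 1 * 1 + P.form 0 0 = 2
  rw [map_zero]
  norm_num

theorem B42_polar_one {k V : Type*} [Field k] [CharP k 3] [AddCommGroup V] [Module k V]
    (P : SymplecticPlane k V) : (B42 P).polar (B42 P).one (B42 P).one = 2 := by
  have h : LinearMap.trace k V 1 = 2 := by
    have := Module.finite_of_finrank_eq_succ P.finrank_eq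
    rw [LinearMap.trace_one, P.finrank_eq, Nat.cast_two]
  change endPolar 1 1 + P.form 0 0 = 2
  rw [map_zero, endPolar_apply, one_mul, h]
  ring

end SuperSquare

theorem corollary3p4 {k V : Type*} [Field k] [CharP k 3] [AddCommGroup V] [Module k V]
    (P : SuperSquare.SymplecticPlane k V) :
    ((SuperSquare.supermagic (SuperSquare.mat2 k).para
        (SuperSquare.B12 P).para).IsLieSuperalgebra ∧
      (SuperSquare.TKK (SuperSquare.B12 P).H3).IsLieSuperalgebra ∧
      (SuperSquare.supermagic (SuperSquare.mat2 k).para (SuperSquare.B12 P).para).Isomorphic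
        (SuperSquare.TKK (SuperSquare.B12 P).H3)) ∧
    ((SuperSquare.supermagic (SuperSquare.mat2 k).para
        (SuperSquare.B42 P).para).IsLieSuperalgebra ∧
      (SuperSquare.TKK (SuperSquare.B42 P).H3).IsLieSuperalgebra ∧
      (SuperSquare.supermagic (SuperSquare.mat2 k).para (SuperSquare.B42 P).para).Isomorphic
        (SuperSquare.TKK (SuperSquare.B42 P).H3)) :=
  ⟨SuperSquare.HurwitzSuperalgebra.tkk_isomorphic _ (SuperSquare.B12_polar_one P),
    SuperSquare.HurwitzSuperalgebra.tkk_isomorphic _ (SuperSquare.B42_polar_one P)⟩
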